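/- Let $A,\alpha\in\mathbb R$ with $A\notin\mathbb Z$, and write $\mathbb N=\{1,2,3,\dots\}$. Let $\Gamma$ be the ring chain with vertices $j\in\mathbb Z$, in which the vertices $j$ and $j+1$ are joined by two edges (the upper and the lower half-circle of the $j$-th ring), each parametrized by $[0,\pi]$ from $j$ to $j+1$; let $\psi_j$ and $\varphi_j$ be the components of a function on the upper and the lower edge, and put $\mathcal D\psi_j=\psi_j'+iA\psi_j$, $\mathcal D\varphi_j=\varphi_j'-iA\varphi_j$. The operator $-\Delta_\alpha$ in $L^2(\Gamma)$ acts as $-\mathcal D^2$ on each edge; its domain consists of all functions in $L^2(\Gamma)$ that are $H^2$ on each edge, are mapped by $-\mathcal D^2$ to $L^2(\Gamma)$, and satisfy, for every $j\in\mathbb Z$, $$\psi_j(0)=\varphi_j(0)=\psi_{j-1}(\pi)=\varphi_{j-1}(\pi),\qquad \mathcal D\psi_j(0)+\mathcal D\varphi_j(0)-\mathcal D\psi_{j-1}(\pi)-\mathcal D\varphi_{j-1}(\pi)=\alpha\,\psi_j(0).$$ Put $\eta(k)=\cos k\pi+\frac{\alpha}{4k}\sin k\pi$ for $k\in\mathbb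 C\setminus\{0\}$, $\eta(0)=1+\frac{\alpha\pi}{4}$, and $\xi(k)=\eta(k)/\cos A\pi$ if $\cos A\pi\ne0$. (i) If $A-\frac12\in\mathbb Z$, then $$\sigma(-\Delta_\alpha)=\{k^2\in\mathbb R:\ k\in\mathbb C,\ \eta(k)=0\}\cup\{k^2:\ k\in\mathbb N\},$$ every point of this set is an eigenvalue of infinite multiplicity, and the spectrum is pure point, i.e. the eigenvectors span a dense subspace of $L^2(\Gamma)$. (ii) If $A-\frac12\notin\mathbb Z$, then $\sigma(-\Delta_\alpha)=\{k^2:k\in\mathbb N\}\cup B$ with $B=\{k^2\in\mathbb R:\ k\in\mathbb C,\ |\xi(k)|\le1\}$. In particular, for $k\in(\mathbb R^+\cup i\mathbb R^+)\setminus\mathbb N$ one has $k^2\in\sigma(-\Delta_\alpha)$ if and only if $|\xi(k)|\le1$. The eigenvalues of $-\Delta_\alpha$ are exactly the numbers $k^2$, $k\in\mathbb N$, and each has infinite multiplicity. The orthogonal complement of the closed span of the eigenvectors is the absolutely continuous subspace of $-\Delta_\alpha$, and the absolutely continuous spectrum is $B$. The spectral bands, i.e. the connected components of the absolutely continuous spectrum,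 are compact intervals of positive length. There is a first (lowest) band, and every other band lies in $(n^2,(n+1)^2)$ for some $n\in\mathbb N$. The first band lies in $(0,1)$ if $\alpha>4(|\cos A\pi|-1)/\pi$, lies in $(-\infty,0)$ if $\alpha<-4(|\cos A\pi|+1)/\pi$, and contains $0$ otherwise. -/

import Mathlib

open MeasureTheory Set
open scoped ENNReal InnerProductSpace

noncomputable section

/-! ### Spectral notions for unbounded operators in a complex Hilbert space -/

namespace UnboundedOp

variable {H : Type*} [NormedAddCommGroup H] [InnerProductSpace ℂ H]

/-- The resolvent set: those `z` for which `T - z` maps the domain of `T` bijectively onto `H`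
with a bounded inverse `R`. -/
def resolventSet (T : H →ₗ.[ℂ] H) : Set ℂ :=
  {z | ∃ R : H →L[ℂ] H,
    (∀ h : H, ∃ f : T.domain, (f : H) = R h ∧ T f - z • (f : H) = h) ∧
    ∀ f : T.domain, R (T f - z • (f : H)) = f}

/-- The spectrum, the complement of the resolvent set. -/
def spec (T : H →ₗ.[ℂ] H) : Set ℂ := (resolventSet T)ᶜ

/-- The eigenspace `ker (T - z)`, as a subspace of `H`. -/
def eigenspace (T : H →ₗ.[ℂ] H) (z : ℂ) : Submodule ℂ H :=
  (LinearMap.ker (T.toFun - z • T.domain.subtype)).map T.domain.subtype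

/-- The set of eigenvalues. -/
def eigenvalues (T : H →ₗ.[ℂ] H) : Set ℂ := {z | eigenspace T z ≠ ⊥}

/-- `z` is an eigenvalue of infinite multiplicity. -/
def IsInfinitelyDegenerate (T : H →ₗ.[ℂ] H) (z : ℂ) : Prop :=
  ¬ FiniteDimensional ℂ (eigenspace T z)

/-- The pure point subspace: the closed linear span of all eigenvectors. -/
def ppSubspace (T : H →ₗ.[ℂ] H) : Submodule ℂ H :=
  (⨆ z : ℂ, eigenspace T z).topologicalClosure

/-- `μ` is the spectral measure of the vector `ψ` with respect to `T`: the finite Borel measure on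
`ℝ` with `⟨ψ, (T - z)⁻¹ ψ⟩ = ∫ (t - z)⁻¹ dμ(t)` for every non-real `z`. A finite measure is
determined by this transform, and for self-adjoint `T` such a measure exists for every `ψ`. -/
def IsSpectralMeasure (T : H →ₗ.[ℂ] H) (ψ : H) (μ : Measure ℝ) : Prop :=
  IsFiniteMeasure μ ∧ ∀ z : ℂ, z.im ≠ 0 →
    ∃ f : T.domain, T f - z • (f : H) = ψ ∧ ⟪ψ, (f : H)⟫_ℂ = ∫ t : ℝ, ((t : ℂ) - z)⁻¹ ∂μ

/-- The absolutely continuous subspace: the vectors whose spectral measure is absolutely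
continuous with respect to Lebesgue measure. -/
def acSubspace (T : H →ₗ.[ℂ] H) : Set H :=
  {ψ | ∃ μ : Measure ℝ, IsSpectralMeasure T ψ μ ∧ μ ≪ volume}

/-- The absolutely continuous spectrum, that is the spectrum of the part of `T` in the absolutely
continuous subspace: `E` belongs to it iff every neighbourhood of `E` is charged by the spectral
measure of some vector of that subspace. -/
def acSpectrum (T : H →ₗ.[ℂ] H) : Set ℝ :=
  {E | ∀ U : Set ℝ, IsOpen U → E ∈ U →
    ∃ ψ : H, ∃ μ : Measure ℝ, IsSpectralMeasure T ψ μ ∧ μ ≪ volume ∧ μ U ≠ 0}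

/-- The absolutely continuous spectral bands: the connected components of the absolutely
continuous spectrum. -/
def IsBand (T : H →ₗ.[ℂ] H) (J : Set ℝ) : Prop :=
  ∃ E ∈ acSpectrum T, J = connectedComponentIn (acSpectrum T) E

end UnboundedOp

/-! ### The ring chain and its magnetic Laplacian -/

namespace RingChain

/-- Edges of the chain: `(j, true)` is the upper and `(j, false)` the lower half-circle of the
`j`-th ring. Each is parametrized by `[0, π]` from the vertex `j` to the vertex `j + 1`. -/
abbrev Edge : Type := ℤ × Bool

/-- Lebesgue measure on one edge. -/
abbrev edgeMeasure : Measure ℝ := volume.restrict (Icc 0 Real.pi)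

/-- The Hilbert space `L²(Γ)`, the orthogonal sum of the spaces `L²(0, π)` over all edges. -/
abbrev L2Gamma : Type := lp (fun _ : Edge => Lp ℂ 2 edgeMeasure) 2

/-- `u` belongs to `H²(0, π)` with `u' = u₁` and `u'' = u₂`: `u` and `u₁` are the (absolutely)
continuous representatives, so that `u₁` is a primitive of `u₂ ∈ L²` and `u` one of `u₁`. -/
structure IsH2 (u u₁ u₂ : ℝ → ℂ) : Prop where
  memLp : MemLp u₂ 2 edgeMeasure
  deriv_eq : ∀ x ∈ Icc 0 Real.pi, u₁ x = u₁ 0 + ∫ t in (0 : ℝ)..x, u₂ t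
  eq : ∀ x ∈ Icc 0 Real.pi, u x = u 0 + ∫ t in (0 : ℝ)..x, u₁ t

/-- The magnetic coefficient in `𝒟 = d/dx + i a`: `a = A` on the upper and `a = -A` on the lower
half-circles. -/
def coeff (A : ℝ) (e : Edge) : ℂ := if e.2 then (A : ℂ) else -(A : ℂ)

/-- The quasiderivative `𝒟u = u' + i a u`, where `u₁` stands for `u'`. -/
def quasi (a : ℂ) (u u₁ : ℝ → ℂ) (x : ℝ) : ℂ := u₁ x + Complex.I * a * u x

/-- The δ-coupling of strength `α` at the vertex `j`, in which the edges `(j, ·)` start and the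
edges `(j - 1, ·)` end. -/
structure DeltaCoupling (A α : ℝ) (u u₁ : Edge → ℝ → ℂ) (j : ℤ) : Prop where
  cont_lower : u (j, false) 0 = u (j, true) 0
  cont_prev_upper : u (j - 1, true) Real.pi = u (j, true) 0
  cont_prev_lower : u (j - 1, false) Real.pi = u (j, true) 0
  deriv_sum :
    quasi (coeff A (j, true)) (u (j, true)) (u₁ (j, true)) 0
      + quasi (coeff A (j, false)) (u (j, false)) (u₁ (j, false)) 0
      - quasi (coeff A (j - 1, true)) (u (j - 1, true)) (u₁ (j - 1, true)) Real.pi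
      - quasi (coeff A (j - 1, false)) (u (j - 1, false)) (u₁ (j - 1, false)) Real.pi
    = α * u (j, true) 0

/-- `(f, g)` lies in the graph of the magnetic Laplacian: `f` is in `H²` on every edge, satisfies
the δ-coupling at every vertex, and `g = -𝒟²f ∈ L²(Γ)`. Note `(𝒟u)' = u'' + i a u'`. -/
def IsInGraph (A α : ℝ) (f g : L2Gamma) : Prop :=
  ∃ u u₁ u₂ : Edge → ℝ → ℂ,
    (∀ e, IsH2 (u e) (u₁ e) (u₂ e)) ∧
    (∀ e, f e =ᵐ[edgeMeasure] u e) ∧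
    (∀ e, g e =ᵐ[edgeMeasure] fun x =>
      -quasi (coeff A e) (quasi (coeff A e) (u e) (u₁ e)) (quasi (coeff A e) (u₁ e) (u₂ e)) x) ∧
    ∀ j, DeltaCoupling A α u u₁ j

theorem IsH2.ii₂ {u u₁ u₂ : ℝ → ℂ} (h : IsH2 u u₁ u₂) :
    IntervalIntegrable u₂ volume 0 Real.pi :=
  (intervalIntegrable_iff_integrableOn_Icc_of_le Real.pi_pos.le).2
    (h.memLp.integrable one_le_two)

theorem continuousOn_primitive {v w : ℝ → ℂ} (hw : IntervalIntegrable w volume 0 Real.pi)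
    (h : ∀ x ∈ Icc 0 Real.pi, v x = v 0 + ∫ t in (0 : ℝ)..x, w t) :
    ContinuousOn v (Icc 0 Real.pi) := by
  have h1 := intervalIntegral.continuousOn_primitive_interval' hw left_mem_uIcc
  rw [uIcc_of_le Real.pi_pos.le] at h1
  exact (continuousOn_const.add h1).congr h

theorem IsH2.cont₁ {u u₁ u₂ : ℝ → ℂ} (h : IsH2 u u₁ u₂) : ContinuousOn u₁ (Icc 0 Real.pi) :=
  continuousOn_primitive h.ii₂ h.deriv_eq

theorem IsH2.ii₁ {u u₁ u₂ : ℝ → ℂ} (h : IsH2 u u₁ u₂) :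
    IntervalIntegrable u₁ volume 0 Real.pi :=
  ContinuousOn.intervalIntegrable_of_Icc Real.pi_pos.le h.cont₁

theorem IsH2.cont {u u₁ u₂ : ℝ → ℂ} (h : IsH2 u u₁ u₂) : ContinuousOn u (Icc 0 Real.pi) :=
  continuousOn_primitive h.ii₁ h.eq

theorem ii_mono {w : ℝ → ℂ} (hw : IntervalIntegrable w volume 0 Real.pi) {x : ℝ}
    (hx : x ∈ Icc 0 Real.pi) : IntervalIntegrable w volume 0 x :=
  hw.mono_set (by rw [uIcc_of_le hx.1, uIcc_of_le Real.pi_pos.le]; exact Icc_subset_Icc_right hx.2)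

theorem IsH2.zero : IsH2 0 0 0 := ⟨MemLp.zero, by simp, by simp⟩

theorem IsH2.add {u u₁ u₂ v v₁ v₂ : ℝ → ℂ} (hu : IsH2 u u₁ u₂) (hv : IsH2 v v₁ v₂) :
    IsH2 (u + v) (u₁ + v₁) (u₂ + v₂) where
  memLp := hu.memLp.add hv.memLp
  deriv_eq x hx := by
    simp only [Pi.add_apply]
    rw [intervalIntegral.integral_add (ii_mono hu.ii₂ hx) (ii_mono hv.ii₂ hx),
      hu.deriv_eq x hx, hv.deriv_eq x hx]
    ring
  eq x hx := by
    simp only [Pi.add_apply]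
    rw [intervalIntegral.integral_add (ii_mono hu.ii₁ hx) (ii_mono hv.ii₁ hx),
      hu.eq x hx, hv.eq x hx]
    ring

theorem IsH2.smul {u u₁ u₂ : ℝ → ℂ} (c : ℂ) (hu : IsH2 u u₁ u₂) :
    IsH2 (c • u) (c • u₁) (c • u₂) where
  memLp := hu.memLp.const_smul c
  deriv_eq x hx := by
    simp only [Pi.smul_apply, intervalIntegral.integral_smul]
    rw [hu.deriv_eq x hx, smul_add]
  eq x hx := by
    simp only [Pi.smul_apply, intervalIntegral.integral_smul]
    rw [hu.eq x hx, smul_add]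

/-- The graph of the magnetic Laplacian, as a subspace of `L²(Γ) × L²(Γ)`. -/
def graph (A α : ℝ) : Submodule ℂ (L2Gamma × L2Gamma) where
  carrier := {p | IsInGraph A α p.1 p.2}
  zero_mem' := by
    refine ⟨0, 0, 0, fun e => IsH2.zero, fun e => Lp.coeFn_zero _ _ _, fun e => ?_, fun j => ?_⟩
    · refine (Lp.coeFn_zero ℂ 2 edgeMeasure).trans (Filter.Eventually.of_forall fun x => ?_)
      simp [quasi]
    · constructor <;> simp [quasi]
  add_mem' := by
    rintro ⟨f, g⟩ ⟨f', g'⟩ ⟨u, u₁, u₂, h1, h2, h3, h4⟩ ⟨v, v₁, v₂, k1, k2, k3, k4⟩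
    refine ⟨u + v, u₁ + v₁, u₂ + v₂, fun e => (h1 e).add (k1 e), fun e => ?_, fun e => ?_,
      fun j => ?_⟩
    · filter_upwards [Lp.coeFn_add (f e) (f' e), h2 e, k2 e] with x a b c
      exact a.trans (congrArg₂ (· + ·) b c)
    · filter_upwards [Lp.coeFn_add (g e) (g' e), h3 e, k3 e] with x a b c
      refine (a.trans (congrArg₂ (· + ·) b c)).trans ?_
      simp only [quasi, Pi.add_apply]
      ring
    · constructor
      · simp only [Pi.add_apply, (h4 j).cont_lower, (k4 j).cont_lower]
      · simp only [Pi.add_apply, (h4 j).cont_prev_upper, (k4 j).cont_prev_upper]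
      · simp only [Pi.add_apply, (h4 j).cont_prev_lower, (k4 j).cont_prev_lower]
      · have a := (h4 j).deriv_sum
        have b := (k4 j).deriv_sum
        simp only [quasi, Pi.add_apply] at a b ⊢
        linear_combination a + b
  smul_mem' := by
    rintro c ⟨f, g⟩ ⟨u, u₁, u₂, h1, h2, h3, h4⟩
    refine ⟨c • u, c • u₁, c • u₂, fun e => (h1 e).smul c, fun e => ?_, fun e => ?_, fun j => ?_⟩
    · filter_upwards [Lp.coeFn_smul c (f e), h2 e] with x a b
      exact a.trans (congrArg (c • ·) b)
    · filter_upwards [Lp.coeFn_smul c (g e), h3 e] with x a b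
      refine (a.trans (congrArg (c • ·) b)).trans ?_
      simp only [quasi, Pi.smul_apply, smul_eq_mul]
      ring
    · constructor
      · simp only [Pi.smul_apply, (h4 j).cont_lower]
      · simp only [Pi.smul_apply, (h4 j).cont_prev_upper]
      · simp only [Pi.smul_apply, (h4 j).cont_prev_lower]
      · have a := (h4 j).deriv_sum
        simp only [quasi, Pi.smul_apply, smul_eq_mul] at a ⊢
        linear_combination c * a

theorem ae_zero_of_primitive {v w : ℝ → ℂ} (hw : IntervalIntegrable w volume 0 Real.pi)
    (h : ∀ x ∈ Icc 0 Real.pi, v x = v 0 + ∫ t in (0 : ℝ)..x, w t)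
    (hv : ∀ x ∈ Icc 0 Real.pi, v x = 0) : w =ᵐ[edgeMeasure] 0 := by
  have hd := hw.ae_hasDerivAt_integral
  rw [Filter.EventuallyEq, edgeMeasure, ← restrict_Ioo_eq_restrict_Icc,
    ae_restrict_iff' measurableSet_Ioo]
  filter_upwards [hd] with x hx hxm
  have h1 := hx (by rw [uIcc_of_le Real.pi_pos.le]; exact Ioo_subset_Icc_self hxm) 0 left_mem_uIcc
  have h2 : HasDerivAt (fun x => ∫ t in (0 : ℝ)..x, w t) 0 x := by
    refine (hasDerivAt_const x (0 : ℂ)).congr_of_eventuallyEq ?_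
    filter_upwards [isOpen_Ioo.mem_nhds hxm] with y hy
    have a := h y (Ioo_subset_Icc_self hy)
    rw [hv y (Ioo_subset_Icc_self hy), hv 0 ⟨le_rfl, Real.pi_pos.le⟩, zero_add] at a
    exact a.symm
  exact h1.unique h2

theorem graph_singleValued (A α : ℝ) (p : L2Gamma × L2Gamma) (hp : p ∈ graph A α)
    (h0 : p.1 = 0) : p.2 = 0 := by
  obtain ⟨u, u₁, u₂, h1, h2, h3, -⟩ := hp
  ext1
  funext e
  have hu : EqOn (u e) 0 (Icc 0 Real.pi) := by
    refine Measure.eqOn_Icc_of_ae_eq volume Real.pi_pos.ne ?_ (h1 e).cont continuousOn_const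
    refine (h2 e).symm.trans ?_
    rw [h0]
    exact Lp.coeFn_zero _ _ _
  have hu1 : EqOn (u₁ e) 0 (Icc 0 Real.pi) :=
    Measure.eqOn_Icc_of_ae_eq volume Real.pi_pos.ne
      (ae_zero_of_primitive (h1 e).ii₁ (h1 e).eq hu) (h1 e).cont₁ continuousOn_const
  have hu2 := ae_zero_of_primitive (h1 e).ii₂ (h1 e).deriv_eq hu1
  refine Lp.ext ((h3 e).trans (Filter.EventuallyEq.trans ?_ (Lp.coeFn_zero _ _ _).symm))
  filter_upwards [hu2, ae_restrict_mem measurableSet_Icc] with x a hx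
  simp [quasi, a, hu hx, hu1 hx]

/-- The Hamiltonian `-Δ_α` on the ring chain with magnetic potential `A`: the operator in `L²(Γ)`
whose graph is `graph A α`. -/
def hamiltonian (A α : ℝ) : L2Gamma →ₗ.[ℂ] L2Gamma := (graph A α).toLinearPMap

theorem hamiltonian_graph (A α : ℝ) : (hamiltonian A α).graph = graph A α :=
  Submodule.toLinearPMap_graph_eq _ (graph_singleValued A α)

/-- `cos kπ + (α / 4k) sin kπ`, extended by continuity to `k = 0`. -/
def xiNum (α : ℝ) (k : ℂ) : ℂ :=
  if k = 0 then 1 + α * Real.pi / 4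
  else Complex.cos (k * Real.pi) + α / (4 * k) * Complex.sin (k * Real.pi)

/-- `ξ(k) = (cos kπ + (α / 4k) sin kπ) / cos Aπ`; meaningful only if `cos Aπ ≠ 0`. -/
def xi (A α : ℝ) (k : ℂ) : ℂ := xiNum α k / Real.cos (A * Real.pi)

/-- The real energies `E = k²`, `k ∈ {1, 2, 3, …}`. -/
def squares : Set ℝ := {E | ∃ n : ℕ, 1 ≤ n ∧ E = (n : ℝ) ^ 2}

/-- The real energies `E = k²`, `k ∈ ℂ`, with `cos kπ + (α / 4k) sin kπ = 0`. -/
def xiZeros (α : ℝ) : Set ℝ := {E | ∃ k : ℂ, (E : ℂ) = k ^ 2 ∧ xiNum α k = 0}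

/-- The real energies `E = k²`, `k ∈ ℂ`, with `|ξ(k)| ≤ 1`. -/
def bandSet (A α : ℝ) : Set ℝ := {E | ∃ k : ℂ, (E : ℂ) = k ^ 2 ∧ ‖xi A α k‖ ≤ 1}

end RingChain

end

/-! The phase `exp (i a x)` gauges the magnetic potential away from the edges, so that every edge
carries `-p'' = z p + source`; the potential survives only as the factors `exp (± i A π)` in the
vertex conditions. If the Dirichlet solution `ssol z` does not vanish at `π`, a function on an edge
is determined by its two vertex values and the source, and the δ-coupling becomes (`flux_iff`) the
difference equation `4 η v j - 2 cos(Aπ) (v (j+1) + v (j-1)) = source j`. The adjacency operator of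
`ℤ` is self-adjoint of norm at most `2`, so this equation is solvable in `ℓ²` unless `η` is real
with `|η| ≤ |cos Aπ|` (`mem_resolventSet_of_eta`). In that exceptional case a conserved quadratic
form excludes decaying homogeneous solutions, and a source on a single edge already has no solution
(`mem_spec_of_eta`); for `cos Aπ = 0` the left side simply vanishes.

The zeros `k²`, `k ∈ ℕ`, of `ssol z π` carry eigenvectors that vanish at all vertices and live on
two adjacent rings. If `cos Aπ = 0`, neighbouring vertices decouple and each zero of `η` carries
eigenvectors concentrated around one vertex. Disjoint translates give the infinite multiplicity.

A sufficiently negative real energy `E` lies in the resolvent set, so `R = (T - E)⁻¹` is a bounded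
self-adjoint operator. Its continuous functional calculus and the Riesz-Markov theorem supply
measures, which `s ↦ E + 1/s` transports to spectral measures of `T`
(`IsSymm.exists_spectralFamily`). These do not charge the resolvent set, and vectors orthogonal to
the eigenvectors have no atoms. If `cos Aπ = 0`, the spectrum is countable, hence pure point
(`ppSubspace_eq_top`).

If `cos Aπ ≠ 0`, the Green function of the vertex equation satisfies `16 |η² - cos²(Aπ)| |g 0|² =
1`. Thus diagonal resolvent elements of single-edge vectors stay bounded as the real axis is
approached away from the numbers `k²`, `k ∈ ℕ`, and the band edges (`exists_im_bound`). A
differentiation argument turns this into absolute continuity off a countable set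
(`measure_eq_zero_of_volume`), and single-edge vectors are total.

The shape of the bands follows from the strict monotonicity of `(cos kπ - c) / (sin kπ / k)` in the
energy between consecutive squares (`strictAntiOn_ratio`): there `η` takes each value in `(-1, 1)`
exactly once. Since `|η| = 1` at the squares and `|cos Aπ| < 1`, each gap contains exactly one
compact band, and the value `η = 1 + απ/4` at energy `0` locates the first one. -/

namespace UnboundedOp

/-! ### Symmetric operators and their resolvents -/

open Filter Topology ComplexConjugate

variable {H : Type*} [NormedAddCommGroup H] [InnerProductSpace ℂ H]

/-- A symmetric operator, not necessarily densely defined. -/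
def IsSymm (T : H →ₗ.[ℂ] H) : Prop := T.IsFormalAdjoint T

theorem mem_eigenspace_iff {T : H →ₗ.[ℂ] H} {z : ℂ} {v : H} :
    v ∈ eigenspace T z ↔ ∃ f : T.domain, (f : H) = v ∧ T f = z • v := by
  simp only [eigenspace, Submodule.mem_map, LinearMap.mem_ker, LinearMap.sub_apply,
    LinearMap.smul_apply, Submodule.subtype_apply, sub_eq_zero]
  constructor
  · rintro ⟨f, h, rfl⟩
    exact ⟨f, rfl, h⟩
  · rintro ⟨f, rfl, h⟩
    exact ⟨f, h, rfl⟩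

theorem IsSymm.im_inner_self {T : H →ₗ.[ℂ] H} (hT : IsSymm T) (f : T.domain) :
    (⟪T f, (f : H)⟫_ℂ).im = 0 := by
  have h := hT f f
  rw [← inner_conj_symm (f : H) (T f)] at h
  exact Complex.conj_eq_iff_im.1 h.symm

/-- The imaginary part of the quadratic form of the resolvent. -/
theorem IsSymm.im_inner_resolvent {T : H →ₗ.[ℂ] H} (hT : IsSymm T) (f : T.domain) (z : ℂ) :
    (⟪T f - z • (f : H), (f : H)⟫_ℂ).im = z.im * ‖(f : H)‖ ^ 2 := by
  rw [inner_sub_left, inner_smul_left, inner_self_eq_norm_sq_to_K, Complex.sub_im,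
    hT.im_inner_self f]
  simp [← Complex.ofReal_pow]

/-- Cauchy-Schwarz applied to the imaginary part of the quadratic form. Off the real axis it yields
both injectivity of `T - z` and boundedness of the inverse. -/
theorem IsSymm.im_mul_norm_le {T : H →ₗ.[ℂ] H} (hT : IsSymm T) (f : T.domain) (z : ℂ) :
    |z.im| * ‖(f : H)‖ ≤ ‖T f - z • (f : H)‖ := by
  have h := hT.im_inner_resolvent f z
  have h2 : |z.im| * ‖(f : H)‖ ^ 2 ≤ ‖T f - z • (f : H)‖ * ‖(f : H)‖ := by
    rw [← abs_of_nonneg (sq_nonneg ‖(f : H)‖), ← abs_mul, ← h]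
    exact (Complex.abs_im_le_norm _).trans (norm_inner_le_norm _ _)
  rcases (norm_nonneg (f : H)).eq_or_lt with h0 | h0
  · rw [← h0]; simp
  · nlinarith

theorem IsSymm.inner_sub_real {T : H →ₗ.[ℂ] H} (hT : IsSymm T) (E : ℝ) (f g : T.domain) :
    ⟪T f - (E : ℂ) • (f : H), (g : H)⟫_ℂ = ⟪(f : H), T g - (E : ℂ) • (g : H)⟫_ℂ := by
  rw [inner_sub_left, inner_sub_right, hT f g, inner_smul_left, inner_smul_right,
    Complex.conj_ofReal]

/-- The map `f ↦ (T - z) f` on the domain of `T`. -/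
def shifted (T : H →ₗ.[ℂ] H) (z : ℂ) : T.domain →ₗ[ℂ] H := T.toFun - z • T.domain.subtype

theorem shifted_apply (T : H →ₗ.[ℂ] H) (z : ℂ) (f : T.domain) :
    shifted T z f = T f - z • (f : H) := rfl

/-- The range condition suffices for a point to be in the resolvent set of a symmetric operator. -/
theorem IsSymm.mem_resolventSet [CompleteSpace H] {T : H →ₗ.[ℂ] H} (hT : IsSymm T) {z : ℂ}
    (hs : ∀ h : H, ∃ f : T.domain, T f - z • (f : H) = h) : z ∈ resolventSet T := by
  have hsurj : Function.Surjective (shifted T z) := hs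
  have hinj : Function.Injective (shifted T z) := by
    rw [injective_iff_map_eq_zero]
    intro f hf
    rw [shifted_apply] at hf
    by_cases hz : z.im = 0
    · obtain ⟨g, hg⟩ := hs (f : H)
      have hz' : z = (z.re : ℂ) := by apply Complex.ext <;> simp [hz]
      have h := hT.inner_sub_real z.re f g
      rw [← hz', hf, hg, inner_zero_left] at h
      exact Subtype.ext (inner_self_eq_zero.1 h.symm)
    · have h := hT.im_mul_norm_le f z
      rw [hf, norm_zero] at h
      have h3 : ‖(f : H)‖ ≤ 0 := by
        have := abs_pos.2 hz
        by_contra h4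
        push Not at h4
        nlinarith [mul_pos this h4]
      exact Subtype.ext (norm_le_zero_iff.1 h3)
  set e := LinearEquiv.ofBijective (shifted T z) ⟨hinj, hsurj⟩ with he
  have hes : ∀ h : H, T (e.symm h) - z • ((e.symm h : T.domain) : H) = h := fun h =>
    e.apply_symm_apply h
  let R₀ : H →ₗ[ℂ] H := T.domain.subtype ∘ₗ e.symm.toLinearMap
  have hcont : Continuous R₀ := by
    by_cases hz : z.im = 0
    -- Hellinger-Toeplitz: for real `z` the inverse is symmetric and defined everywhere, hence
    -- bounded.
    · apply LinearMap.IsSymmetric.continuous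
      intro x y
      have hz' : z = (z.re : ℂ) := by apply Complex.ext <;> simp [hz]
      have h := hT.inner_sub_real z.re (e.symm x) (e.symm y)
      rw [← hz', hes, hes] at h
      exact h.symm
    · refine AddMonoidHomClass.continuous_of_bound R₀ |z.im|⁻¹ fun x => ?_
      have h := hT.im_mul_norm_le (e.symm x) z
      rw [hes] at h
      rw [inv_mul_eq_div, le_div_iff₀ (abs_pos.2 hz), mul_comm]
      exact h
  refine ⟨⟨R₀, hcont⟩, fun h => ⟨e.symm h, rfl, hes h⟩, fun f => ?_⟩
  exact congrArg Subtype.val (e.symm_apply_apply f)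

/-- Perturbation of the resolvent. -/
theorem exists_solution_of_isUnit {T : H →ₗ.[ℂ] H} {z w : ℂ} {R : H →L[ℂ] H}
    (hR : ∀ h : H, ∃ f : T.domain, (f : H) = R h ∧ T f - z • (f : H) = h)
    (hu : IsUnit (1 - (w - z) • R)) (h : H) : ∃ f : T.domain, T f - w • (f : H) = h := by
  obtain ⟨B, hB, -⟩ := isUnit_iff_exists.1 hu
  obtain ⟨f, hf, hf'⟩ := hR (B h)
  refine ⟨f, ?_⟩
  have h1 : (1 - (w - z) • R) (B h) = h := by
    rw [← mul_apply_eq_comp, hB, one_apply_eq_self]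
  have h2 : (1 - (w - z) • R) (B h) = B h - (w - z) • (f : H) := by
    rw [hf]; simp
  rw [← h1, h2]
  nth_rewrite 1 [← hf']
  rw [sub_smul]
  abel

theorem IsSymm.isSelfAdjoint_resolvent [CompleteSpace H] {T : H →ₗ.[ℂ] H} (hT : IsSymm T) {E : ℝ}
    {R : H →L[ℂ] H} (hR : ∀ h : H, ∃ f : T.domain, (f : H) = R h ∧ T f - (E : ℂ) • (f : H) = h) :
    IsSelfAdjoint R := by
  rw [ContinuousLinearMap.isSelfAdjoint_iff_isSymmetric]
  intro x y
  obtain ⟨f, hf, hf'⟩ := hR x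
  obtain ⟨g, hg, hg'⟩ := hR y
  have h := hT.inner_sub_real E f g
  rw [hf', hg', hf, hg] at h
  exact h.symm

/-- `1 - w R = w (w⁻¹ - R)`, and the non-real number `w⁻¹` is not in the spectrum of the
self-adjoint `R`. -/
theorem isUnit_one_sub_smul [CompleteSpace H] {R : H →L[ℂ] H} (hR : IsSelfAdjoint R) {w : ℂ}
    (hw : w.im ≠ 0) : IsUnit (1 - w • R) := by
  have hw0 : w ≠ 0 := fun h => hw (by simp [h])
  have h : w⁻¹ ∉ spectrum ℂ R := by
    intro h
    have := hR.mem_spectrum_eq_re h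
    have h2 : (w⁻¹).im = 0 := by rw [this]; simp
    rw [Complex.inv_im, div_eq_zero_iff] at h2
    rcases h2 with h2 | h2
    · exact hw (by linarith)
    · exact hw0 (Complex.normSq_eq_zero.1 h2)
  rw [spectrum.notMem_iff] at h
  have h2 : (1 - w • R) = w • (algebraMap ℂ (H →L[ℂ] H) w⁻¹ - R) := by
    rw [smul_sub, Algebra.algebraMap_eq_smul_one, smul_smul, mul_inv_cancel₀ hw0, one_smul]
  rw [h2]
  exact IsUnit.smul (Units.mk0 w hw0) h

/-- A symmetric operator with a real point in its resolvent set has real spectrum. -/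
theorem IsSymm.mem_resolventSet_of_im_ne_zero [CompleteSpace H] {T : H →ₗ.[ℂ] H} (hT : IsSymm T)
    {E : ℝ} (hE : (E : ℂ) ∈ resolventSet T) {z : ℂ} (hz : z.im ≠ 0) : z ∈ resolventSet T := by
  obtain ⟨R, hR, -⟩ := hE
  refine hT.mem_resolventSet (exists_solution_of_isUnit hR ?_)
  exact isUnit_one_sub_smul (hT.isSelfAdjoint_resolvent hR) (by simpa using hz)

theorem notMem_resolventSet_of_mem_eigenvalues {T : H →ₗ.[ℂ] H} {z : ℂ}
    (hz : z ∈ eigenvalues T) : z ∈ spec T := by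
  rintro ⟨R, -, hR⟩
  refine hz ((Submodule.eq_bot_iff _).2 fun v hv => ?_)
  obtain ⟨f, rfl, hf⟩ := mem_eigenspace_iff.1 hv
  rw [← hR f, hf, sub_self, map_zero]

end UnboundedOp

/-! ### Spectral measures of a bounded self-adjoint operator -/

namespace BoundedSelfAdjoint

open Filter Topology ComplexConjugate CompactlySupported

variable {H : Type*} [NormedAddCommGroup H] [InnerProductSpace ℂ H] [CompleteSpace H]
  {R : H →L[ℂ] H}

/-- A real continuous function, considered as a complex one. -/
def ofRealC {X : Type*} [TopologicalSpace X] (f : C(X, ℝ)) : C(X, ℂ) :=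
  ⟨fun x => (f x : ℂ), Complex.continuous_ofReal.comp f.continuous⟩

/-- The continuous functional calculus. -/
noncomputable def fc (hR : IsSelfAdjoint R) : C(spectrum ℂ R, ℂ) →⋆ₐ[ℂ] (H →L[ℂ] H) :=
  cfcHom hR.isStarNormal

/-- The function `s ↦ s` on the spectrum. -/
def coordinate (R : H →L[ℂ] H) : C(spectrum ℂ R, ℂ) := ⟨Subtype.val, continuous_subtype_val⟩

theorem fc_coordinate (hR : IsSelfAdjoint R) : fc hR (coordinate R) = R := cfcHom_id hR.isStarNormal

theorem inner_star_mul_self (B : H →L[ℂ] H) (ψ φ : H) : ⟪ψ, (star B * B) φ⟫_ℂ = ⟪B ψ, B φ⟫_ℂ := by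
  rw [mul_apply_eq_comp, ContinuousLinearMap.star_eq_adjoint,
    ContinuousLinearMap.adjoint_inner_right]

/-- The square root of a nonnegative function, with complex values. -/
noncomputable def sqrtC {X : Type*} [TopologicalSpace X] (f : C(X, ℝ)) : C(X, ℂ) :=
  ofRealC ⟨fun x => Real.sqrt (f x), Real.continuous_sqrt.comp f.continuous⟩

theorem star_sqrtC_mul {X : Type*} [TopologicalSpace X] {f : C(X, ℝ)} (hf : ∀ x, 0 ≤ f x) :
    star (sqrtC f) * sqrtC f = ofRealC f := by
  ext x
  simp only [sqrtC, ofRealC, ContinuousMap.mul_apply, ContinuousMap.star_apply,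
    ContinuousMap.coe_mk, RCLike.star_def, Complex.conj_ofReal]
  rw [← Complex.ofReal_mul, Real.mul_self_sqrt (hf x)]

/-- Factorise `f` as `√f · √f`. This gives the positivity needed for Riesz-Markov and reduces
comparisons of spectral measures to comparisons of norms. -/
theorem inner_fc_ofRealC (hR : IsSelfAdjoint R) {f : C(spectrum ℂ R, ℝ)} (hf : ∀ x, 0 ≤ f x)
    (ψ : H) : ⟪ψ, fc hR (ofRealC f) ψ⟫_ℂ = (‖fc hR (sqrtC f) ψ‖ ^ 2 : ℝ) := by
  rw [← star_sqrtC_mul hf, map_mul, map_star, inner_star_mul_self, inner_self_eq_norm_sq_to_K]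
  simp

/-- The positive functional `f ↦ ⟨ψ, f(R) ψ⟩`. -/
noncomputable def functional (hR : IsSelfAdjoint R) (ψ : H) : C_c(spectrum ℂ R, ℝ) →ₚ[ℝ] ℝ :=
  PositiveLinearMap.mk₀
    { toFun := fun f => (⟪ψ, fc hR (ofRealC (f : C(spectrum ℂ R, ℝ))) ψ⟫_ℂ).re
      map_add' := fun f g => by
        have : ofRealC ((f + g : C_c(spectrum ℂ R, ℝ)) : C(spectrum ℂ R, ℝ))
            = ofRealC (f : C(spectrum ℂ R, ℝ)) + ofRealC (g : C(spectrum ℂ R, ℝ)) := by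
          ext x; simp [ofRealC]
        rw [this, map_add, add_apply, inner_add_right, Complex.add_re]
      map_smul' := fun c f => by
        have : ofRealC ((c • f : C_c(spectrum ℂ R, ℝ)) : C(spectrum ℂ R, ℝ))
            = (c : ℂ) • ofRealC (f : C(spectrum ℂ R, ℝ)) := by
          ext x; simp [ofRealC]
        rw [this, map_smul, smul_apply, inner_smul_right]
        simp }
    (fun f hf => by
      have h : ∀ x, 0 ≤ (f : C(spectrum ℂ R, ℝ)) x := hf
      change 0 ≤ (⟪ψ, fc hR (ofRealC (f : C(spectrum ℂ R, ℝ))) ψ⟫_ℂ).re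
      rw [inner_fc_ofRealC hR h, Complex.ofReal_re]
      positivity)

/-- The spectral measure of `ψ` on the spectrum of `R`. -/
noncomputable def measure (hR : IsSelfAdjoint R) (ψ : H) : Measure (spectrum ℂ R) :=
  RealRMK.rieszMeasure (functional hR ψ)

instance (hR : IsSelfAdjoint R) (ψ : H) : (measure hR ψ).Regular := by
  unfold measure; infer_instance

theorem integral_measure_re (hR : IsSelfAdjoint R) (ψ : H) (f : C(spectrum ℂ R, ℝ)) :
    ∫ x, f x ∂(measure hR ψ) = (⟪ψ, fc hR (ofRealC f) ψ⟫_ℂ).re :=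
  RealRMK.integral_rieszMeasure (functional hR ψ)
    (CompactlySupportedContinuousMap.continuousMapEquiv f)

instance (hR : IsSelfAdjoint R) (ψ : H) : IsFiniteMeasure (measure hR ψ) :=
  ⟨isCompact_univ.measure_lt_top⟩

theorem inner_fc_ofRealC_im (hR : IsSelfAdjoint R) (ψ : H) (f : C(spectrum ℂ R, ℝ)) :
    (⟪ψ, fc hR (ofRealC f) ψ⟫_ℂ).im = 0 := by
  have hs : star (ofRealC f) = ofRealC f := by ext x; simp [ofRealC]
  have h : IsSelfAdjoint (fc hR (ofRealC f)) := by
    rw [IsSelfAdjoint, ← map_star, hs]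
  rw [ContinuousLinearMap.isSelfAdjoint_iff_isSymmetric] at h
  have h2 := h ψ ψ
  rw [← inner_conj_symm] at h2
  exact Complex.conj_eq_iff_im.1 h2

theorem integrable_of_continuous (hR : IsSelfAdjoint R) (ψ : H) (f : C(spectrum ℂ R, ℂ)) :
    Integrable f (measure hR ψ) :=
  f.continuous.integrable_of_hasCompactSupport (HasCompactSupport.of_compactSpace _)

theorem integral_measure (hR : IsSelfAdjoint R) (ψ : H) (f : C(spectrum ℂ R, ℂ)) :
    ∫ x, f x ∂(measure hR ψ) = ⟪ψ, fc hR f ψ⟫_ℂ := by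
  let f₁ : C(spectrum ℂ R, ℝ) := ⟨fun x => (f x).re, Complex.continuous_re.comp f.continuous⟩
  let f₂ : C(spectrum ℂ R, ℝ) := ⟨fun x => (f x).im, Complex.continuous_im.comp f.continuous⟩
  have hf : f = ofRealC f₁ + Complex.I • ofRealC f₂ := by
    ext x
    simp [ofRealC, f₁, f₂, mul_comm Complex.I, Complex.re_add_im]
  have h1 : ((∫ x, f x ∂(measure hR ψ)).re) = ∫ x, f₁ x ∂(measure hR ψ) :=
    (integral_re (integrable_of_continuous hR ψ f)).symm
  have h2 : ((∫ x, f x ∂(measure hR ψ)).im) = ∫ x, f₂ x ∂(measure hR ψ) :=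
    (integral_im (integrable_of_continuous hR ψ f)).symm
  rw [integral_measure_re] at h1 h2
  have e1 := inner_fc_ofRealC_im hR ψ f₁
  have e2 := inner_fc_ofRealC_im hR ψ f₂
  have h3 : ⟪ψ, fc hR f ψ⟫_ℂ
      = ⟪ψ, fc hR (ofRealC f₁) ψ⟫_ℂ + Complex.I * ⟪ψ, fc hR (ofRealC f₂) ψ⟫_ℂ := by
    conv_lhs => rw [hf]
    rw [map_add, map_smul, add_apply, smul_apply,
      inner_add_right, inner_smul_right]
  rw [h3]
  apply Complex.ext
  · simp [h1, e2]
  · simp [h2, e1]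

theorem measure_univ (hR : IsSelfAdjoint R) (ψ : H) :
    measure hR ψ univ = ENNReal.ofReal (‖ψ‖ ^ 2) := by
  have h := integral_measure_re hR ψ 1
  have h1 : ofRealC (1 : C(spectrum ℂ R, ℝ)) = 1 := by ext x; simp [ofRealC]
  rw [h1, map_one, one_apply_eq_self, inner_self_eq_norm_sq_to_K] at h
  simp only [ContinuousMap.one_apply, integral_const, smul_eq_mul, mul_one] at h
  rw [← ENNReal.ofReal_toReal (measure_ne_top (measure hR ψ) univ)]
  congr 1
  rw [← Measure.real, h]
  simp [← Complex.ofReal_pow]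

/-- Urysohn functions between a compact set and an open neighbourhood, together with outer
regularity of `ν`, settle compact sets; inner regularity of `μ` does the rest. -/
theorem measure_le_of_integral_le {X : Type*} [TopologicalSpace X] [T2Space X] [CompactSpace X]
    [MeasurableSpace X] [BorelSpace X] (μ ν : Measure X) [μ.Regular] [ν.Regular]
    (h : ∀ f : C(X, ℝ), (∀ x, 0 ≤ f x) → ∫ x, f x ∂μ ≤ ∫ x, f x ∂ν) : μ ≤ ν := by
  have : IsFiniteMeasure μ := ⟨isCompact_univ.measure_lt_top⟩
  have : IsFiniteMeasure ν := ⟨isCompact_univ.measure_lt_top⟩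
  have hK : ∀ K : Set X, IsCompact K → μ K ≤ ν K := by
    intro K hK
    refine le_of_forall_gt fun r hr => ?_
    obtain ⟨V, hKV, hV, hVr⟩ := K.exists_isOpen_lt_of_lt r hr
    obtain ⟨f, hf1, -, hf2, hf3⟩ := exists_continuousMap_one_of_isCompact_subset_isOpen hK hV hKV
    have hint : ∀ (ρ : Measure X) [IsFiniteMeasure ρ], Integrable f ρ := fun ρ _ =>
      f.continuous.integrable_of_hasCompactSupport (HasCompactSupport.of_compactSpace _)
    have h1 : μ.real K ≤ ∫ x, f x ∂μ := by
      rw [← integral_indicator_one hK.measurableSet]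
      refine integral_mono ((integrable_const 1).indicator hK.measurableSet) (hint μ) fun x => ?_
      by_cases hx : x ∈ K
      · simp [hx, hf1 hx]
      · simp [hx, (hf3 x).1]
    have h2 : ∫ x, f x ∂ν ≤ ν.real V := by
      rw [← integral_indicator_one hV.measurableSet]
      refine integral_mono (hint ν) ((integrable_const 1).indicator hV.measurableSet) fun x => ?_
      by_cases hx : x ∈ V
      · simp [hx, (hf3 x).2]
      · have : x ∉ tsupport f := fun h => hx (hf2 h)
        simp [hx, image_eq_zero_of_notMem_tsupport this]
    have h3 := h1.trans ((h f fun x => (hf3 x).1).trans h2)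
    have h4 : μ K ≤ ν V := by
      rwa [Measure.real, Measure.real, ENNReal.toReal_le_toReal (measure_ne_top _ _)
        (measure_ne_top _ _)] at h3
    exact h4.trans_lt hVr
  rw [Measure.le_iff]
  intro s hs
  rw [hs.measure_eq_iSup_isCompact_of_ne_top (measure_ne_top _ _)]
  simp only [iSup_le_iff]
  exact fun K hKs hKc => (hK K hKc).trans (measure_mono hKs)

theorem integral_measure_of_nonneg (hR : IsSelfAdjoint R) (ψ : H) {f : C(spectrum ℂ R, ℝ)}
    (hf : ∀ x, 0 ≤ f x) : ∫ x, f x ∂(measure hR ψ) = ‖fc hR (sqrtC f) ψ‖ ^ 2 := by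
  rw [integral_measure_re, inner_fc_ofRealC hR hf, Complex.ofReal_re]

theorem integrable_of_continuous_real (hR : IsSelfAdjoint R) (ψ : H) (f : C(spectrum ℂ R, ℝ)) :
    Integrable f (measure hR ψ) :=
  f.continuous.integrable_of_hasCompactSupport (HasCompactSupport.of_compactSpace _)

/-- The parallelogram law gives `‖a + b‖² ≤ 2 (‖a‖² + ‖b‖²)` for the images under `√f (R)`. This
inequality makes the vectors with a given null set a closed subspace. -/
theorem measure_add_le (hR : IsSelfAdjoint R) (ψ φ : H) :
    measure hR (ψ + φ) ≤ (2 : NNReal) • (measure hR ψ + measure hR φ) := by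
  have : (measure hR ψ + measure hR φ).Regular := inferInstance
  have : ((2 : NNReal) • (measure hR ψ + measure hR φ)).Regular :=
    Measure.Regular.smul_nnreal 2
  refine measure_le_of_integral_le _ _ fun f hf => ?_
  rw [integral_smul_nnreal_measure, integral_add_measure (integrable_of_continuous_real hR ψ f)
    (integrable_of_continuous_real hR φ f), integral_measure_of_nonneg hR _ hf,
    integral_measure_of_nonneg hR _ hf, integral_measure_of_nonneg hR _ hf, map_add]
  set a := fc hR (sqrtC f) ψ
  set b := fc hR (sqrtC f) φ
  have h := parallelogram_law_with_norm ℂ a b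
  have : (2 : NNReal) • (‖a‖ ^ 2 + ‖b‖ ^ 2) = 2 * (‖a‖ ^ 2 + ‖b‖ ^ 2) := by
    simp [NNReal.smul_def, mul_add]
  rw [this]
  nlinarith [sq_nonneg ‖a - b‖]

theorem measure_smul_le (hR : IsSelfAdjoint R) (c : ℂ) (ψ : H) :
    measure hR (c • ψ) ≤ (‖c‖₊ ^ 2) • measure hR ψ := by
  have : ((‖c‖₊ ^ 2) • measure hR ψ).Regular := Measure.Regular.smul_nnreal _
  refine measure_le_of_integral_le _ _ fun f hf => ?_
  rw [integral_smul_nnreal_measure, integral_measure_of_nonneg hR _ hf,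
    integral_measure_of_nonneg hR _ hf, map_smul, norm_smul, mul_pow]
  simp [NNReal.smul_def]

/-- The spectral measure of `(R - s) φ` has no atom at `s`. -/
theorem measure_sub_smul_atom (hR : IsSelfAdjoint R) (s : ℝ) (φ : H) :
    measure hR (R φ - (s : ℂ) • φ) {x | (x : ℂ) = s} = 0 := by
  set ν := measure hR (R φ - (s : ℂ) • φ) with hν
  set N := measure hR φ with hN
  have key : ∀ n : ℕ, ν.real {x | (x : ℂ) = s} ≤ (1 / ((n : ℝ) + 1)) ^ 2 * N.real univ := by
    intro n
    -- A tent of height `1` at `s` that vanishes beyond distance `1 / (n + 1)`.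
    let f : C(spectrum ℂ R, ℝ) := ⟨fun x => max 0 (1 - (n + 1) * ‖(x : ℂ) - s‖), by fun_prop⟩
    have hf : ∀ x, 0 ≤ f x := fun x => le_max_left _ _
    have hm : MeasurableSet {x : spectrum ℂ R | (x : ℂ) = s} :=
      (isClosed_eq continuous_subtype_val continuous_const).measurableSet
    have h1 : ν.real {x | (x : ℂ) = s} ≤ ∫ x, f x ∂ν := by
      rw [← integral_indicator_one hm]
      refine integral_mono ((integrable_const 1).indicator hm)
        (integrable_of_continuous_real hR _ f) fun x => ?_
      by_cases hx : (x : ℂ) = s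
      · simp [hx, f]
      · simpa [hx] using hf x
    let d : C(spectrum ℂ R, ℂ) := ⟨fun x => (x : ℂ) - s, by fun_prop⟩
    have hd : fc hR d φ = R φ - (s : ℂ) • φ := by
      have : d = coordinate R - algebraMap ℂ _ (s : ℂ) := by
        ext x; simp [d, coordinate, Algebra.algebraMap_eq_smul_one]
      rw [this, map_sub, fc_coordinate, AlgHomClass.commutes, Algebra.algebraMap_eq_smul_one]
      simp
    -- Applying `R - s` to `φ` multiplies its spectral measure by `|x - s|²`, which is at most `(1 /
    -- (n + 1))²` on the support of the tent.
    let g : C(spectrum ℂ R, ℝ) := ⟨fun x => f x * ‖(x : ℂ) - s‖ ^ 2, by fun_prop⟩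
    have hg : ∀ x, 0 ≤ g x := fun x => mul_nonneg (hf x) (by positivity)
    have hprod : star (sqrtC f * d) * (sqrtC f * d) = ofRealC g := by
      rw [star_mul, mul_assoc, ← mul_assoc (star (sqrtC f)), star_sqrtC_mul hf]
      ext x
      have : (starRingEnd ℂ) ((x : ℂ) - s) * ((x : ℂ) - s) = (‖(x : ℂ) - s‖ ^ 2 : ℝ) := by
        rw [mul_comm, Complex.mul_conj, Complex.normSq_eq_norm_sq]
      simp only [ContinuousMap.mul_apply, ContinuousMap.star_apply, RCLike.star_def, d, ofRealC, g,
        ContinuousMap.coe_mk, Complex.ofReal_mul, ← this]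
      ring
    have h2 : ∫ x, f x ∂ν = ∫ x, g x ∂N := by
      rw [hν, hN, integral_measure_of_nonneg hR _ hf, integral_measure_re, ← hprod, map_mul,
        map_star, inner_star_mul_self, inner_self_eq_norm_sq_to_K, map_mul, mul_apply_eq_comp, hd]
      simp [← Complex.ofReal_pow]
    have h3 : ∫ x, g x ∂N ≤ ∫ _, (1 / ((n : ℝ) + 1)) ^ 2 ∂N := by
      refine integral_mono (integrable_of_continuous_real hR _ g) (integrable_const _) fun x => ?_
      have hn : (0 : ℝ) < n + 1 := by positivity
      simp only [g, f, ContinuousMap.coe_mk]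
      rcases le_total 1 ((n + 1) * ‖(x : ℂ) - s‖) with h | h
      · rw [max_eq_left (by linarith), zero_mul]; positivity
      · have h5 : ‖(x : ℂ) - s‖ ≤ 1 / ((n : ℝ) + 1) := by
          rw [le_div_iff₀ hn]; linarith
        have h6 : max 0 (1 - (n + 1) * ‖(x : ℂ) - s‖) ≤ 1 :=
          max_le zero_le_one (by have := norm_nonneg ((x : ℂ) - s); nlinarith)
        calc _ ≤ 1 * ‖(x : ℂ) - s‖ ^ 2 := by gcongr
          _ ≤ _ := by rw [one_mul]; gcongr
    rw [integral_const, smul_eq_mul, mul_comm] at h3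
    linarith
  have hlim : Tendsto (fun n : ℕ => (1 / ((n : ℝ) + 1)) ^ 2 * N.real univ) atTop (𝓝 0) := by
    simpa using (tendsto_one_div_add_atTop_nhds_zero_nat (𝕜 := ℝ)).pow 2 |>.mul_const (N.real univ)
  have h0 : ν.real {x | (x : ℂ) = s} ≤ 0 := ge_of_tendsto' hlim key
  have h1 := le_antisymm h0 measureReal_nonneg
  rwa [measureReal_eq_zero_iff] at h1

/-- The vectors whose spectral measure vanishes on a given set form a closed subspace. -/
def nullSubspace (hR : IsSelfAdjoint R) (N : Set (spectrum ℂ R)) : Submodule ℂ H where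
  carrier := {ψ | measure hR ψ N = 0}
  zero_mem' := by
    have h := measure_univ hR (0 : H)
    rw [norm_zero, zero_pow two_ne_zero, ENNReal.ofReal_zero] at h
    exact measure_mono_null (subset_univ _) h
  add_mem' := fun {ψ φ} hψ hφ => by
    have h := measure_add_le hR ψ φ N
    simp only [mem_ofPred_eq] at hψ hφ ⊢
    simpa [hψ, hφ] using h
  smul_mem' := fun c ψ hψ => by
    have h := measure_smul_le hR c ψ N
    simp only [mem_ofPred_eq] at hψ ⊢
    simpa [hψ] using h

theorem isClosed_nullSubspace (hR : IsSelfAdjoint R) (N : Set (spectrum ℂ R)) :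
    IsClosed (nullSubspace hR N : Set H) := by
  refine isClosed_of_closure_subset fun ψ hψ => ?_
  change measure hR ψ N = 0
  rw [Metric.mem_closure_iff] at hψ
  refine le_antisymm (le_of_forall_pos_le_add fun ε hε => ?_) zero_le
  rcases eq_or_ne ε ∞ with rfl | hε'
  · simp
  -- Half of `ε` as a bound for `‖ψ - φ‖²`, because `measure_add_le` costs a factor `2`.
  have hδ : 0 < ε.toReal / 2 := by have := ENNReal.toReal_pos hε.ne' hε'; linarith
  obtain ⟨φ, hφ, hd⟩ := hψ (Real.sqrt (ε.toReal / 2)) (Real.sqrt_pos.2 hδ)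
  have hφ' : measure hR φ N = 0 := hφ
  have h := measure_add_le hR φ (ψ - φ) N
  rw [add_sub_cancel] at h
  have h2 : measure hR (ψ - φ) N ≤ ENNReal.ofReal (ε.toReal / 2) := by
    refine (measure_mono (subset_univ _)).trans ?_
    rw [measure_univ]
    refine ENNReal.ofReal_le_ofReal ?_
    rw [dist_eq_norm] at hd
    exact (Real.lt_sqrt (norm_nonneg _)).1 hd |>.le
  refine h.trans ?_
  have h3 : ENNReal.ofReal (ε.toReal / 2) = ε / 2 := by
    rw [ENNReal.ofReal_div_of_pos two_pos, ENNReal.ofReal_toReal hε']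
    simp
  rw [h3] at h2
  simp only [Measure.smul_apply, Measure.add_apply, hφ', zero_add]
  calc (2 : NNReal) • (measure hR (ψ - φ)) N ≤ (2 : NNReal) • (ε / 2) := by gcongr
    _ = ε := by rw [ENNReal.smul_def, smul_eq_mul]; exact ENNReal.mul_div_cancel (by simp) (by simp)

/-- For the self-adjoint `B = R - s`, the orthogonal complement of the kernel is the closure of the
range. Vectors in the range have no atom at `s`, and this property passes to the closure. -/
theorem measure_atom_eq_zero (hR : IsSelfAdjoint R) (s : ℝ) {ψ : H}
    (hψ : ∀ φ : H, R φ = (s : ℂ) • φ → ⟪φ, ψ⟫_ℂ = 0) :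
    measure hR ψ {x | (x : ℂ) = s} = 0 := by
  set B : H →L[ℂ] H := R - (s : ℂ) • 1 with hB
  have hBs : IsSelfAdjoint B := by
    refine hR.sub ?_
    rw [IsSelfAdjoint, star_smul]
    simp
  have h1 : ψ ∈ (LinearMap.ker (B : H →ₗ[ℂ] H))ᗮ := by
    rw [Submodule.mem_orthogonal]
    intro φ hφ
    refine hψ φ ?_
    have : R φ - (s : ℂ) • φ = 0 := by simpa [hB] using hφ
    exact sub_eq_zero.1 this
  have h2 : ψ ∈ (LinearMap.range (B : H →ₗ[ℂ] H)).topologicalClosure := by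
    have := ContinuousLinearMap.orthogonal_ker B
    rw [← ContinuousLinearMap.star_eq_adjoint, hBs.star_eq] at this
    rwa [← this]
  have h3 : (LinearMap.range (B : H →ₗ[ℂ] H)).topologicalClosure
      ≤ nullSubspace hR {x | (x : ℂ) = s} := by
    refine Submodule.topologicalClosure_minimal _ ?_ (isClosed_nullSubspace hR _)
    rintro _ ⟨φ, rfl⟩
    have := measure_sub_smul_atom hR s φ
    simpa [hB, nullSubspace] using this
  exact h3 h2

end BoundedSelfAdjoint

/-! ### Spectral measures of a symmetric operator with a real point in the resolvent set -/

namespace UnboundedOp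

open Filter Topology ComplexConjugate BoundedSelfAdjoint

variable {H : Type*} [NormedAddCommGroup H] [InnerProductSpace ℂ H]

/-- A choice of spectral measures, one for every vector, together with the properties that
the spectral theorem provides. -/
structure IsSpectralFamily (T : H →ₗ.[ℂ] H) (μ : H → Measure ℝ) : Prop where
  isSpectralMeasure : ∀ ψ, IsSpectralMeasure T ψ (μ ψ)
  measure_univ : ∀ ψ, μ ψ univ = ENNReal.ofReal (‖ψ‖ ^ 2)
  exists_nullSubspace : ∀ N : Set ℝ, MeasurableSet N →
    ∃ V : Submodule ℂ H, IsClosed (V : Set H) ∧ ∀ ψ, ψ ∈ V ↔ μ ψ N = 0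
  measure_singleton : ∀ (E : ℝ) (ψ : H), ψ ∈ (eigenspace T (E : ℂ))ᗮ → μ ψ {E} = 0

/-- The spectral parameter `t` of `T` that belongs to the spectral parameter `s` of
`(T - E)⁻¹`. -/
noncomputable def energy (R : H →L[ℂ] H) (E : ℝ) (s : spectrum ℂ R) : ℝ := E + ((s : ℂ).re)⁻¹

theorem measurable_energy (R : H →L[ℂ] H) (E : ℝ) : Measurable (energy R E) := by
  have : Measurable fun s : spectrum ℂ R => (s : ℂ).re :=
    (Complex.continuous_re.comp continuous_subtype_val).measurable
  exact this.inv.const_add E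

/-- `(T - z)⁻¹ = (1 - (z - E) R)⁻¹ R` is the function `s / (1 - (z - E) s)` of `R`, and for `s ≠ 0`
this equals `1 / (E + 1/s - z)`. -/
theorem IsSymm.inner_resolvent_eq_integral [CompleteSpace H] {T : H →ₗ.[ℂ] H} {E : ℝ}
    {R : H →L[ℂ] H} (hR : IsSelfAdjoint R)
    (hR₁ : ∀ h : H, ∃ f : T.domain, (f : H) = R h ∧ T f - (E : ℂ) • (f : H) = h)
    (hR₂ : ∀ f : T.domain, R (T f - (E : ℂ) • (f : H)) = f) {z : ℂ} (hz : z.im ≠ 0) (ψ : H) :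
    ∃ f : T.domain, T f - z • (f : H) = ψ ∧
      ⟪ψ, (f : H)⟫_ℂ = ∫ t : ℝ, ((t : ℂ) - z)⁻¹ ∂((measure hR ψ).map (energy R E)) := by
  have hzE : (z - E).im ≠ 0 := by simpa using hz
  obtain ⟨f, hf⟩ := exists_solution_of_isUnit hR₁ (isUnit_one_sub_smul hR hzE) ψ
  refine ⟨f, hf, ?_⟩
  have hre : ∀ s : spectrum ℂ R, ((s : ℂ).re : ℂ) = s := fun s =>
    (hR.mem_spectrum_eq_re s.2).symm
  have hden : ∀ s : spectrum ℂ R, 1 - (z - E) * (s : ℂ) ≠ 0 := by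
    intro s hs
    have h1 : ((z - E) * (s : ℂ)).im = 0 := by
      rw [sub_eq_zero] at hs
      rw [← hs]; simp
    rw [← hre s, Complex.im_mul_ofReal, mul_eq_zero] at h1
    rcases h1 with h1 | h1
    · exact hzE h1
    · rw [← hre s, h1] at hs
      simp at hs
  let g : C(spectrum ℂ R, ℂ) := ⟨fun s => (1 - (z - E) * (s : ℂ))⁻¹,
    Continuous.inv₀ (by fun_prop) hden⟩
  have hg : g * (1 - (z - E) • coordinate R) = 1 := by
    ext s
    simp only [g, coordinate, ContinuousMap.mul_apply, ContinuousMap.coe_mk,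
      ContinuousMap.sub_apply, ContinuousMap.one_apply, ContinuousMap.smul_apply, smul_eq_mul]
    exact inv_mul_cancel₀ (hden s)
  have hg' : fc hR g * (1 - (z - E) • R) = 1 := by
    have h := congrArg (fc hR) hg
    rwa [map_mul, map_sub, map_smul, map_one, fc_coordinate] at h
  have hfR : (1 - (z - E) • R) (f : H) = R ψ := by
    have h1 := hR₂ f
    have h2 : T f - (E : ℂ) • (f : H) = ψ + (z - E) • (f : H) := by
      rw [← hf, sub_smul]; abel
    rw [h2, map_add, map_smul] at h1
    simp only [sub_apply, one_apply_eq_self, smul_apply]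
    nth_rewrite 1 [← h1]
    abel
  have hff : (f : H) = fc hR (g * coordinate R) ψ := by
    rw [map_mul, fc_coordinate, mul_apply_eq_comp, ← hfR, ← mul_apply_eq_comp, hg',
      one_apply_eq_self]
  rw [hff, ← integral_measure, integral_map (measurable_energy R E).aemeasurable
    (by fun_prop)]
  -- `R` is injective, so `s = 0` carries no mass and the convention `0⁻¹ = 0` in `energy` is
  -- harmless.
  have h0 : measure hR ψ {s : spectrum ℂ R | (s : ℂ) = (0 : ℝ)} = 0 := by
    refine measure_atom_eq_zero hR 0 fun φ hφ => ?_
    obtain ⟨k, hk, hk'⟩ := hR₁ φ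
    rw [hφ, Complex.ofReal_zero, zero_smul] at hk
    have : k = 0 := Subtype.ext hk
    rw [this] at hk'
    rw [← hk']; simp
  refine integral_congr_ae ?_
  have h0' : ∀ᵐ s : spectrum ℂ R ∂(measure hR ψ), (s : ℂ) ≠ 0 := by
    rw [ae_iff]; simpa using h0
  filter_upwards [h0'] with s hs
  simp only [g, coordinate, ContinuousMap.mul_apply, ContinuousMap.coe_mk, energy]
  push_cast
  rw [hre s]
  have : (E : ℂ) + (s : ℂ)⁻¹ - z = (1 - (z - E) * s) / s := by
    field_simp; ring
  rw [this, inv_div, inv_mul_eq_div]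

/-- The spectral theorem, in the form of the existence of spectral measures. -/
theorem IsSymm.exists_spectralFamily [CompleteSpace H] {T : H →ₗ.[ℂ] H} (hT : IsSymm T) {E : ℝ}
    (hE : (E : ℂ) ∈ resolventSet T) : ∃ μ : H → Measure ℝ, IsSpectralFamily T μ := by
  obtain ⟨R, hR₁, hR₂⟩ := hE
  have hR := hT.isSelfAdjoint_resolvent hR₁
  have hm := measurable_energy R E
  refine ⟨fun ψ => (measure hR ψ).map (energy R E), ⟨fun ψ => ⟨inferInstance, fun z hz =>
    inner_resolvent_eq_integral hR hR₁ hR₂ hz ψ⟩, fun ψ => ?_, fun N hN => ?_, fun E' ψ hψ => ?_⟩⟩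
  · rw [Measure.map_apply hm MeasurableSet.univ, preimage_univ]
    exact BoundedSelfAdjoint.measure_univ hR ψ
  · refine ⟨nullSubspace hR (energy R E ⁻¹' N), isClosed_nullSubspace hR _, fun ψ => ?_⟩
    rw [Measure.map_apply hm hN]
    rfl
  · rw [Measure.map_apply hm (measurableSet_singleton _)]
    refine measure_mono_null (t := {s | (s : ℂ) = (((E' - E)⁻¹ : ℝ) : ℂ)}) ?_ ?_
    · intro s hs
      have h1 : E + ((s : ℂ).re)⁻¹ = E' := hs
      have h2 : (s : ℂ).re = (E' - E)⁻¹ := by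
        rw [← h1, add_sub_cancel_left, inv_inv]
      change (s : ℂ) = _
      rw [← h2]
      exact hR.mem_spectrum_eq_re s.2
    · refine measure_atom_eq_zero hR _ fun φ hφ => ?_
      obtain ⟨k, hk, hk'⟩ := hR₁ φ
      rw [hφ] at hk
      -- For `E' = E` the point `(E' - E)⁻¹` is `0` by convention, and the eigenspace of `R` at `0`
      -- is trivial; otherwise an eigenvector of `R` is an eigenvector of `T` at `E'`.
      rcases eq_or_ne E' E with h | h
      · rw [h, sub_self, inv_zero, Complex.ofReal_zero, zero_smul] at hk
        have : k = 0 := Subtype.ext hk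
        rw [this] at hk'
        rw [← hk']; simp
      · have hne : ((E' - E : ℝ) : ℂ) ≠ 0 := by
          exact_mod_cast sub_ne_zero.2 h
        have hφk : φ = ((E' - E : ℝ) : ℂ) • (k : H) := by
          rw [hk, smul_smul, Complex.ofReal_inv, mul_inv_cancel₀ hne, one_smul]
        have hmem : (k : H) ∈ eigenspace T (E' : ℂ) := by
          refine mem_eigenspace_iff.2 ⟨k, rfl, ?_⟩
          rw [hφk, sub_eq_iff_eq_add] at hk'
          rw [hk', ← add_smul]
          push_cast
          rw [sub_add_cancel]
        rw [hφk, inner_smul_left, (Submodule.mem_orthogonal _ _).1 hψ _ hmem, mul_zero]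

end UnboundedOp

namespace UnboundedOp

open Filter Topology ComplexConjugate

variable {H : Type*} [NormedAddCommGroup H] [InnerProductSpace ℂ H]

/-! ### The Borel transform of a finite measure -/

theorem inv_ofReal_sub_im (t x ε : ℝ) :
    (((t : ℂ) - (x + ε * Complex.I))⁻¹).im = ε / ((t - x) ^ 2 + ε ^ 2) := by
  rw [Complex.inv_im, Complex.normSq_apply]
  simp
  ring

theorem integrable_inv_ofReal_sub (μ : Measure ℝ) [IsFiniteMeasure μ] {z : ℂ} (hz : z.im ≠ 0) :
    Integrable (fun t : ℝ => ((t : ℂ) - z)⁻¹) μ := by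
  refine Integrable.of_bound (C := |z.im|⁻¹) (by fun_prop) (Eventually.of_forall fun t => ?_)
  rw [norm_inv]
  refine inv_anti₀ (abs_pos.2 hz) ?_
  have := Complex.abs_im_le_norm ((t : ℂ) - z)
  simpa using this

theorem add_mul_I_im (x ε : ℝ) : ((x : ℂ) + ε * Complex.I).im = ε := by simp

/-- The imaginary part of the Borel transform is the Poisson integral. -/
theorem im_borelTransform (μ : Measure ℝ) [IsFiniteMeasure μ] (x : ℝ) {ε : ℝ} (hε : 0 < ε) :
    (∫ t : ℝ, ((t : ℂ) - (x + ε * Complex.I))⁻¹ ∂μ).im = ∫ t, ε / ((t - x) ^ 2 + ε ^ 2) ∂μ := by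
  have hi := integrable_inv_ofReal_sub μ (z := x + ε * Complex.I) (by simp [hε.ne'])
  have h : (∫ t : ℝ, ((t : ℂ) - (x + ε * Complex.I))⁻¹ ∂μ).im
      = ∫ t : ℝ, (((t : ℂ) - (x + ε * Complex.I))⁻¹).im ∂μ := (integral_im hi).symm
  rw [h]
  simp only [inv_ofReal_sub_im]

theorem integrable_poisson (μ : Measure ℝ) [IsFiniteMeasure μ] (x : ℝ) {ε : ℝ} (hε : 0 < ε) :
    Integrable (fun t : ℝ => ε / ((t - x) ^ 2 + ε ^ 2)) μ := by
  have hi := (integrable_inv_ofReal_sub μ (z := x + ε * Complex.I) (by simp [hε.ne'])).im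
  simpa only [inv_ofReal_sub_im, RCLike.im_eq_complex_im] using hi

/-- The Poisson kernel of width `ε` is at least `1 / (2ε)` on the ball of radius `ε`. -/
theorem measure_closedBall_le (μ : Measure ℝ) [IsFiniteMeasure μ] (x : ℝ) {ε : ℝ} (hε : 0 < ε) :
    μ.real (Metric.closedBall x ε)
      ≤ 2 * ε * (∫ t : ℝ, ((t : ℂ) - (x + ε * Complex.I))⁻¹ ∂μ).im := by
  rw [im_borelTransform μ x hε]
  have hm : MeasurableSet (Metric.closedBall x ε) := Metric.isClosed_closedBall.measurableSet
  have h : (2 * ε)⁻¹ * μ.real (Metric.closedBall x ε) ≤ ∫ t, ε / ((t - x) ^ 2 + ε ^ 2) ∂μ := by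
    rw [← integral_indicator_one hm, ← integral_const_mul]
    refine integral_mono (((integrable_const 1).indicator hm).const_mul _)
      (integrable_poisson μ x hε) fun t => ?_
    by_cases ht : t ∈ Metric.closedBall x ε
    · simp only [indicator_of_mem ht, Pi.one_apply, mul_one]
      rw [Metric.mem_closedBall, Real.dist_eq] at ht
      have h2 : (t - x) ^ 2 ≤ ε ^ 2 := by
        rw [← sq_abs (t - x)]; gcongr
      rw [inv_eq_one_div, div_le_div_iff₀ (by positivity) (by positivity)]
      nlinarith
    · simp only [indicator_of_notMem ht, mul_zero]
      positivity
  rwa [inv_mul_le_iff₀ (by positivity)] at h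

/-- A bound on the boundary values of the Borel transform bounds the density of the measure. -/
theorem measure_le_mul_volume (μ : Measure ℝ) [IsFiniteMeasure μ] {s : Set ℝ} {C : ℝ}
    (h : ∀ x ∈ s, ∀ᶠ ε : ℝ in 𝓝[>] 0,
      (∫ t : ℝ, ((t : ℂ) - (x + ε * Complex.I))⁻¹ ∂μ).im ≤ C) :
    μ s ≤ ENNReal.ofReal C * volume s := by
  have key : μ s ≤ (C.toNNReal • volume : Measure ℝ) s := by
    -- Besicovitch covering: it suffices to compare `μ` with `C` times Lebesgue measure on small
    -- balls around the points of `s`. The bound `2 ε C` is `C` times the length of such a ball.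
    refine (Besicovitch.vitaliFamily μ).measure_le_of_frequently_le (C.toNNReal • volume)
      Measure.AbsolutelyContinuous.rfl s fun x hx => ?_
    refine (Besicovitch.tendsto_filterAt μ x).frequently (Eventually.frequently ?_)
    filter_upwards [h x hx, self_mem_nhdsWithin] with ε hε (hε0 : 0 < ε)
    have h1 := (measure_closedBall_le μ x hε0).trans
      (mul_le_mul_of_nonneg_left hε (by positivity))
    rw [Measure.smul_apply, Real.volume_closedBall, ENNReal.smul_def, smul_eq_mul,
      ← ENNReal.ofReal_toReal (measure_ne_top μ (Metric.closedBall x ε)), ← ENNReal.ofReal.eq_1,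
      mul_comm, ← ENNReal.ofReal_mul (by positivity)]
    exact ENNReal.ofReal_le_ofReal h1
  rwa [Measure.smul_apply, ENNReal.smul_def, smul_eq_mul] at key

/-- A set on which the boundary values of the imaginary part of the Borel transform are zero is
a null set. -/
theorem measure_eq_zero_of_im_tendsto_zero (μ : Measure ℝ) [IsFiniteMeasure μ] {s : Set ℝ}
    (h : ∀ x ∈ s, Tendsto (fun ε : ℝ => (∫ t : ℝ, ((t : ℂ) - (x + ε * Complex.I))⁻¹ ∂μ).im)
      (𝓝[>] 0) (𝓝 0)) : μ s = 0 := by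
  have hb : ∀ n : ℕ, μ (s ∩ Icc (-n : ℝ) n) = 0 := by
    intro n
    -- Every `C > 0` is an admissible density bound. The cut-off to `[-n, n]` keeps the volume
    -- finite, so that the product vanishes as `C → 0`.
    have hlim : Tendsto (fun C : ℝ => ENNReal.ofReal C * volume (s ∩ Icc (-n : ℝ) n)) (𝓝[>] 0)
        (𝓝 0) := by
      have hfin : volume (s ∩ Icc (-n : ℝ) n) ≠ ∞ :=
        ((measure_mono inter_subset_right).trans_lt (by simp)).ne
      have : Tendsto (fun C : ℝ => ENNReal.ofReal C) (𝓝[>] 0) (𝓝 0) := by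
        simpa using (ENNReal.continuous_ofReal.tendsto 0).mono_left nhdsWithin_le_nhds
      simpa using ENNReal.Tendsto.mul_const this (Or.inr hfin)
    refine le_antisymm (ge_of_tendsto hlim ?_) zero_le
    filter_upwards [self_mem_nhdsWithin] with C (hC : 0 < C)
    refine measure_le_mul_volume μ fun x hx => ?_
    exact (h x hx.1).eventually (eventually_le_nhds hC)
  have : s ⊆ ⋃ n : ℕ, s ∩ Icc (-n : ℝ) n := by
    intro x hx
    obtain ⟨n, hn⟩ := exists_nat_ge |x|
    exact mem_iUnion.2 ⟨n, hx, abs_le.1 hn⟩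
  exact measure_mono_null this (measure_iUnion_null hb)

/-- A set on which the imaginary part of the Borel transform has bounded boundary values has
measure zero if its Lebesgue measure is zero. -/
theorem measure_eq_zero_of_im_bounded (μ : Measure ℝ) [IsFiniteMeasure μ] {s : Set ℝ}
    (hs : volume s = 0) (h : ∀ x ∈ s, ∃ C : ℝ, ∀ᶠ ε : ℝ in 𝓝[>] 0,
      (∫ t : ℝ, ((t : ℂ) - (x + ε * Complex.I))⁻¹ ∂μ).im ≤ C) : μ s = 0 := by
  have : s ⊆ ⋃ n : ℕ, {x ∈ s | ∀ᶠ ε : ℝ in 𝓝[>] 0,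
      (∫ t : ℝ, ((t : ℂ) - (x + ε * Complex.I))⁻¹ ∂μ).im ≤ n} := by
    intro x hx
    obtain ⟨C, hC⟩ := h x hx
    obtain ⟨n, hn⟩ := exists_nat_ge C
    exact mem_iUnion.2 ⟨n, hx, hC.mono fun ε hε => hε.trans hn⟩
  refine measure_mono_null this (measure_iUnion_null fun n => ?_)
  have h1 := measure_le_mul_volume μ (s := {x ∈ s | ∀ᶠ ε : ℝ in 𝓝[>] 0,
      (∫ t : ℝ, ((t : ℂ) - (x + ε * Complex.I))⁻¹ ∂μ).im ≤ n}) (C := n) fun x hx => hx.2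
  rw [measure_mono_null (sep_subset _ _) hs, mul_zero] at h1
  exact le_antisymm h1 zero_le

/-- `ε` times the Poisson kernel is bounded by `1` and tends to `0` off the point `x`; dominated
convergence applies because `x` is a null point. -/
theorem tendsto_mul_im_borelTransform (μ : Measure ℝ) [IsFiniteMeasure μ] {x : ℝ}
    (hx : μ {x} = 0) :
    Tendsto (fun ε : ℝ => ε * (∫ t : ℝ, ((t : ℂ) - (x + ε * Complex.I))⁻¹ ∂μ).im)
      (𝓝[>] 0) (𝓝 0) := by
  have h1 : Tendsto (fun ε : ℝ => ∫ t, ε * (ε / ((t - x) ^ 2 + ε ^ 2)) ∂μ) (𝓝[>] 0)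
      (𝓝 (∫ _, (0 : ℝ) ∂μ)) := by
    refine tendsto_integral_filter_of_dominated_convergence (fun _ => 1) ?_ ?_
      (integrable_const _) ?_
    · filter_upwards [self_mem_nhdsWithin] with ε (hε : 0 < ε)
      exact ((integrable_poisson μ x hε).const_mul ε).aestronglyMeasurable
    · filter_upwards [self_mem_nhdsWithin] with ε (hε : 0 < ε)
      refine Eventually.of_forall fun t => ?_
      rw [Real.norm_of_nonneg (by positivity), mul_div, div_le_one (by positivity)]
      nlinarith [sq_nonneg (t - x)]
    · have hae : ∀ᵐ t ∂μ, t ≠ x := by rw [ae_iff]; simpa using hx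
      filter_upwards [hae] with t ht
      have hne : (t - x) ^ 2 + (0 : ℝ) ^ 2 ≠ 0 := by
        simpa using sub_ne_zero.2 ht
      have hc : ContinuousAt (fun ε : ℝ => ε * (ε / ((t - x) ^ 2 + ε ^ 2))) 0 := by
        refine continuousAt_id.mul (continuousAt_id.div (by fun_prop) hne)
      have := hc.tendsto
      rw [zero_mul] at this
      exact this.mono_left nhdsWithin_le_nhds
  rw [integral_zero] at h1
  refine h1.congr' ?_
  filter_upwards [self_mem_nhdsWithin] with ε (hε : 0 < ε)
  rw [im_borelTransform μ x hε, integral_const_mul]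

/-! ### Spectral measures and the spectrum -/

theorem IsSymm.eq_of_sub_smul_eq {T : H →ₗ.[ℂ] H} (hT : IsSymm T) {z : ℂ} (hz : z.im ≠ 0)
    {f g : T.domain} (h : T f - z • (f : H) = T g - z • (g : H)) : f = g := by
  have h5 := hT.im_mul_norm_le (f - g) z
  have h6 : T (f - g) - z • ((f - g : T.domain) : H) = 0 := by
    rw [LinearPMap.map_sub]
    push_cast
    rw [smul_sub, sub_sub_sub_comm, h, sub_self]
  rw [h6, norm_zero] at h5
  have h8 : ‖((f - g : T.domain) : H)‖ = 0 :=
    le_antisymm (by by_contra hc; push Not at hc; nlinarith [mul_pos (abs_pos.2 hz) hc])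
      (norm_nonneg _)
  exact sub_eq_zero.1 (Subtype.ext (norm_eq_zero.1 h8))

/-- The imaginary part of the Borel transform is `ε ‖(T - z)⁻¹ ψ‖²`; through this identity norm
estimates for the resolvent become statements about the spectral measure. -/
theorem IsSymm.exists_resolvent_of_isSpectralMeasure {T : H →ₗ.[ℂ] H} (hT : IsSymm T) {ψ : H}
    {μ : Measure ℝ} (h : IsSpectralMeasure T ψ μ) (x : ℝ) {ε : ℝ} (hε : 0 < ε) :
    ∃ f : T.domain, T f - ((x : ℂ) + ε * Complex.I) • (f : H) = ψ ∧
      ⟪ψ, (f : H)⟫_ℂ = ∫ t : ℝ, ((t : ℂ) - (x + ε * Complex.I))⁻¹ ∂μ ∧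
      (∫ t : ℝ, ((t : ℂ) - (x + ε * Complex.I))⁻¹ ∂μ).im = ε * ‖(f : H)‖ ^ 2 := by
  obtain ⟨f, hf, hf'⟩ := h.2 (x + ε * Complex.I) (by simp [hε.ne'])
  refine ⟨f, hf, hf', ?_⟩
  rw [← hf']
  nth_rewrite 1 [← hf]
  rw [hT.im_inner_resolvent, add_mul_I_im]

/-- Spectral measures do not charge the resolvent set. -/
theorem IsSymm.measure_resolventSet {T : H →ₗ.[ℂ] H} (hT : IsSymm T) {ψ : H}
    {μ : Measure ℝ} (h : IsSpectralMeasure T ψ μ) : μ {x : ℝ | (x : ℂ) ∈ resolventSet T} = 0 := by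
  have := h.1
  refine measure_eq_zero_of_im_tendsto_zero μ fun x hx => ?_
  obtain ⟨R, -, hR⟩ := hx
  have hlim : Tendsto (fun ε : ℝ => ε * (2 * (‖R‖ * ‖ψ‖)) ^ 2) (𝓝[>] 0) (𝓝 0) := by
    have : Continuous fun ε : ℝ => ε * (2 * (‖R‖ * ‖ψ‖)) ^ 2 := by fun_prop
    simpa using (this.tendsto 0).mono_left nhdsWithin_le_nhds
  have hsmall : ∀ᶠ ε : ℝ in 𝓝[>] 0, ‖R‖ * ε ≤ 1 / 2 := by
    have : Continuous fun ε : ℝ => ‖R‖ * ε := by fun_prop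
    have h2 : Tendsto (fun ε : ℝ => ‖R‖ * ε) (𝓝[>] 0) (𝓝 0) := by
      simpa using (this.tendsto 0).mono_left nhdsWithin_le_nhds
    exact h2.eventually (eventually_le_nhds (by norm_num))
  refine tendsto_of_tendsto_of_tendsto_of_le_of_le' tendsto_const_nhds hlim ?_ ?_
  · filter_upwards [self_mem_nhdsWithin] with ε (hε : 0 < ε)
    obtain ⟨f, -, -, h3⟩ := hT.exists_resolvent_of_isSpectralMeasure h x hε
    rw [h3]; positivity
  · filter_upwards [self_mem_nhdsWithin, hsmall] with ε (hε : 0 < ε) hs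
    obtain ⟨f, h1, -, h3⟩ := hT.exists_resolvent_of_isSpectralMeasure h x hε
    rw [h3]
    -- First resolvent identity between `x + iε` and `x`. Once `‖R‖ ε ≤ 1/2`, the term with `f` is
    -- absorbed and `‖f‖` stays bounded.
    have h4 : (f : H) = R (ψ + (ε * Complex.I) • (f : H)) := by
      have : T f - (x : ℂ) • (f : H) = ψ + (ε * Complex.I) • (f : H) := by
        rw [← h1, add_smul]; abel
      rw [← this, hR f]
    have h5 : ‖(f : H)‖ ≤ ‖R‖ * (‖ψ‖ + ε * ‖(f : H)‖) := by
      nth_rewrite 1 [h4]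
      refine (R.le_opNorm _).trans ?_
      gcongr
      refine (norm_add_le _ _).trans_eq ?_
      rw [norm_smul]
      simp [abs_of_pos hε]
    have h6 : ‖(f : H)‖ ≤ 2 * (‖R‖ * ‖ψ‖) := by
      have := norm_nonneg (f : H)
      nlinarith
    gcongr

/-- The spectral measure of an eigenvector does not charge the complement of the eigenvalue. -/
theorem IsSymm.measure_compl_of_mem_eigenspace [CompleteSpace H] {T : H →ₗ.[ℂ] H} (hT : IsSymm T)
    {E : ℝ} {ψ : H} (hψ : ψ ∈ eigenspace T (E : ℂ)) {μ : Measure ℝ}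
    (h : IsSpectralMeasure T ψ μ) : μ {E}ᶜ = 0 := by
  have := h.1
  obtain ⟨v, rfl, hv⟩ := mem_eigenspace_iff.1 hψ
  refine measure_eq_zero_of_im_tendsto_zero μ fun x hx => ?_
  have hne : x - E ≠ 0 := sub_ne_zero.2 hx
  have hlim : Tendsto (fun ε : ℝ => ε * (‖(v : H)‖ ^ 2 / ((x - E) ^ 2))) (𝓝[>] 0) (𝓝 0) := by
    have : Continuous fun ε : ℝ => ε * (‖(v : H)‖ ^ 2 / ((x - E) ^ 2)) := by fun_prop
    simpa using (this.tendsto 0).mono_left nhdsWithin_le_nhds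
  refine tendsto_of_tendsto_of_tendsto_of_le_of_le' tendsto_const_nhds hlim ?_ ?_
  · filter_upwards [self_mem_nhdsWithin] with ε (hε : 0 < ε)
    obtain ⟨f, -, -, h3⟩ := hT.exists_resolvent_of_isSpectralMeasure h x hε
    rw [h3]; positivity
  · filter_upwards [self_mem_nhdsWithin] with ε (hε : 0 < ε)
    obtain ⟨f, h1, -, h3⟩ := hT.exists_resolvent_of_isSpectralMeasure h x hε
    rw [h3]
    have hz : ((x : ℂ) + ε * Complex.I) ≠ E := fun h' => by
      have := congrArg Complex.im h'
      simp [hε.ne'] at this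
    set z : ℂ := (x : ℂ) + ε * Complex.I with hzdef
    have hzE : (E : ℂ) - z ≠ 0 := sub_ne_zero.2 hz.symm
    -- On an eigenvector the resolvent is the scalar `1 / (E - z)`, bounded by `1 / |x - E|`.
    have h4 : ((E : ℂ) - z) • f = v := by
      refine hT.eq_of_sub_smul_eq (z := z) (by simp [hzdef, hε.ne']) ?_
      have h7 : T f = (v : H) + z • (f : H) := by rw [← h1]; abel
      rw [LinearPMap.map_smul, hv, h7]
      push_cast
      module
    have h5 : ‖(E : ℂ) - z‖ * ‖(f : H)‖ = ‖(v : H)‖ := by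
      rw [← norm_smul, ← h4]; rfl
    have h6 : |x - E| ≤ ‖(E : ℂ) - z‖ := by
      have := Complex.abs_re_le_norm ((E : ℂ) - z)
      rw [abs_sub_comm]
      simpa [hzdef] using this
    have h7 : |x - E| * ‖(f : H)‖ ≤ ‖(v : H)‖ := by
      rw [← h5]; gcongr
    refine mul_le_mul_of_nonneg_left ?_ hε.le
    rw [le_div_iff₀ (by positivity), ← sq_abs (x - E), ← mul_pow, mul_comm]
    gcongr

/-- Vectors with absolutely continuous spectral measure are orthogonal to the eigenvectors. -/
theorem IsSymm.inner_eq_zero_of_measure_singleton {T : H →ₗ.[ℂ] H} (hT : IsSymm T)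
    {E : ℝ} {v ψ : H} (hv : v ∈ eigenspace T (E : ℂ)) {μ : Measure ℝ}
    (h : IsSpectralMeasure T ψ μ) (h0 : μ {E} = 0) : ⟪v, ψ⟫_ℂ = 0 := by
  have := h.1
  obtain ⟨v, rfl, hv⟩ := mem_eigenspace_iff.1 hv
  have hlim := (tendsto_mul_im_borelTransform μ h0).const_mul (‖(v : H)‖ ^ 2)
  rw [mul_zero] at hlim
  have hle : ‖⟪(v : H), ψ⟫_ℂ‖ ^ 2 ≤ 0 := by
    refine ge_of_tendsto hlim ?_
    filter_upwards [self_mem_nhdsWithin] with ε (hε : 0 < ε)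
    obtain ⟨f, h1, -, h3⟩ := hT.exists_resolvent_of_isSpectralMeasure h E hε
    rw [h3]
    -- Moving `T` to the eigenvector leaves a factor `ε`. Hence `|⟨v, ψ⟩|² ≤ ‖v‖² · ε · (ε ‖f‖²)`,
    -- where `ε ‖f‖²` is the imaginary part of the Borel transform.
    have h4 : ⟪(v : H), ψ⟫_ℂ = -(ε * Complex.I) * ⟪(v : H), (f : H)⟫_ℂ := by
      rw [← h1, inner_sub_right, ← hT v f, hv, inner_smul_left, inner_smul_right,
        Complex.conj_ofReal]
      ring
    have h5 : ‖⟪(v : H), ψ⟫_ℂ‖ ≤ ε * (‖(v : H)‖ * ‖(f : H)‖) := by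
      rw [h4, norm_mul]
      refine mul_le_mul (by simp [abs_of_pos hε]) (norm_inner_le_norm _ _) (norm_nonneg _) hε.le
    calc ‖⟪(v : H), ψ⟫_ℂ‖ ^ 2 ≤ (ε * (‖(v : H)‖ * ‖(f : H)‖)) ^ 2 := by gcongr
      _ = _ := by ring
  have := le_antisymm hle (by positivity)
  simpa using this

/-- A point of the spectrum is charged, with all its neighbourhoods, by some spectral measure. -/
theorem IsSpectralFamily.exists_measure_ne_zero [CompleteSpace H] {T : H →ₗ.[ℂ] H} (hT : IsSymm T)
    {μ : H → Measure ℝ} (hμ : IsSpectralFamily T μ) {E₀ : ℝ} (hE₀ : (E₀ : ℂ) ∈ resolventSet T)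
    {E : ℝ} (hE : (E : ℂ) ∈ spec T) {U : Set ℝ} (hU : IsOpen U) (hEU : E ∈ U) :
    ∃ ψ, μ ψ U ≠ 0 := by
  by_contra! hcon
  obtain ⟨d, hd, hball⟩ := Metric.isOpen_iff.1 hU E hEU
  set ε : ℝ := d / 2 with hε
  have hε0 : 0 < ε := by positivity
  -- If no spectral measure charges the `d`-ball around `E`, the resolvent at `z` has norm at most
  -- `1/d`. As `|E - z| = d/2`, a Neumann series then reaches `E`.
  set z : ℂ := (E : ℂ) + ε * Complex.I with hz
  obtain ⟨R, hR₁, -⟩ := hT.mem_resolventSet_of_im_ne_zero hE₀ (z := z) (by simp [hz, hε0.ne'])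
  have hbound : ∀ ψ, ‖R ψ‖ ≤ d⁻¹ * ‖ψ‖ := by
    intro ψ
    have := (hμ.isSpectralMeasure ψ).1
    obtain ⟨f, hf, -, h3⟩ :=
      hT.exists_resolvent_of_isSpectralMeasure (hμ.isSpectralMeasure ψ) E hε0
    obtain ⟨g, hg, hg'⟩ := hR₁ ψ
    have hfg : (f : H) = R ψ := by
      rw [← hg, hT.eq_of_sub_smul_eq (z := z) (by simp [hz, hε0.ne']) (hf.trans hg'.symm)]
    rw [im_borelTransform _ _ hε0] at h3
    have h4 : ∫ t, ε / ((t - E) ^ 2 + ε ^ 2) ∂(μ ψ) ≤ ∫ _, ε / d ^ 2 ∂(μ ψ) := by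
      refine integral_mono_ae (integrable_poisson _ _ hε0) (integrable_const _) ?_
      have hae : ∀ᵐ t ∂(μ ψ), t ∉ U := measure_eq_zero_iff_ae_notMem.1 (hcon ψ)
      filter_upwards [hae] with t ht
      have : d ≤ |t - E| := by
        by_contra hlt
        push Not at hlt
        exact ht (hball (by rwa [Metric.mem_ball, Real.dist_eq]))
      have h2 : d ^ 2 ≤ (t - E) ^ 2 := by rw [← sq_abs (t - E)]; gcongr
      exact div_le_div_of_nonneg_left hε0.le (by positivity) (by nlinarith [sq_nonneg ε])
    rw [h3, integral_const, Measure.real, hμ.measure_univ, ENNReal.toReal_ofReal (by positivity),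
      smul_eq_mul, hfg, mul_div_left_comm] at h4
    have h5 := le_of_mul_le_mul_left h4 hε0
    rw [← div_pow] at h5
    rw [inv_mul_eq_div]
    exact (sq_le_sq₀ (norm_nonneg _) (by positivity)).1 h5
  have hnorm : ‖((E : ℂ) - z) • R‖ < 1 := by
    have h1 : ‖R‖ ≤ d⁻¹ := R.opNorm_le_bound (by positivity) hbound
    have h2 : ‖(E : ℂ) - z‖ = ε := by simp [hz, abs_of_pos hε0]
    rw [norm_smul, h2]
    calc ε * ‖R‖ ≤ ε * d⁻¹ := by gcongr
      _ = 1 / 2 := by rw [hε]; field_simp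
      _ < 1 := by norm_num
  exact hE (hT.mem_resolventSet (exists_solution_of_isUnit hR₁
    (isUnit_one_sub_of_norm_lt_one hnorm)))

end UnboundedOp

/-! ### Absolutely continuous functions on an edge -/

namespace RingChain

open Filter Topology ComplexConjugate

/-- `v` is an absolutely continuous function on `[0, π]` with derivative `w`. -/
structure IsPrim (v w : ℝ → ℂ) : Prop where
  ii : IntervalIntegrable w volume 0 Real.pi
  eq : ∀ x ∈ Icc 0 Real.pi, v x = v 0 + ∫ t in (0 : ℝ)..x, w t

theorem IsH2.isPrim {u u₁ u₂ : ℝ → ℂ} (h : IsH2 u u₁ u₂) : IsPrim u u₁ := ⟨h.ii₁, h.eq⟩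

theorem IsH2.isPrim₁ {u u₁ u₂ : ℝ → ℂ} (h : IsH2 u u₁ u₂) : IsPrim u₁ u₂ := ⟨h.ii₂, h.deriv_eq⟩

theorem IsPrim.continuousOn {v w : ℝ → ℂ} (h : IsPrim v w) : ContinuousOn v (Icc 0 Real.pi) :=
  continuousOn_primitive h.ii h.eq

theorem isH2_of_isPrim {u u₁ u₂ : ℝ → ℂ} (h : IsPrim u u₁) (h₁ : IsPrim u₁ u₂)
    (h₂ : MemLp u₂ 2 edgeMeasure) : IsH2 u u₁ u₂ := ⟨h₂, h₁.eq, h.eq⟩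

theorem isPrim_of_hasDerivAt {v w : ℝ → ℂ} (h : ∀ x, HasDerivAt v (w x) x) (hw : Continuous w) :
    IsPrim v w := by
  refine ⟨hw.intervalIntegrable _ _, fun x _ => ?_⟩
  rw [intervalIntegral.integral_eq_sub_of_hasDerivAt (fun y _ => h y) (hw.intervalIntegrable _ _)]
  ring

theorem IsPrim.sub_eq {v w : ℝ → ℂ} (h : IsPrim v w) {x y : ℝ} (hx : x ∈ Icc 0 Real.pi)
    (hy : y ∈ Icc 0 Real.pi) : v y - v x = ∫ t in x..y, w t := by
  rw [h.eq x hx, h.eq y hy,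
    ← intervalIntegral.integral_interval_sub_left (ii_mono h.ii hy) (ii_mono h.ii hx)]
  ring

/-- The increments of `v` are dominated by those of the absolutely continuous function `∫ ‖w‖`. -/
theorem IsPrim.absolutelyContinuous {v w : ℝ → ℂ} (h : IsPrim v w) :
    AbsolutelyContinuousOnInterval v 0 Real.pi := by
  have h1 := h.ii.norm.absolutelyContinuousOnInterval_intervalIntegral (c := 0) left_mem_uIcc
  rw [absolutelyContinuousOnInterval_iff] at h1 ⊢
  intro ε hε
  obtain ⟨δ, hδ, H⟩ := h1 ε hε
  refine ⟨δ, hδ, fun E hE hlt => lt_of_le_of_lt (Finset.sum_le_sum fun i hi => ?_) (H E hE hlt)⟩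
  have hmem := hE.1 i hi
  rw [uIcc_of_le Real.pi_pos.le] at hmem
  have hn := h.ii.norm
  have hm : ∀ {x : ℝ}, x ∈ Icc 0 Real.pi → IntervalIntegrable (fun t => ‖w t‖) volume 0 x :=
    fun hx => hn.mono_set (by
      rw [uIcc_of_le hx.1, uIcc_of_le Real.pi_pos.le]; exact Icc_subset_Icc_right hx.2)
  rw [dist_comm, dist_eq_norm, h.sub_eq hmem.1 hmem.2, dist_comm, Real.dist_eq,
    intervalIntegral.integral_interval_sub_left (hm hmem.2) (hm hmem.1)]
  exact intervalIntegral.norm_integral_le_abs_integral_norm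

theorem IsPrim.ae_hasDerivAt {v w : ℝ → ℂ} (h : IsPrim v w) :
    ∀ᵐ x, x ∈ Ioo 0 Real.pi → HasDerivAt v (w x) x := by
  filter_upwards [h.ii.ae_hasDerivAt_integral] with x hx hxm
  have h1 := hx (by rw [uIcc_of_le Real.pi_pos.le]; exact Ioo_subset_Icc_self hxm) 0 left_mem_uIcc
  refine (h1.const_add (v 0)).congr_of_eventuallyEq ?_
  filter_upwards [isOpen_Ioo.mem_nhds hxm] with y hy
  exact h.eq y (Ioo_subset_Icc_self hy)

theorem ae_mem_Ioo_of_mem_uIcc : ∀ᵐ x : ℝ, x ∈ uIcc 0 Real.pi → x ∈ Ioo 0 Real.pi := by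
  have h : ∀ᵐ x : ℝ, x ≠ 0 ∧ x ≠ Real.pi := by
    refine (Measure.ae_ne volume 0).and (Measure.ae_ne volume Real.pi)
  filter_upwards [h] with x hx hxm
  rw [uIcc_of_le Real.pi_pos.le] at hxm
  exact ⟨lt_of_le_of_ne hxm.1 hx.1.symm, lt_of_le_of_ne hxm.2 hx.2⟩

/-- The difference of `v` and the primitive of `w` is absolutely continuous with derivative zero
almost everywhere, hence constant. -/
theorem isPrim_of_absolutelyContinuous {v w : ℝ → ℂ}
    (hv : AbsolutelyContinuousOnInterval v 0 Real.pi)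
    (hw : IntervalIntegrable w volume 0 Real.pi)
    (h : ∀ᵐ x, x ∈ Ioo 0 Real.pi → HasDerivAt v (w x) x) : IsPrim v w := by
  have hP : IsPrim (fun x => ∫ t in (0 : ℝ)..x, w t) w := ⟨hw, fun x _ => by simp⟩
  obtain ⟨C, hC⟩ := (hv.sub hP.absolutelyContinuous).const_of_ae_hasDerivAt_zero (by
    filter_upwards [h, hP.ae_hasDerivAt, ae_mem_Ioo_of_mem_uIcc] with x h1 h2 h3 hx
    have := (h1 (h3 hx)).sub (h2 (h3 hx))
    rwa [sub_self] at this)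
  refine ⟨hw, fun x hx => ?_⟩
  have h1 := hC x (by rwa [uIcc_of_le Real.pi_pos.le])
  have h2 := hC 0 left_mem_uIcc
  simp only [Pi.sub_apply, intervalIntegral.integral_same, sub_zero] at h1 h2
  rw [h2, ← h1]; ring

theorem ContinuousOn.ii_mul {v w : ℝ → ℂ} (hv : ContinuousOn v (Icc 0 Real.pi))
    (hw : IntervalIntegrable w volume 0 Real.pi) :
    IntervalIntegrable (fun x => v x * w x) volume 0 Real.pi :=
  hw.continuousOn_mul (by rwa [uIcc_of_le Real.pi_pos.le])

/-- The product rule. -/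
theorem IsPrim.mul {v w v' w' : ℝ → ℂ} (h : IsPrim v w) (h' : IsPrim v' w') :
    IsPrim (fun x => v x * v' x) (fun x => v' x * w x + v x * w' x) := by
  refine isPrim_of_absolutelyContinuous ?_ ?_ ?_
  · exact h.absolutelyContinuous.smul h'.absolutelyContinuous
  · exact (ContinuousOn.ii_mul h'.continuousOn h.ii).add (ContinuousOn.ii_mul h.continuousOn h'.ii)
  · filter_upwards [h.ae_hasDerivAt, h'.ae_hasDerivAt] with x h1 h2 hx
    exact ((h1 hx).fun_mul (h2 hx)).congr_deriv (by ring)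

theorem IsPrim.congr_ae {v w w' : ℝ → ℂ} (h : IsPrim v w) (hw : w =ᵐ[edgeMeasure] w') :
    IsPrim v w' := by
  have hw' : ∀ᵐ x, x ∈ Ioc 0 Real.pi → w x = w' x := by
    rw [← ae_restrict_iff' measurableSet_Ioc]
    exact ae_restrict_of_ae_restrict_of_subset Ioc_subset_Icc_self hw
  refine ⟨h.ii.congr_ae ?_, fun x hx => ?_⟩
  · rwa [uIoc_of_le Real.pi_pos.le, EventuallyEq, ae_restrict_iff' measurableSet_Ioc]
  · rw [h.eq x hx]
    congr 1
    refine intervalIntegral.integral_congr_ae ?_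
    filter_upwards [hw'] with t ht htm
    rw [uIoc_of_le hx.1] at htm
    exact ht ⟨htm.1, htm.2.trans hx.2⟩

theorem IsPrim.congr {v v' w w' : ℝ → ℂ} (h : IsPrim v w) (hv : ∀ x, v x = v' x)
    (hw : ∀ x, w x = w' x) : IsPrim v' w' := by
  rw [← funext hv, ← funext hw]; exact h

theorem IsPrim.add {v w v' w' : ℝ → ℂ} (h : IsPrim v w) (h' : IsPrim v' w') :
    IsPrim (fun x => v x + v' x) (fun x => w x + w' x) := by
  refine ⟨h.ii.add h'.ii, fun x hx => ?_⟩
  rw [intervalIntegral.integral_add (ii_mono h.ii hx) (ii_mono h'.ii hx), h.eq x hx, h'.eq x hx]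
  ring

theorem IsPrim.const_mul {v w : ℝ → ℂ} (c : ℂ) (h : IsPrim v w) :
    IsPrim (fun x => c * v x) (fun x => c * w x) := by
  refine ⟨h.ii.const_mul c, fun x hx => ?_⟩
  rw [intervalIntegral.integral_const_mul, h.eq x hx]
  ring

theorem IsPrim.conj {v w : ℝ → ℂ} (h : IsPrim v w) :
    IsPrim (fun x => conj (v x)) (fun x => conj (w x)) := by
  have hint : ∀ y : ℝ, conj (∫ t in (0 : ℝ)..y, w t) = ∫ t in (0 : ℝ)..y, conj (w t) := fun y => by
    simp only [intervalIntegral, map_sub, integral_conj]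
  refine ⟨?_, fun x hx => ?_⟩
  · have := h.ii
    rw [intervalIntegrable_iff] at this ⊢
    exact (Complex.conjLIE.toContinuousLinearEquiv.toContinuousLinearMap.integrable_comp this)
  · rw [h.eq x hx, map_add, hint]

/-- Green's identity on an edge. -/
theorem green {p p₁ p₂ q q₁ q₂ : ℝ → ℂ} (hp : IsPrim p p₁) (hp₁ : IsPrim p₁ p₂) (hq : IsPrim q q₁)
    (hq₁ : IsPrim q₁ q₂) :
    ∫ x in (0 : ℝ)..Real.pi, (q x * p₂ x - q₂ x * p x)
      = (q Real.pi * p₁ Real.pi - q₁ Real.pi * p Real.pi) - (q 0 * p₁ 0 - q₁ 0 * p 0) := by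
  have h := ((hq.mul hp₁).add ((hq₁.mul hp).const_mul (-1)))
  have h2 := h.eq Real.pi ⟨Real.pi_pos.le, le_rfl⟩
  have h3 : ∫ x in (0 : ℝ)..Real.pi, (q x * p₂ x - q₂ x * p x)
      = ∫ x in (0 : ℝ)..Real.pi, (p₁ x * q₁ x + q x * p₂ x + -1 * (p x * q₂ x + q₁ x * p₁ x)) := by
    congr 1; ext x; ring
  rw [h3]
  linear_combination -h2

/-! ### The gauge transformation -/

/-- The phase `exp (i a x)`. -/
noncomputable def phase (a : ℂ) (x : ℝ) : ℂ := Complex.exp (Complex.I * a * x)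

theorem phase_zero (a : ℂ) : phase a 0 = 1 := by simp [phase]

theorem phase_ne_zero (a : ℂ) (x : ℝ) : phase a x ≠ 0 := Complex.exp_ne_zero _

theorem phase_neg_mul (a : ℂ) (x : ℝ) : phase (-a) x * phase a x = 1 := by
  rw [phase, phase, ← Complex.exp_add]
  simp

theorem phase_mul_neg (a : ℂ) (x : ℝ) : phase a x * phase (-a) x = 1 := by
  rw [mul_comm, phase_neg_mul]

theorem continuous_phase (a : ℂ) : Continuous (phase a) := by unfold phase; fun_prop

theorem hasDerivAt_phase (a : ℂ) (x : ℝ) : HasDerivAt (phase a) (Complex.I * a * phase a x) x := by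
  have h : HasDerivAt (fun y : ℝ => Complex.I * a * (y : ℂ)) (Complex.I * a) x := by
    simpa using (Complex.ofRealCLM.hasDerivAt (x := x)).const_mul (Complex.I * a)
  exact h.cexp.congr_deriv (mul_comm _ _)

theorem isPrim_phase (a : ℂ) : IsPrim (phase a) (fun x => Complex.I * a * phase a x) :=
  isPrim_of_hasDerivAt (hasDerivAt_phase a) (continuous_const.mul (continuous_phase a))

theorem norm_phase {a : ℂ} (ha : a.im = 0) (x : ℝ) : ‖phase a x‖ = 1 := by
  rw [phase, Complex.norm_exp]
  simp [ha]

/-- Multiplication by the phase intertwines the quasiderivative `𝒟` with the ordinary derivative. -/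
theorem IsPrim.gauge {v w : ℝ → ℂ} (a : ℂ) (h : IsPrim v w) :
    IsPrim (fun x => phase a x * v x) (fun x => phase a x * quasi a v w x) :=
  ((isPrim_phase a).mul h).congr (fun _ => rfl) fun x => by simp only [quasi]; ring

end RingChain

/-! ### The gauged form of the Hamiltonian -/

namespace RingChain

open Filter Topology ComplexConjugate

theorem coeff_im (A : ℝ) (e : Edge) : (coeff A e).im = 0 := by
  unfold coeff; split_ifs <;> simp

theorem coeff_true (A : ℝ) (j : ℤ) : coeff A (j, true) = A := by simp [coeff]

theorem coeff_false (A : ℝ) (j : ℤ) : coeff A (j, false) = -A := by simp [coeff]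

theorem conj_phase {a : ℂ} (ha : a.im = 0) (x : ℝ) : conj (phase a x) = phase (-a) x := by
  have : conj a = a := Complex.conj_eq_iff_im.2 ha
  rw [phase, phase, ← Complex.exp_conj]
  simp [this]

theorem memLp_of_continuousOn {v : ℝ → ℂ} (hv : ContinuousOn v (Icc 0 Real.pi)) :
    MemLp v 2 edgeMeasure := by
  obtain ⟨C, hC⟩ := isCompact_Icc.exists_bound_of_continuousOn hv
  refine MemLp.of_bound (hv.aestronglyMeasurable measurableSet_Icc) C ?_
  filter_upwards [ae_restrict_mem measurableSet_Icc] with x hx using hC x hx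

theorem MemLp.phase_mul {v : ℝ → ℂ} (a : ℂ) (hv : MemLp v 2 edgeMeasure) :
    MemLp (fun x => phase a x * v x) 2 edgeMeasure := by
  obtain ⟨C, hC⟩ := isCompact_Icc.exists_bound_of_continuousOn
    (continuous_phase a).continuousOn (s := Icc 0 Real.pi)
  refine (hv.const_mul (C : ℂ)).mono ((continuous_phase a).aestronglyMeasurable.mul hv.1) ?_
  filter_upwards [ae_restrict_mem measurableSet_Icc] with x hx
  rw [norm_mul, norm_mul]
  gcongr
  exact (hC x hx).trans (by simpa using le_abs_self C)

theorem IsPrim.quasi {u u₁ u₂ : ℝ → ℂ} (a : ℂ) (h : IsPrim u u₁) (h₁ : IsPrim u₁ u₂) :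
    IsPrim (quasi a u u₁) (quasi a u₁ u₂) :=
  (h₁.add (h.const_mul (Complex.I * a))).congr (fun _ => rfl) fun _ => rfl

theorem IsH2.gauge {u u₁ u₂ : ℝ → ℂ} (a : ℂ) (h : IsH2 u u₁ u₂) :
    IsH2 (fun x => phase a x * u x) (fun x => phase a x * RingChain.quasi a u u₁ x)
      (fun x => phase a x *
        RingChain.quasi a (RingChain.quasi a u u₁) (RingChain.quasi a u₁ u₂) x) := by
  have hq := h.isPrim.quasi a h.isPrim₁
  refine isH2_of_isPrim (h.isPrim.gauge a) (hq.gauge a) (MemLp.phase_mul a ?_)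
  have h1 : MemLp (RingChain.quasi a u₁ u₂) 2 edgeMeasure :=
    h.memLp.add ((memLp_of_continuousOn h.cont₁).const_mul (Complex.I * a))
  exact h1.add ((memLp_of_continuousOn hq.continuousOn).const_mul (Complex.I * a))

/-- `f` and `g = -Δ_α f` in terms of the gauged components `p`, where `v` is the sequence of the
vertex values. -/
structure IsGauged (A α : ℝ) (f g : L2Gamma) (p p₁ p₂ : Edge → ℝ → ℂ) (v : ℤ → ℂ) : Prop where
  isH2 : ∀ e, IsH2 (p e) (p₁ e) (p₂ e)
  f_eq : ∀ e, f e =ᵐ[edgeMeasure] fun x => phase (-coeff A e) x * p e x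
  g_eq : ∀ e, g e =ᵐ[edgeMeasure] fun x => -(phase (-coeff A e) x * p₂ e x)
  start : ∀ e, p e 0 = v e.1
  finish : ∀ e, p e Real.pi = phase (coeff A e) Real.pi * v (e.1 + 1)
  flux : ∀ j, p₁ (j + 1, true) 0 + p₁ (j + 1, false) 0
    - phase (-A) Real.pi * p₁ (j, true) Real.pi - phase A Real.pi * p₁ (j, false) Real.pi
    = α * v (j + 1)

/-- The phase equals `1` at the start of an edge, so all trace of the potential is moved to the end
point `π`. -/
theorem IsInGraph.exists_isGauged {A α : ℝ} {f g : L2Gamma} (h : IsInGraph A α f g) :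
    ∃ p p₁ p₂ v, IsGauged A α f g p p₁ p₂ v := by
  obtain ⟨u, u₁, u₂, h1, h2, h3, h4⟩ := h
  refine ⟨_, _, _, fun j => u (j, true) 0, fun e => (h1 e).gauge (coeff A e), fun e => ?_,
    fun e => ?_, ?_, ?_, fun j => ?_⟩
  · filter_upwards [h2 e] with x hx
    rw [hx, ← mul_assoc, phase_neg_mul, one_mul]
  · filter_upwards [h3 e] with x hx
    rw [hx, ← mul_assoc, phase_neg_mul, one_mul]
  · rintro ⟨j, _ | _⟩
    · simp only [phase_zero, one_mul, (h4 j).cont_lower]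
    · simp only [phase_zero, one_mul]
  · rintro ⟨j, _ | _⟩
    · have := (h4 (j + 1)).cont_prev_lower
      rw [add_sub_cancel_right] at this
      simp only [this]
    · have := (h4 (j + 1)).cont_prev_upper
      rw [add_sub_cancel_right] at this
      simp only [this]
  · have := (h4 (j + 1)).deriv_sum
    rw [add_sub_cancel_right] at this
    simp only [phase_zero, one_mul, coeff_true, coeff_false] at this ⊢
    rw [← mul_assoc, ← mul_assoc, phase_neg_mul, phase_mul_neg, one_mul, one_mul]
    exact this

theorem IsGauged.isInGraph {A α : ℝ} {f g : L2Gamma} {p p₁ p₂ : Edge → ℝ → ℂ} {v : ℤ → ℂ}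
    (h : IsGauged A α f g p p₁ p₂ v) : IsInGraph A α f g := by
  have key : ∀ (a : ℂ) (p p₁ : ℝ → ℂ), quasi a (fun x => phase (-a) x * p x)
      (fun x => phase (-a) x * quasi (-a) p p₁ x) = fun x => phase (-a) x * p₁ x := by
    intro a p p₁
    funext x
    simp only [quasi]
    ring
  have key2 : ∀ (a : ℂ) (p p₁ p₂ : ℝ → ℂ), quasi a (fun x => phase (-a) x * quasi (-a) p p₁ x)
      (fun x => phase (-a) x * quasi (-a) (quasi (-a) p p₁) (quasi (-a) p₁ p₂) x)
      = fun x => phase (-a) x * quasi (-a) p₁ p₂ x := by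
    intro a p p₁ p₂
    funext x
    simp only [quasi]
    ring
  refine ⟨_, _, _, fun e => (h.isH2 e).gauge (-coeff A e), h.f_eq, fun e => ?_, fun j => ?_⟩
  · filter_upwards [h.g_eq e] with x hx
    rw [hx, key, key2, key]
  · have hst : ∀ b, p (j, b) 0 = v j := fun b => h.start (j, b)
    have hfi : ∀ b, p (j - 1, b) Real.pi = phase (coeff A (j - 1, b)) Real.pi * v j := fun b => by
      have := h.finish (j - 1, b)
      rwa [sub_add_cancel] at this
    refine ⟨?_, ?_, ?_, ?_⟩
    · simp only [hst, phase_zero]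
    · simp only [hst, hfi, phase_zero, one_mul]
      rw [← mul_assoc, phase_neg_mul, one_mul]
    · simp only [hst, hfi, phase_zero, one_mul]
      rw [← mul_assoc, phase_neg_mul, one_mul]
    · rw [key, key, key, key]
      have := h.flux (j - 1)
      rw [sub_add_cancel] at this
      simp only [phase_zero, one_mul, coeff_true, coeff_false, neg_neg, hst]
      exact this

/-! ### Traces -/

theorem integral_norm_le (F : Lp ℂ 2 edgeMeasure) :
    ∫ x, ‖F x‖ ∂edgeMeasure ≤ Real.sqrt Real.pi * ‖F‖ := by
  have hF := Lp.memLp F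
  have h1 : ∫ x, ‖F x‖ ∂edgeMeasure = (eLpNorm F 1 edgeMeasure).toReal := by
    rw [eLpNorm_one_eq_lintegral_enorm, integral_norm_eq_lintegral_enorm hF.1]
  have h2 := eLpNorm_le_eLpNorm_mul_rpow_measure_univ (p := 1) (q := 2) one_le_two hF.1
  have hu : edgeMeasure univ = ENNReal.ofReal Real.pi := by
    simp [edgeMeasure]
  have h3 : edgeMeasure univ ^ (1 / (1 : ℝ≥0∞).toReal - 1 / (2 : ℝ≥0∞).toReal)
      = ENNReal.ofReal (Real.sqrt Real.pi) := by
    rw [hu, Real.sqrt_eq_rpow, ← ENNReal.ofReal_rpow_of_pos Real.pi_pos]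
    norm_num
  rw [h3] at h2
  rw [h1, Lp.norm_def, mul_comm]
  have h4 := ENNReal.toReal_mono (ENNReal.mul_ne_top hF.2.ne ENNReal.ofReal_ne_top) h2
  rwa [ENNReal.toReal_mul, ENNReal.toReal_ofReal (Real.sqrt_nonneg _)] at h4

theorem norm_integral_test_le {q φ : ℝ → ℂ} {F : Lp ℂ 2 edgeMeasure} {M x : ℝ}
    (hx : x ∈ Icc 0 Real.pi) (hM : ∀ t ∈ Icc 0 x, ‖q t‖ ≤ M)
    (h : ∀ᵐ t ∂edgeMeasure, ‖φ t‖ = ‖F t‖) :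
    ‖∫ t in (0 : ℝ)..x, q t * φ t‖ ≤ M * (Real.sqrt Real.pi * ‖F‖) := by
  have hM0 : 0 ≤ M := (norm_nonneg _).trans (hM 0 ⟨le_rfl, hx.1⟩)
  have hint : Integrable (fun t => ‖F t‖) edgeMeasure :=
    ((Lp.memLp F).integrable one_le_two).norm
  have hsub : Ioc 0 x ⊆ Icc 0 Real.pi := fun t ht => ⟨ht.1.le, ht.2.trans hx.2⟩
  have hle : (volume.restrict (Ioc 0 x)) ≤ edgeMeasure := Measure.restrict_mono hsub le_rfl
  rw [intervalIntegral.integral_of_le hx.1]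
  calc ‖∫ t in Ioc 0 x, q t * φ t‖ ≤ ∫ t in Ioc 0 x, M * ‖F t‖ := by
        refine norm_integral_le_of_norm_le ((hint.mono_measure hle).const_mul M) ?_
        filter_upwards [ae_mono hle h, ae_restrict_mem measurableSet_Ioc] with t ht htm
        rw [norm_mul, ht]
        gcongr
        exact hM t (Ioc_subset_Icc_self htm)
    _ = M * ∫ t in Ioc 0 x, ‖F t‖ := integral_const_mul _ _
    _ ≤ M * ∫ t, ‖F t‖ ∂edgeMeasure := by
        refine mul_le_mul_of_nonneg_left ?_ hM0
        exact integral_mono_measure hle (Eventually.of_forall fun t => norm_nonneg _) hint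
    _ ≤ _ := by gcongr; exact integral_norm_le F

/-- Cubic functions on an edge. -/
theorem isPrim_cubic (a b c d : ℂ) :
    IsPrim (fun x : ℝ => a + b * x + c * x ^ 2 + d * x ^ 3)
      (fun x : ℝ => b + 2 * c * x + 3 * d * x ^ 2) := by
  refine isPrim_of_hasDerivAt (fun x => ?_) (by fun_prop)
  have h : HasDerivAt (fun y : ℝ => (y : ℂ)) 1 x := Complex.ofRealCLM.hasDerivAt
  have := (((h.const_mul b).const_add a).add ((h.pow 2).const_mul c)).add ((h.pow 3).const_mul d)
  refine this.congr_deriv ?_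
  simp
  ring

/-- A bound for the values of a function and its derivative at the starting point of an edge. -/
theorem exists_trace_bound : ∃ K : ℝ, 0 ≤ K ∧ ∀ (p p₁ p₂ : ℝ → ℂ) (F G : Lp ℂ 2 edgeMeasure),
    IsH2 p p₁ p₂ → (∀ᵐ x ∂edgeMeasure, ‖p x‖ = ‖F x‖) → (∀ᵐ x ∂edgeMeasure, ‖p₂ x‖ = ‖G x‖) →
    ‖p 0‖ ≤ K * (‖F‖ + ‖G‖) ∧ ‖p₁ 0‖ ≤ K * (‖F‖ + ‖G‖) := by
  -- Green's identity against a cubic with a double zero at `π`: only the boundary data at `0`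
  -- survive, and they are bounded by integrals of `p` and `p₂`.
  have main : ∀ a b c d : ℂ, ∃ K : ℝ, 0 ≤ K ∧
      ∀ (p p₁ p₂ : ℝ → ℂ) (F G : Lp ℂ 2 edgeMeasure),
      IsH2 p p₁ p₂ → (∀ᵐ x ∂edgeMeasure, ‖p x‖ = ‖F x‖) → (∀ᵐ x ∂edgeMeasure, ‖p₂ x‖ = ‖G x‖) →
      a + b * Real.pi + c * Real.pi ^ 2 + d * Real.pi ^ 3 = 0 →
      b + 2 * c * Real.pi + 3 * d * Real.pi ^ 2 = 0 →
      ‖a * p₁ 0 - b * p 0‖ ≤ K * (‖F‖ + ‖G‖) := by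
    intro a b c d
    obtain ⟨M, hM⟩ := isCompact_Icc.exists_bound_of_continuousOn (s := Icc 0 Real.pi)
      (f := fun x : ℝ => a + b * x + c * x ^ 2 + d * x ^ 3) (by fun_prop)
    obtain ⟨M', hM'⟩ := isCompact_Icc.exists_bound_of_continuousOn (s := Icc 0 Real.pi)
      (f := fun x : ℝ => 2 * c + 2 * (3 * d) * x + 3 * 0 * (x : ℂ) ^ 2) (by fun_prop)
    have h0 : (0 : ℝ) ∈ Icc 0 Real.pi := ⟨le_rfl, Real.pi_pos.le⟩
    have hpi : Real.pi ∈ Icc 0 Real.pi := ⟨Real.pi_pos.le, le_rfl⟩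
    have hM0 := (norm_nonneg _).trans (hM 0 h0)
    have hM0' := (norm_nonneg _).trans (hM' 0 h0)
    refine ⟨(M + M') * Real.sqrt Real.pi, by positivity, ?_⟩
    intro p p₁ p₂ F G hp hF hG e1 e2
    have hq := isPrim_cubic a b c d
    have hq₁ := (isPrim_cubic b (2 * c) (3 * d) 0).congr
      (v' := fun x : ℝ => b + 2 * c * x + 3 * d * x ^ 2) (fun x => by ring) fun x => rfl
    have hg := green hp.isPrim hp.isPrim₁ hq hq₁
    have hi1 := ContinuousOn.ii_mul hq.continuousOn hp.ii₂
    have hi2 : IntervalIntegrable (fun x : ℝ => (2 * c + 2 * (3 * d) * x + 3 * 0 * (x : ℂ) ^ 2)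
      * p x) volume 0 Real.pi := ContinuousOn.ii_mul (by fun_prop)
      (ContinuousOn.intervalIntegrable_of_Icc Real.pi_pos.le hp.cont)
    rw [intervalIntegral.integral_sub hi1 hi2, e1, e2] at hg
    have b1 := norm_integral_test_le hpi hM hG
    have b2 := norm_integral_test_le hpi hM' hF
    have e3 : a * p₁ 0 - b * p 0 = (∫ x in (0 : ℝ)..Real.pi, (2 * c + 2 * (3 * d) * x
        + 3 * 0 * (x : ℂ) ^ 2) * p x) - ∫ x in (0 : ℝ)..Real.pi, (a + b * x + c * x ^ 2 + d * x ^ 3)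
        * p₂ x := by
      push_cast at hg
      linear_combination hg
    rw [e3]
    refine (norm_sub_le _ _).trans ((add_le_add b2 b1).trans ?_)
    have := Real.sqrt_nonneg Real.pi
    have := norm_nonneg F
    have := norm_nonneg G
    have h3 : 0 ≤ M * (Real.sqrt Real.pi * ‖F‖) := by positivity
    have h4 : 0 ≤ M' * (Real.sqrt Real.pi * ‖G‖) := by positivity
    nlinarith
  have hpi : (Real.pi : ℂ) ≠ 0 := by exact_mod_cast Real.pi_ne_zero
  -- The Hermite cubics `x (1 - x/π)²` and `1 - 3 (x/π)² + 2 (x/π)³`: the first has value `0` and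
  -- slope `1` at `0` and isolates `p 0`, the second has value `1` and slope `0` and isolates `p₁
  -- 0`.
  obtain ⟨K, hK, h⟩ := main 0 1 (-2 / Real.pi) (1 / Real.pi ^ 2)
  obtain ⟨K', hK', h'⟩ := main 1 0 (-3 / Real.pi ^ 2) (2 / Real.pi ^ 3)
  refine ⟨max K K', le_max_of_le_left hK, fun p p₁ p₂ F G hp hF hG => ⟨?_, ?_⟩⟩
  · have h1 := h p p₁ p₂ F G hp hF hG (by field_simp; ring) (by field_simp; ring)
    rw [zero_mul, zero_sub, one_mul, norm_neg] at h1
    exact h1.trans (by gcongr; exact le_max_left _ _)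
  · have h1 := h' p p₁ p₂ F G hp hF hG (by field_simp; ring) (by field_simp; ring)
    rw [zero_mul, sub_zero, one_mul] at h1
    exact h1.trans (by gcongr; exact le_max_right _ _)

end RingChain

/-! ### Symmetry of the Hamiltonian -/

namespace RingChain

open Filter Topology ComplexConjugate UnboundedOp

theorem summable_norm_sq (f : L2Gamma) : Summable fun e => ‖f e‖ ^ 2 := by
  have := (lp.memℓp f).summable (p := 2) (by norm_num)
  simpa using this

theorem IsGauged.norm_p_ae {A α : ℝ} {f g : L2Gamma} {p p₁ p₂ : Edge → ℝ → ℂ} {v : ℤ → ℂ}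
    (h : IsGauged A α f g p p₁ p₂ v) (e : Edge) : ∀ᵐ x ∂edgeMeasure, ‖p e x‖ = ‖f e x‖ := by
  filter_upwards [h.f_eq e] with x hx
  rw [hx, norm_mul, norm_phase (by simp [coeff_im]), one_mul]

theorem IsGauged.norm_p₂_ae {A α : ℝ} {f g : L2Gamma} {p p₁ p₂ : Edge → ℝ → ℂ} {v : ℤ → ℂ}
    (h : IsGauged A α f g p p₁ p₂ v) (e : Edge) : ∀ᵐ x ∂edgeMeasure, ‖p₂ e x‖ = ‖g e x‖ := by
  filter_upwards [h.g_eq e] with x hx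
  rw [hx, norm_neg, norm_mul, norm_phase (by simp [coeff_im]), one_mul]

theorem summable_add_sq {ι : Type*} {a b : ι → ℝ} (ha : Summable fun i => a i ^ 2)
    (hb : Summable fun i => b i ^ 2) : Summable fun i => (a i + b i) ^ 2 := by
  refine Summable.of_nonneg_of_le (fun i => sq_nonneg _) (fun i => ?_)
    ((ha.mul_left 2).add (hb.mul_left 2))
  nlinarith [sq_nonneg (a i - b i)]

theorem IsGauged.exists_summable_bound {A α : ℝ} {f g : L2Gamma} {p p₁ p₂ : Edge → ℝ → ℂ}
    {v : ℤ → ℂ} (h : IsGauged A α f g p p₁ p₂ v) :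
    ∃ N : Edge → ℝ, (Summable fun e => N e ^ 2) ∧ ∀ e, ‖p e 0‖ ≤ N e ∧ ‖p₁ e 0‖ ≤ N e := by
  obtain ⟨K, -, hK⟩ := exists_trace_bound
  refine ⟨fun e => K * (‖f e‖ + ‖g e‖), ?_, fun e =>
    hK _ _ _ _ _ (h.isH2 e) (h.norm_p_ae e) (h.norm_p₂_ae e)⟩
  simp only [mul_pow]
  exact (summable_add_sq (summable_norm_sq f) (summable_norm_sq g)).mul_left _

theorem IsGauged.summable_v {A α : ℝ} {f g : L2Gamma} {p p₁ p₂ : Edge → ℝ → ℂ}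
    {v : ℤ → ℂ} (h : IsGauged A α f g p p₁ p₂ v) : Summable fun j => ‖v j‖ ^ 2 := by
  obtain ⟨N, hN, hb⟩ := h.exists_summable_bound
  have hinj : Function.Injective fun j : ℤ => ((j, true) : Edge) := fun a b hab => by
    simpa using hab
  refine Summable.of_nonneg_of_le (fun _ => by positivity) (fun j => ?_) (hN.comp_injective hinj)
  have h1 := (hb (j, true)).1
  rw [h.start] at h1
  simp only [Function.comp]
  gcongr

theorem inner_edge (F G : Lp ℂ 2 edgeMeasure) :
    ⟪F, G⟫_ℂ = ∫ x in (0 : ℝ)..Real.pi, conj (F x) * G x := by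
  rw [L2.inner_def, intervalIntegral.integral_of_le Real.pi_pos.le,
    integral_Icc_eq_integral_Ioc]
  simp [mul_comm]

theorem integral_edge_congr {φ χ : ℝ → ℂ} (h : φ =ᵐ[edgeMeasure] χ) :
    ∫ x in (0 : ℝ)..Real.pi, φ x = ∫ x in (0 : ℝ)..Real.pi, χ x := by
  rw [intervalIntegral.integral_of_le Real.pi_pos.le, intervalIntegral.integral_of_le
    Real.pi_pos.le, ← integral_Icc_eq_integral_Ioc, ← integral_Icc_eq_integral_Ioc]
  exact integral_congr_ae h

theorem conj_phase_mul_phase {a : ℂ} (ha : a.im = 0) (x : ℝ) :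
    conj (phase a x) * phase a x = 1 := by
  rw [conj_phase ha, phase_neg_mul]

theorem tsum_sub_shift {Y : ℤ → ℂ} (hY : Summable Y) : ∑' j, (Y j - Y (j + 1)) = 0 := by
  have h : Summable fun j => Y (j + 1) := (Equiv.addRight (1 : ℤ)).summable_iff.2 hY
  rw [hY.tsum_sub h, (Equiv.addRight (1 : ℤ)).tsum_eq Y |>.symm]
  simp

/-- The boundary form on an edge. -/
noncomputable def bdry (p p₁ q q₁ : ℝ → ℂ) (x : ℝ) : ℂ := conj (p x) * q₁ x - conj (p₁ x) * q x

section

variable {A α : ℝ} {f g f' g' : L2Gamma} {p p₁ p₂ q q₁ q₂ : Edge → ℝ → ℂ} {v w : ℤ → ℂ}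

/-- Green's identity on the edge; the gauge phases are unimodular because the coefficients are real,
so they cancel in the inner products. -/
theorem IsGauged.inner_sub_inner_edge (h : IsGauged A α f g p p₁ p₂ v)
    (h' : IsGauged A α f' g' q q₁ q₂ w) (e : Edge) :
    ⟪f e, g' e⟫_ℂ - ⟪g e, f' e⟫_ℂ
      = bdry (p e) (p₁ e) (q e) (q₁ e) 0 - bdry (p e) (p₁ e) (q e) (q₁ e) Real.pi := by
  have him : (-coeff A e).im = 0 := by simp [coeff_im]
  have e1 : ⟪f e, g' e⟫_ℂ = ∫ x in (0 : ℝ)..Real.pi, -(conj (p e x) * q₂ e x) := by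
    rw [inner_edge]
    refine integral_edge_congr ?_
    filter_upwards [h.f_eq e, h'.g_eq e] with x h1 h2
    rw [h1, h2, map_mul]
    linear_combination (-(conj (p e x) * q₂ e x)) * conj_phase_mul_phase him x
  have e2 : ⟪g e, f' e⟫_ℂ = ∫ x in (0 : ℝ)..Real.pi, -(conj (p₂ e x) * q e x) := by
    rw [inner_edge]
    refine integral_edge_congr ?_
    filter_upwards [h.g_eq e, h'.f_eq e] with x h1 h2
    rw [h1, h2, map_neg, map_mul]
    linear_combination (-(conj (p₂ e x) * q e x)) * conj_phase_mul_phase him x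
  have hp := (h.isH2 e).isPrim.conj
  have hp₁ := (h.isH2 e).isPrim₁.conj
  have hg := green (h'.isH2 e).isPrim (h'.isH2 e).isPrim₁ hp hp₁
  have i1 := ContinuousOn.ii_mul hp.continuousOn (h'.isH2 e).ii₂
  have i2 : IntervalIntegrable (fun x => conj (p₂ e x) * q e x) volume 0 Real.pi := by
    have := ContinuousOn.ii_mul (h'.isH2 e).cont hp₁.ii
    simpa only [mul_comm] using this
  rw [intervalIntegral.integral_sub i1 i2] at hg
  rw [e1, e2, intervalIntegral.integral_neg, intervalIntegral.integral_neg]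
  simp only [bdry]
  linear_combination -hg

theorem IsGauged.summable_bdry (h : IsGauged A α f g p p₁ p₂ v)
    (h' : IsGauged A α f' g' q q₁ q₂ w) :
    Summable fun e => bdry (p e) (p₁ e) (q e) (q₁ e) 0 := by
  obtain ⟨N, hN, hb⟩ := h.exists_summable_bound
  obtain ⟨N', hN', hb'⟩ := h'.exists_summable_bound
  refine Summable.of_norm_bounded (hN.add hN') fun e => ?_
  simp only [bdry]
  refine (norm_sub_le _ _).trans ?_
  rw [norm_mul, norm_mul, RCLike.norm_conj, RCLike.norm_conj]
  have a1 := mul_le_mul (hb e).1 (hb' e).2 (norm_nonneg _) ((norm_nonneg _).trans (hb e).1)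
  have a2 := mul_le_mul (hb e).2 (hb' e).1 (norm_nonneg _) ((norm_nonneg _).trans (hb e).1)
  nlinarith [sq_nonneg (N e - N' e)]

/-- The vertex conditions transport the boundary form across a vertex: continuity factors out the
vertex values, and the terms with the real `α` cancel between the flux condition and its conjugate.
-/
theorem IsGauged.bdry_finish (h : IsGauged A α f g p p₁ p₂ v)
    (h' : IsGauged A α f' g' q q₁ q₂ w) (j : ℤ) :
    bdry (p (j, true)) (p₁ (j, true)) (q (j, true)) (q₁ (j, true)) Real.pi
      + bdry (p (j, false)) (p₁ (j, false)) (q (j, false)) (q₁ (j, false)) Real.pi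
    = bdry (p (j + 1, true)) (p₁ (j + 1, true)) (q (j + 1, true)) (q₁ (j + 1, true)) 0
      + bdry (p (j + 1, false)) (p₁ (j + 1, false)) (q (j + 1, false)) (q₁ (j + 1, false)) 0 := by
  have f2 := h'.flux j
  have f1 := congrArg conj (h.flux j)
  simp only [map_add, map_sub, map_mul, Complex.conj_ofReal] at f1
  rw [conj_phase (by simp), conj_phase (by simp), neg_neg] at f1
  simp only [bdry, h.finish, h'.finish, h.start, h'.start, coeff_true, coeff_false, map_mul]
  rw [conj_phase (by simp), conj_phase (by simp), neg_neg]
  linear_combination (-conj (v (j + 1))) * f2 + w (j + 1) * f1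

/-- The boundary terms of a ring are `Y j - Y (j + 1)`, with `Y` summable by the trace bounds; the
sum over the chain telescopes to zero. -/
theorem IsGauged.symm (h : IsGauged A α f g p p₁ p₂ v) (h' : IsGauged A α f' g' q q₁ q₂ w) :
    ⟪g, f'⟫_ℂ = ⟪f, g'⟫_ℂ := by
  have hinj : ∀ b, Function.Injective fun j : ℤ => ((j, b) : Edge) := fun b x y hxy => by
    simpa using hxy
  have hB := h.summable_bdry h'
  have hY := (hB.comp_injective (hinj true)).add (hB.comp_injective (hinj false))
  have hs1 := lp.summable_inner (𝕜 := ℂ) f g'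
  have hs2 := lp.summable_inner (𝕜 := ℂ) g f'
  have h0 : ∑' e, (⟪f e, g' e⟫_ℂ - ⟪g e, f' e⟫_ℂ) = 0 := by
    rw [(hs1.sub hs2).tsum_prod, ← tsum_sub_shift hY]
    refine tsum_congr fun j => ?_
    rw [tsum_bool, h.inner_sub_inner_edge h', h.inner_sub_inner_edge h']
    simp only [Function.comp]
    linear_combination -(h.bdry_finish h' j)
  rw [lp.inner_eq_tsum, lp.inner_eq_tsum]
  rw [hs1.tsum_sub hs2] at h0
  exact (sub_eq_zero.1 h0).symm

end

theorem mem_graph_iff {A α : ℝ} {f g : L2Gamma} : (f, g) ∈ graph A α ↔ IsInGraph A α f g := Iff.rfl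

theorem exists_domain_iff {A α : ℝ} {f g : L2Gamma} :
    (∃ k : (hamiltonian A α).domain, (k : L2Gamma) = f ∧ hamiltonian A α k = g)
      ↔ IsInGraph A α f g := by
  rw [← mem_graph_iff, ← hamiltonian_graph, LinearPMap.mem_graph_iff]

theorem isInGraph_apply {A α : ℝ} (k : (hamiltonian A α).domain) :
    IsInGraph A α (k : L2Gamma) (hamiltonian A α k) := exists_domain_iff.1 ⟨k, rfl, rfl⟩

theorem isSymm_hamiltonian (A α : ℝ) : IsSymm (hamiltonian A α) := by
  intro f g
  obtain ⟨p, p₁, p₂, v, h⟩ := (isInGraph_apply f).exists_isGauged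
  obtain ⟨q, q₁, q₂, w, h'⟩ := (isInGraph_apply g).exists_isGauged
  exact h.symm h'

end RingChain

/-! ### Fundamental solutions -/

namespace RingChain

open Filter Topology ComplexConjugate UnboundedOp

/-- A square root. -/
noncomputable def root (z : ℂ) : ℂ := z ^ ((2 : ℕ) : ℂ)⁻¹

theorem root_sq (z : ℂ) : root z ^ 2 = z := Complex.cpow_nat_inv_pow z two_ne_zero

/-- The solution of `-u'' = z u` with `u(0) = 1`, `u'(0) = 0`. -/
noncomputable def csol (z : ℂ) (x : ℝ) : ℂ := Complex.cos (root z * x)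

/-- The solution of `-u'' = z u` with `u(0) = 0`, `u'(0) = 1`. -/
noncomputable def ssol (z : ℂ) (x : ℝ) : ℂ := if z = 0 then x else Complex.sin (root z * x) / root z

theorem csol_sq (k : ℂ) (x : ℝ) : csol (k ^ 2) x = Complex.cos (k * x) := by
  rw [csol]
  rcases sq_eq_sq_iff_eq_or_eq_neg.1 (root_sq (k ^ 2)) with h | h
  · rw [h]
  · rw [h, neg_mul, Complex.cos_neg]

theorem ssol_zero_left (x : ℝ) : ssol 0 x = x := by simp [ssol]

theorem ssol_sq {k : ℂ} (hk : k ≠ 0) (x : ℝ) : ssol (k ^ 2) x = Complex.sin (k * x) / k := by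
  rw [ssol, if_neg (pow_ne_zero 2 hk)]
  rcases sq_eq_sq_iff_eq_or_eq_neg.1 (root_sq (k ^ 2)) with h | h
  · rw [h]
  · rw [h, neg_mul, Complex.sin_neg, neg_div_neg_eq]

theorem csol_zero (z : ℂ) : csol z 0 = 1 := by simp [csol]

theorem ssol_zero (z : ℂ) : ssol z 0 = 0 := by simp [ssol]

/-- This is the constant Wronskian of the two fundamental solutions. -/
theorem csol_sq_add (z : ℂ) (x : ℝ) : csol z x ^ 2 + z * ssol z x ^ 2 = 1 := by
  obtain ⟨k, rfl⟩ : ∃ k, z = k ^ 2 := ⟨root z, (root_sq z).symm⟩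
  rcases eq_or_ne k 0 with rfl | hk
  · rw [csol_sq]; simp
  · rw [csol_sq, ssol_sq hk, div_pow, mul_div_cancel₀ _ (pow_ne_zero 2 hk), add_comm,
      Complex.sin_sq_add_cos_sq]

theorem hasDerivAt_csol (z : ℂ) (x : ℝ) : HasDerivAt (csol z) (-z * ssol z x) x := by
  obtain ⟨k, rfl⟩ : ∃ k, z = k ^ 2 := ⟨root z, (root_sq z).symm⟩
  have h : HasDerivAt (fun y : ℝ => k * (y : ℂ)) k x := by
    simpa using (Complex.ofRealCLM.hasDerivAt (x := x)).const_mul k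
  have h2 : HasDerivAt (fun y : ℝ => Complex.cos (k * y)) (-Complex.sin (k * x) * k) x :=
    (Complex.hasDerivAt_cos _).comp x h
  rw [show csol (k ^ 2) = fun y : ℝ => Complex.cos (k * y) from funext (csol_sq k)]
  refine h2.congr_deriv ?_
  rcases eq_or_ne k 0 with rfl | hk
  · simp
  · rw [ssol_sq hk]; field_simp

theorem hasDerivAt_ssol (z : ℂ) (x : ℝ) : HasDerivAt (ssol z) (csol z x) x := by
  obtain ⟨k, rfl⟩ : ∃ k, z = k ^ 2 := ⟨root z, (root_sq z).symm⟩
  rcases eq_or_ne k 0 with rfl | hk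
  · rw [csol_sq, zero_pow two_ne_zero,
      show ssol 0 = fun y : ℝ => (y : ℂ) from funext ssol_zero_left]
    have h : HasDerivAt (fun y : ℝ => (y : ℂ)) 1 x := Complex.ofRealCLM.hasDerivAt
    exact h.congr_deriv (by simp)
  · have h : HasDerivAt (fun y : ℝ => k * (y : ℂ)) k x := by
      simpa using (Complex.ofRealCLM.hasDerivAt (x := x)).const_mul k
    have h2 : HasDerivAt (fun y : ℝ => Complex.sin (k * y) / k) (Complex.cos (k * x) * k / k) x :=
      ((Complex.hasDerivAt_sin _).comp x h).div_const k
    rw [show ssol (k ^ 2) = fun y : ℝ => Complex.sin (k * y) / k from funext (ssol_sq hk), csol_sq]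
    exact h2.congr_deriv (by field_simp)

theorem continuous_csol (z : ℂ) : Continuous (csol z) :=
  continuous_iff_continuousAt.2 fun x => (hasDerivAt_csol z x).continuousAt

theorem continuous_ssol (z : ℂ) : Continuous (ssol z) :=
  continuous_iff_continuousAt.2 fun x => (hasDerivAt_ssol z x).continuousAt

theorem isPrim_csol (z : ℂ) : IsPrim (csol z) (fun x => -z * ssol z x) :=
  isPrim_of_hasDerivAt (hasDerivAt_csol z) (continuous_const.mul (continuous_ssol z))

theorem isPrim_ssol (z : ℂ) : IsPrim (ssol z) (csol z) :=
  isPrim_of_hasDerivAt (hasDerivAt_ssol z) (continuous_csol z)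

/-- The numerator of `ξ` as a function of the energy. -/
noncomputable def eta (α : ℝ) (z : ℂ) : ℂ := csol z Real.pi + α / 4 * ssol z Real.pi

theorem xiNum_eq_eta (α : ℝ) (k : ℂ) : xiNum α k = eta α (k ^ 2) := by
  unfold xiNum eta
  split_ifs with h
  · rw [h, csol_sq, zero_pow two_ne_zero, ssol_zero_left]; simp; ring
  · rw [csol_sq, ssol_sq h]; field_simp

/-- The Dirichlet condition `sin kπ = 0` for `k ≠ 0`; energy `0` drops out because the solution
there is `x`, with value `π` at the end. -/
theorem ssol_pi_eq_zero_iff (z : ℂ) : ssol z Real.pi = 0 ↔ ∃ E ∈ squares, z = (E : ℂ) := by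
  obtain ⟨k, rfl⟩ : ∃ k, z = k ^ 2 := ⟨root z, (root_sq z).symm⟩
  have hpi : (Real.pi : ℂ) ≠ 0 := by exact_mod_cast Real.pi_ne_zero
  rcases eq_or_ne k 0 with rfl | hk
  · rw [zero_pow two_ne_zero, ssol_zero_left]
    refine ⟨fun h => absurd h hpi, ?_⟩
    rintro ⟨E, ⟨n, hn, rfl⟩, h⟩
    exfalso
    have : (n : ℂ) ^ 2 = 0 := by rw [h]; push_cast; rfl
    have : n = 0 := by exact_mod_cast pow_eq_zero_iff two_ne_zero |>.1 this
    omega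
  · rw [ssol_sq hk, div_eq_zero_iff, or_iff_left hk, Complex.sin_eq_zero_iff]
    constructor
    · rintro ⟨m, hm⟩
      have hkm : k = m := mul_right_cancel₀ hpi hm
      refine ⟨(m.natAbs : ℝ) ^ 2, ⟨m.natAbs, ?_, rfl⟩, ?_⟩
      · have : m ≠ 0 := by rintro rfl; exact hk (by simpa using hkm)
        omega
      · rw [hkm]
        have h1 : ((m.natAbs : ℝ)) ^ 2 = (m : ℝ) ^ 2 := by
          rw [Nat.cast_natAbs, Int.cast_abs, sq_abs]
        rw [h1]; push_cast; rfl
    · rintro ⟨E, ⟨n, hn, rfl⟩, h⟩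
      push_cast at h
      rcases sq_eq_sq_iff_eq_or_eq_neg.1 h with h | h
      · exact ⟨n, by rw [h]; simp⟩
      · exact ⟨-n, by rw [h]; simp⟩

/-- Two solutions of the inhomogeneous equation on an edge in terms of its boundary data. -/
theorem boundary_relations {p p₁ p₂ s : ℝ → ℂ} {z : ℂ} (hp : IsPrim p p₁) (hp₁ : IsPrim p₁ p₂)
    (h : ∀ᵐ x ∂edgeMeasure, p₂ x = -z * p x - s x) :
    csol z Real.pi * p₁ Real.pi + z * ssol z Real.pi * p Real.pi
        = p₁ 0 - ∫ x in (0 : ℝ)..Real.pi, csol z x * s x ∧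
      ssol z Real.pi * p₁ Real.pi - csol z Real.pi * p Real.pi
        = -p 0 - ∫ x in (0 : ℝ)..Real.pi, ssol z x * s x := by
  have e1 := green hp hp₁ (isPrim_csol z) ((isPrim_ssol z).const_mul (-z))
  have e2 := green hp hp₁ (isPrim_ssol z) (isPrim_csol z)
  have i1 : ∫ x in (0 : ℝ)..Real.pi, (csol z x * p₂ x - -z * csol z x * p x)
      = -∫ x in (0 : ℝ)..Real.pi, csol z x * s x := by
    rw [← intervalIntegral.integral_neg]
    refine integral_edge_congr ?_
    filter_upwards [h] with x hx
    rw [hx]; ring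
  have i2 : ∫ x in (0 : ℝ)..Real.pi, (ssol z x * p₂ x - -z * ssol z x * p x)
      = -∫ x in (0 : ℝ)..Real.pi, ssol z x * s x := by
    rw [← intervalIntegral.integral_neg]
    refine integral_edge_congr ?_
    filter_upwards [h] with x hx
    rw [hx]; ring
  rw [i1] at e1
  rw [i2] at e2
  simp only [csol_zero, ssol_zero] at e1 e2
  constructor
  · linear_combination -e1
  · linear_combination -e2

/-! ### The vertex equation -/

/-- The gauged source on an edge. -/
noncomputable def gsrc (A : ℝ) (h : L2Gamma) (e : Edge) (x : ℝ) : ℂ := phase (coeff A e) x * h e x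

/-- The moments of the source against the fundamental solutions. -/
noncomputable def cmom (A : ℝ) (z : ℂ) (h : L2Gamma) (e : Edge) : ℂ :=
  ∫ x in (0 : ℝ)..Real.pi, csol z x * gsrc A h e x

/-- The moments of the source against the fundamental solutions. -/
noncomputable def smom (A : ℝ) (z : ℂ) (h : L2Gamma) (e : Edge) : ℂ :=
  ∫ x in (0 : ℝ)..Real.pi, ssol z x * gsrc A h e x

/-- The moment of the source against the solution that vanishes at the end of the edge. -/
noncomputable def rmom (A : ℝ) (z : ℂ) (h : L2Gamma) (e : Edge) : ℂ :=
  ssol z Real.pi * cmom A z h e - csol z Real.pi * smom A z h e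

/-- The source term of the vertex equation. -/
noncomputable def source (A : ℝ) (z : ℂ) (h : L2Gamma) (j : ℤ) : ℂ :=
  rmom A z h (j, true) + rmom A z h (j, false)
    + phase (-A) Real.pi * smom A z h (j - 1, true) + phase A Real.pi * smom A z h (j - 1, false)

theorem phase_add_phase_neg (A : ℝ) :
    phase A Real.pi + phase (-A) Real.pi = 2 * (Real.cos (A * Real.pi) : ℂ) := by
  rw [phase, phase, Complex.ofReal_cos, Complex.two_cos]
  push_cast
  congr 2 <;> ring

/-- The flux condition is the vertex equation. -/
theorem flux_iff {A α : ℝ} {z : ℂ} (hS : ssol z Real.pi ≠ 0) {h : L2Gamma}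
    {p p₁ p₂ : Edge → ℝ → ℂ} {v : ℤ → ℂ} (hp : ∀ e, IsPrim (p e) (p₁ e))
    (hp₁ : ∀ e, IsPrim (p₁ e) (p₂ e))
    (hs : ∀ e, ∀ᵐ x ∂edgeMeasure, p₂ e x = -z * p e x - gsrc A h e x)
    (start : ∀ e, p e 0 = v e.1)
    (finish : ∀ e, p e Real.pi = phase (coeff A e) Real.pi * v (e.1 + 1)) (j : ℤ) :
    p₁ (j + 1, true) 0 + p₁ (j + 1, false) 0
      - phase (-A) Real.pi * p₁ (j, true) Real.pi - phase A Real.pi * p₁ (j, false) Real.pi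
      = α * v (j + 1) ↔
    4 * eta α z * v (j + 1) - 2 * (Real.cos (A * Real.pi) : ℂ) * (v (j + 2) + v j)
      = source A z h (j + 1) := by
  have hcs := csol_sq_add z Real.pi
  -- The slopes at both ends of an edge in terms of its vertex values, obtained by solving the two
  -- boundary relations with the help of the Wronskian.
  have r : ∀ e, ssol z Real.pi * p₁ e 0
      = phase (coeff A e) Real.pi * v (e.1 + 1) - csol z Real.pi * v e.1 + rmom A z h e := by
    intro e
    obtain ⟨e1, e2⟩ := boundary_relations (hp e) (hp₁ e) (hs e)
    rw [start, finish] at *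
    simp only [rmom, cmom, smom]
    linear_combination (-ssol z Real.pi) * e1 + csol z Real.pi * e2
      + (phase (coeff A e) Real.pi * v (e.1 + 1)) * hcs
  have r' : ∀ e, ssol z Real.pi * p₁ e Real.pi
      = csol z Real.pi * (phase (coeff A e) Real.pi * v (e.1 + 1)) - v e.1 - smom A z h e := by
    intro e
    obtain ⟨-, e2⟩ := boundary_relations (hp e) (hp₁ e) (hs e)
    rw [start, finish] at *
    simp only [smom]
    linear_combination e2
  have r1 := r (j + 1, true)
  have r2 := r (j + 1, false)
  have r3 := r' (j, true)
  have r4 := r' (j, false)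
  simp only [coeff_true, coeff_false, add_assoc, one_add_one_eq_two] at r1 r2 r3 r4
  have hc := phase_add_phase_neg A
  have hpm := phase_neg_mul (A : ℂ) Real.pi
  -- After multiplication by `ssol z π` the slopes at the vertex `j + 1` are replaced by vertex
  -- values: outgoing edges bring in `v (j + 2)`, incoming ones `v j`. The two phases add up to `2
  -- cos Aπ`.
  rw [← mul_right_inj' hS]
  simp only [source, eta, add_sub_cancel_right]
  constructor
  · intro H
    linear_combination -H + r1 + r2 - phase (-A) Real.pi * r3 - phase A Real.pi * r4
      + (v (j + 2) + v j) * hc - 2 * csol z Real.pi * v (j + 1) * hpm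
  · intro H
    linear_combination -H + r1 + r2 - phase (-A) Real.pi * r3 - phase A Real.pi * r4
      + (v (j + 2) + v j) * hc - 2 * csol z Real.pi * v (j + 1) * hpm

theorem IsGauged.p₂_eq {A α : ℝ} {f g h : L2Gamma} {p p₁ p₂ : Edge → ℝ → ℂ} {v : ℤ → ℂ}
    (H : IsGauged A α f g p p₁ p₂ v) {z : ℂ} (hz : g - z • f = h) (e : Edge) :
    ∀ᵐ x ∂edgeMeasure, p₂ e x = -z * p e x - gsrc A h e x := by
  have he : h e = g e - z • f e := by rw [← hz]; rfl
  filter_upwards [H.f_eq e, H.g_eq e, Lp.coeFn_sub (g e) (z • f e), Lp.coeFn_smul z (f e)]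
    with x h1 h2 h3 h4
  rw [gsrc, he, h3, Pi.sub_apply, h4, Pi.smul_apply, h1, h2, smul_eq_mul]
  linear_combination (-p₂ e x - z * p e x) * phase_mul_neg (coeff A e) x

/-- The vertex values of a solution of `(-Δ_α - z) f = h` satisfy the vertex equation. -/
theorem IsGauged.vertex_eq {A α : ℝ} {f g h : L2Gamma} {p p₁ p₂ : Edge → ℝ → ℂ} {v : ℤ → ℂ}
    (H : IsGauged A α f g p p₁ p₂ v) {z : ℂ} (hS : ssol z Real.pi ≠ 0) (hz : g - z • f = h)
    (j : ℤ) :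
    4 * eta α z * v j - 2 * (Real.cos (A * Real.pi) : ℂ) * (v (j + 1) + v (j - 1))
      = source A z h j := by
  have := (flux_iff hS (fun e => (H.isH2 e).isPrim) (fun e => (H.isH2 e).isPrim₁)
    (H.p₂_eq hz) H.start H.finish (j - 1)).1 (H.flux (j - 1))
  rwa [sub_add_cancel, show j - 1 + 2 = j + 1 by ring] at this

end RingChain

/-! ### Solving the resolvent equation -/

namespace RingChain

open Filter Topology ComplexConjugate UnboundedOp

/-- `M` bounds the fundamental solutions on the edge and the inverse of `ssol z π`. -/
structure IsBound (z : ℂ) (M : ℝ) : Prop where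
  one_le : 1 ≤ M
  csol_le : ∀ x ∈ Icc 0 Real.pi, ‖csol z x‖ ≤ M
  ssol_le : ∀ x ∈ Icc 0 Real.pi, ‖ssol z x‖ ≤ M
  inv_le : ‖(ssol z Real.pi)⁻¹‖ ≤ M

theorem exists_isBound (z : ℂ) : ∃ M, IsBound z M := by
  obtain ⟨M₁, h1⟩ := isCompact_Icc.exists_bound_of_continuousOn (s := Icc 0 Real.pi)
    (continuous_csol z).continuousOn
  obtain ⟨M₂, h2⟩ := isCompact_Icc.exists_bound_of_continuousOn (s := Icc 0 Real.pi)
    (continuous_ssol z).continuousOn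
  refine ⟨max (max M₁ M₂) (max 1 ‖(ssol z Real.pi)⁻¹‖), ?_, fun x hx => ?_, fun x hx => ?_, ?_⟩
  · exact (le_max_left _ _).trans (le_max_right _ _)
  · exact (h1 x hx).trans ((le_max_left _ _).trans (le_max_left _ _))
  · exact (h2 x hx).trans ((le_max_right _ _).trans (le_max_left _ _))
  · exact (le_max_right _ _).trans (le_max_right _ _)

theorem norm_gsrc_ae (A : ℝ) (h : L2Gamma) (e : Edge) :
    ∀ x, ‖gsrc A h e x‖ = ‖h e x‖ := fun x => by
  rw [gsrc, norm_mul, norm_phase (coeff_im A e), one_mul]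

theorem memLp_gsrc (A : ℝ) (h : L2Gamma) (e : Edge) : MemLp (gsrc A h e) 2 edgeMeasure :=
  MemLp.phase_mul _ (Lp.memLp (h e))

theorem ii_gsrc (A : ℝ) (h : L2Gamma) (e : Edge) :
    IntervalIntegrable (gsrc A h e) volume 0 Real.pi :=
  (intervalIntegrable_iff_integrableOn_Icc_of_le Real.pi_pos.le).2
    ((memLp_gsrc A h e).integrable one_le_two)

theorem zero_mem_edge : (0 : ℝ) ∈ Icc 0 Real.pi := ⟨le_rfl, Real.pi_pos.le⟩

theorem pi_mem_edge : Real.pi ∈ Icc 0 Real.pi := ⟨Real.pi_pos.le, le_rfl⟩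

theorem IsBound.norm_cmom_le {z : ℂ} {M : ℝ} (hM : IsBound z M) (A : ℝ) (h : L2Gamma) (e : Edge) :
    ‖cmom A z h e‖ ≤ M * (Real.sqrt Real.pi * ‖h e‖) :=
  norm_integral_test_le pi_mem_edge hM.csol_le (Eventually.of_forall (norm_gsrc_ae A h e))

theorem IsBound.norm_smom_le {z : ℂ} {M : ℝ} (hM : IsBound z M) (A : ℝ) (h : L2Gamma) (e : Edge) :
    ‖smom A z h e‖ ≤ M * (Real.sqrt Real.pi * ‖h e‖) :=
  norm_integral_test_le pi_mem_edge hM.ssol_le (Eventually.of_forall (norm_gsrc_ae A h e))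

theorem IsBound.norm_rmom_le {z : ℂ} {M : ℝ} (hM : IsBound z M) (A : ℝ) (h : L2Gamma) (e : Edge) :
    ‖rmom A z h e‖ ≤ 2 * M ^ 2 * (Real.sqrt Real.pi * ‖h e‖) := by
  have hM0 : 0 ≤ M := zero_le_one.trans hM.one_le
  rw [rmom]
  refine (norm_sub_le _ _).trans ?_
  rw [norm_mul, norm_mul]
  have h1 := mul_le_mul (hM.ssol_le _ pi_mem_edge) (hM.norm_cmom_le A h e) (norm_nonneg _) hM0
  have h2 := mul_le_mul (hM.csol_le _ pi_mem_edge) (hM.norm_smom_le A h e) (norm_nonneg _) hM0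
  linarith

/-- The initial slope of the solution with given vertex values. -/
noncomputable def slope (A : ℝ) (z : ℂ) (h : L2Gamma) (v : ℤ → ℂ) (e : Edge) : ℂ :=
  (ssol z Real.pi)⁻¹ *
    (phase (coeff A e) Real.pi * v (e.1 + 1) - csol z Real.pi * v e.1 + rmom A z h e)

/-- Variation of constants. -/
noncomputable def vcC (A : ℝ) (z : ℂ) (h : L2Gamma) (e : Edge) (x : ℝ) : ℂ :=
  ∫ t in (0 : ℝ)..x, csol z t * gsrc A h e t

/-- Variation of constants. -/
noncomputable def vcS (A : ℝ) (z : ℂ) (h : L2Gamma) (e : Edge) (x : ℝ) : ℂ :=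
  ∫ t in (0 : ℝ)..x, ssol z t * gsrc A h e t

/-- The gauged solution on an edge. -/
noncomputable def sol (A : ℝ) (z : ℂ) (h : L2Gamma) (v : ℤ → ℂ) (e : Edge) (x : ℝ) : ℂ :=
  ssol z x * (slope A z h v e - vcC A z h e x) + csol z x * (v e.1 + vcS A z h e x)

/-- The derivative of the gauged solution on an edge. -/
noncomputable def sol₁ (A : ℝ) (z : ℂ) (h : L2Gamma) (v : ℤ → ℂ) (e : Edge) (x : ℝ) : ℂ :=
  csol z x * (slope A z h v e - vcC A z h e x) + -z * ssol z x * (v e.1 + vcS A z h e x)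

/-- The second derivative of the gauged solution on an edge. -/
noncomputable def sol₂ (A : ℝ) (z : ℂ) (h : L2Gamma) (v : ℤ → ℂ) (e : Edge) (x : ℝ) : ℂ :=
  -z * sol A z h v e x - gsrc A h e x

section

variable (A : ℝ) (z : ℂ) (h : L2Gamma) (v : ℤ → ℂ) (e : Edge)

theorem isPrim_vcC : IsPrim (fun x => slope A z h v e - vcC A z h e x)
    (fun x => -(csol z x * gsrc A h e x)) := by
  refine ⟨(ContinuousOn.ii_mul (continuous_csol z).continuousOn (ii_gsrc A h e)).neg, fun x _ => ?_⟩
  rw [intervalIntegral.integral_neg, vcC, vcC, intervalIntegral.integral_same]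
  ring

theorem isPrim_vcS : IsPrim (fun x => v e.1 + vcS A z h e x)
    (fun x => ssol z x * gsrc A h e x) := by
  refine ⟨ContinuousOn.ii_mul (continuous_ssol z).continuousOn (ii_gsrc A h e), fun x _ => ?_⟩
  rw [vcS, vcS, intervalIntegral.integral_same]
  ring

theorem isPrim_sol : IsPrim (sol A z h v e) (sol₁ A z h v e) :=
  (((isPrim_ssol z).mul (isPrim_vcC A z h v e)).add
    ((isPrim_csol z).mul (isPrim_vcS A z h v e))).congr (fun _ => rfl) fun x => by
      simp only [sol₁]; ring

theorem isPrim_sol₁ : IsPrim (sol₁ A z h v e) (sol₂ A z h v e) :=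
  (((isPrim_csol z).mul (isPrim_vcC A z h v e)).add
    (((isPrim_ssol z).const_mul (-z)).mul (isPrim_vcS A z h v e))).congr (fun _ => rfl) fun x => by
      simp only [sol₂, sol]
      -- Differentiating the coefficients in the variation of constants produces the source times
      -- the Wronskian.
      linear_combination (-gsrc A h e x) * csol_sq_add z x

theorem isH2_sol : IsH2 (sol A z h v e) (sol₁ A z h v e) (sol₂ A z h v e) := by
  refine isH2_of_isPrim (isPrim_sol A z h v e) (isPrim_sol₁ A z h v e) ?_
  exact ((memLp_of_continuousOn (isPrim_sol A z h v e).continuousOn).const_mul (-z)).sub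
    (memLp_gsrc A h e)

theorem sol_start : sol A z h v e 0 = v e.1 := by
  simp [sol, ssol_zero, csol_zero, vcS]

/-- `slope` is the initial slope that shoots at the prescribed value at the far end; this needs
division by `ssol z π`. -/
theorem sol_finish (hS : ssol z Real.pi ≠ 0) :
    sol A z h v e Real.pi = phase (coeff A e) Real.pi * v (e.1 + 1) := by
  have h1 : vcC A z h e Real.pi = cmom A z h e := rfl
  have h2 : vcS A z h e Real.pi = smom A z h e := rfl
  rw [sol, slope, h1, h2, rmom]
  field_simp
  ring

end

/-- The constant in the bound for the solution of the resolvent equation. -/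
noncomputable def solConst (M : ℝ) : ℝ := 5 * M ^ 4 * (1 + Real.sqrt Real.pi)

theorem IsBound.norm_sol_le {z : ℂ} {M : ℝ} (hM : IsBound z M) (A : ℝ) (h : L2Gamma) (v : ℤ → ℂ)
    (e : Edge) {x : ℝ} (hx : x ∈ Icc 0 Real.pi) :
    ‖sol A z h v e x‖ ≤ solConst M * (‖v e.1‖ + ‖v (e.1 + 1)‖ + ‖h e‖) := by
  have hM1 := hM.one_le
  have hM0 : 0 ≤ M := zero_le_one.trans hM1
  have hsub : ∀ t ∈ Icc 0 x, t ∈ Icc 0 Real.pi := fun t ht => ⟨ht.1, ht.2.trans hx.2⟩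
  have b1 : ‖vcC A z h e x‖ ≤ M * (Real.sqrt Real.pi * ‖h e‖) :=
    norm_integral_test_le hx (fun t ht => hM.csol_le t (hsub t ht))
      (Eventually.of_forall (norm_gsrc_ae A h e))
  have b2 : ‖vcS A z h e x‖ ≤ M * (Real.sqrt Real.pi * ‖h e‖) :=
    norm_integral_test_le hx (fun t ht => hM.ssol_le t (hsub t ht))
      (Eventually.of_forall (norm_gsrc_ae A h e))
  set r := Real.sqrt Real.pi with hr
  have hr0 : 0 ≤ r := Real.sqrt_nonneg _
  set a := ‖v e.1‖
  set b := ‖v (e.1 + 1)‖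
  set c := ‖h e‖
  have ha : 0 ≤ a := norm_nonneg _
  have hb : 0 ≤ b := norm_nonneg _
  have hc : 0 ≤ c := norm_nonneg _
  have b3 : ‖slope A z h v e‖ ≤ M * (b + M * a + 2 * M ^ 2 * (r * c)) := by
    rw [slope, norm_mul]
    refine mul_le_mul hM.inv_le ?_ (norm_nonneg _) hM0
    refine (norm_add_le _ _).trans (add_le_add ((norm_sub_le _ _).trans (add_le_add ?_ ?_))
      (hM.norm_rmom_le A h e))
    · rw [norm_mul, norm_phase (coeff_im A e), one_mul]
    · rw [norm_mul]
      exact mul_le_mul_of_nonneg_right (hM.csol_le _ pi_mem_edge) ha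
  have b4 : ‖sol A z h v e x‖ ≤ M * (M * (b + M * a + 2 * M ^ 2 * (r * c)) + M * (r * c))
      + M * (a + M * (r * c)) := by
    rw [sol]
    refine (norm_add_le _ _).trans (add_le_add ?_ ?_)
    · rw [norm_mul]
      exact mul_le_mul (hM.ssol_le x hx) ((norm_sub_le _ _).trans (add_le_add b3 b1))
        (norm_nonneg _) hM0
    · rw [norm_mul]
      exact mul_le_mul (hM.csol_le x hx) ((norm_add_le _ _).trans (add_le_add le_rfl b2))
        (norm_nonneg _) hM0
  refine b4.trans ?_
  have m2 : M ^ 2 ≤ M ^ 4 := pow_le_pow_right₀ hM1 (by norm_num)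
  have m3 : M ^ 3 ≤ M ^ 4 := pow_le_pow_right₀ hM1 (by norm_num)
  have m1 : M ≤ M ^ 4 := by simpa using pow_le_pow_right₀ hM1 (show 1 ≤ 4 by norm_num)
  have hrc : 0 ≤ r * c := mul_nonneg hr0 hc
  have e1 : M * (M * (b + M * a + 2 * M ^ 2 * (r * c)) + M * (r * c)) + M * (a + M * (r * c))
      = M ^ 2 * b + M ^ 3 * a + M * a + 2 * M ^ 4 * (r * c) + 2 * M ^ 2 * (r * c) := by ring
  have e2 : solConst M * (a + b + c) = 5 * M ^ 4 * a + 5 * M ^ 4 * b + 5 * M ^ 4 * (r * c)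
      + (5 * M ^ 4 * (c + r * a + r * b)) := by rw [solConst]; ring
  rw [e1, e2]
  have f1 := mul_le_mul_of_nonneg_right m2 hb
  have f2 := mul_le_mul_of_nonneg_right m3 ha
  have f3 := mul_le_mul_of_nonneg_right m1 ha
  have f4 := mul_le_mul_of_nonneg_right m2 hrc
  have g1 : 0 ≤ M ^ 4 * a := by positivity
  have g2 : 0 ≤ M ^ 4 * b := by positivity
  have g3 : 0 ≤ M ^ 4 * (r * c) := by positivity
  have g4 : 0 ≤ 5 * M ^ 4 * (c + r * a + r * b) := by positivity
  linarith

theorem norm_lp_edge_le {F : Lp ℂ 2 edgeMeasure} {K : ℝ} (hK : 0 ≤ K)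
    (h : ∀ᵐ x ∂edgeMeasure, ‖F x‖ ≤ K) : ‖F‖ ≤ Real.sqrt Real.pi * K := by
  have h1 := Lp.norm_le_of_ae_bound hK h
  refine h1.trans_eq ?_
  congr 1
  simp [measureUnivNNReal, Real.sqrt_eq_rpow, edgeMeasure, ENNReal.coe_toNNReal_eq_toReal,
    ENNReal.toReal_ofReal Real.pi_pos.le]

/-- Any square summable solution of the vertex equation gives a solution of the resolvent
equation. -/
theorem exists_solution {A α : ℝ} {z : ℂ} (hS : ssol z Real.pi ≠ 0) {M : ℝ} (hM : IsBound z M)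
    (h : L2Gamma) {v : ℤ → ℂ} (hv : Summable fun j => ‖v j‖ ^ 2)
    (heq : ∀ j, 4 * eta α z * v j
      - 2 * (Real.cos (A * Real.pi) : ℂ) * (v (j + 1) + v (j - 1)) = source A z h j) :
    ∃ f g : L2Gamma, IsInGraph A α f g ∧ g - z • f = h ∧
      ∀ e, ‖f e‖ ≤ Real.sqrt Real.pi * (solConst M * (‖v e.1‖ + ‖v (e.1 + 1)‖ + ‖h e‖)) := by
  have hK : 0 ≤ solConst M := by
    have := zero_le_one.trans hM.one_le
    unfold solConst; positivity
  have hmem : ∀ e, MemLp (fun x => phase (-coeff A e) x * sol A z h v e x) 2 edgeMeasure :=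
    fun e => MemLp.phase_mul _ (memLp_of_continuousOn (isPrim_sol A z h v e).continuousOn)
  let F : ∀ _ : Edge, Lp ℂ 2 edgeMeasure := fun e => (hmem e).toLp _
  have hF : ∀ e, F e =ᵐ[edgeMeasure] fun x => phase (-coeff A e) x * sol A z h v e x :=
    fun e => (hmem e).coeFn_toLp
  have hFn : ∀ e, ‖F e‖ ≤ Real.sqrt Real.pi * (solConst M * (‖v e.1‖ + ‖v (e.1 + 1)‖ + ‖h e‖)) := by
    intro e
    refine norm_lp_edge_le (by positivity) ?_
    filter_upwards [hF e, ae_restrict_mem measurableSet_Icc] with x hx hxm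
    rw [hx, norm_mul, norm_phase (by simp [coeff_im]), one_mul]
    exact hM.norm_sol_le A h v e hxm
  have hvE : Summable fun e : Edge => ‖v e.1‖ ^ 2 := by
    rw [summable_prod_of_nonneg (fun _ => by positivity)]
    refine ⟨fun j => Summable.of_finite, ?_⟩
    simp only [tsum_fintype, Fintype.univ_bool, Finset.sum_const]
    simpa using hv.mul_left 2
  have hvE' : Summable fun e : Edge => ‖v (e.1 + 1)‖ ^ 2 := by
    have hv' : Summable fun j => ‖v (j + 1)‖ ^ 2 :=
      (Equiv.addRight (1 : ℤ)).summable_iff (f := fun j => ‖v j‖ ^ 2) |>.2 hv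
    rw [summable_prod_of_nonneg (fun _ => by positivity)]
    refine ⟨fun j => Summable.of_finite, ?_⟩
    simp only [tsum_fintype, Fintype.univ_bool, Finset.sum_const]
    simpa using hv'.mul_left 2
  have hFl : Memℓp F 2 := by
    refine memℓp_gen ?_
    have h1 := ((summable_add_sq (summable_add_sq hvE hvE') (summable_norm_sq h)).mul_left
      ((Real.sqrt Real.pi * solConst M) ^ 2))
    refine Summable.of_nonneg_of_le (fun _ => by positivity) (fun e => ?_) h1
    have h2 := hFn e
    rw [← mul_assoc] at h2
    rw [← mul_pow]
    norm_num
    gcongr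
  let f : L2Gamma := ⟨F, hFl⟩
  have hfe : ∀ e, f e = F e := fun e => rfl
  refine ⟨f, h + z • f, IsGauged.isInGraph (p := sol A z h v) (p₁ := sol₁ A z h v)
    (p₂ := sol₂ A z h v) (v := v) ⟨isH2_sol A z h v, fun e => hF e, fun e => ?_,
    sol_start A z h v, fun e => sol_finish A z h v e hS, fun j => ?_⟩, by abel, hFn⟩
  · have he : (h + z • f) e = h e + z • F e := rfl
    rw [he]
    filter_upwards [hF e, Lp.coeFn_add (h e) (z • F e), Lp.coeFn_smul z (F e)] with x h1 h2 h3
    rw [h2, Pi.add_apply, h3, Pi.smul_apply, h1, smul_eq_mul, sol₂, gsrc]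
    linear_combination (-h e x) * phase_neg_mul (coeff A e) x
  · refine (flux_iff hS (isPrim_sol A z h v) (isPrim_sol₁ A z h v)
      (fun e => Eventually.of_forall fun x => rfl) (sol_start A z h v)
      (fun e => sol_finish A z h v e hS) j).2 ?_
    have := heq (j + 1)
    rwa [add_sub_cancel_right, add_assoc, one_add_one_eq_two] at this

end RingChain

/-! ### The vertex equation in `ℓ²(ℤ)` -/

namespace VertexEquation

open Filter Topology ComplexConjugate

/-- Square summable sequences over the vertices. -/
abbrev Seq : Type := lp (fun _ : ℤ => ℂ) 2

theorem memℓp_iff_summable {v : ℤ → ℂ} : Memℓp v 2 ↔ Summable fun j => ‖v j‖ ^ 2 := by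
  rw [memℓp_gen_iff (by norm_num)]
  norm_num

theorem summable_shift {v : ℤ → ℂ} (hv : Summable fun j => ‖v j‖ ^ 2) (m : ℤ) :
    Summable fun j => ‖v (j + m)‖ ^ 2 :=
  (Equiv.addRight m).summable_iff (f := fun j => ‖v j‖ ^ 2) |>.2 hv

/-- The shift by `m`. -/
noncomputable def shift (m : ℤ) : Seq →ₗᵢ[ℂ] Seq where
  toFun v := ⟨fun j => v (j + m),
    memℓp_iff_summable.2 (summable_shift (memℓp_iff_summable.1 (lp.memℓp v)) m)⟩
  map_add' _ _ := rfl
  map_smul' _ _ := rfl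
  norm_map' v := by
    have h : ∀ w : Seq, ‖w‖ ^ 2 = ∑' j, ‖w j‖ ^ 2 := fun w => by
      have := lp.norm_rpow_eq_tsum (p := 2) (by norm_num) w
      norm_num at this
      exact this
    refine (sq_eq_sq₀ (norm_nonneg _) (norm_nonneg _)).1 ?_
    rw [h, h]
    exact (Equiv.addRight m).tsum_eq fun j => ‖v j‖ ^ 2

theorem shift_apply (m : ℤ) (v : Seq) (j : ℤ) : shift m v j = v (j + m) := rfl

theorem inner_shift (v w : Seq) : ⟪shift 1 v, w⟫_ℂ = ⟪v, shift (-1) w⟫_ℂ := by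
  have h : w = shift 1 (shift (-1) w) := by
    ext j; simp [shift_apply]
  conv_lhs => rw [h]
  exact (shift 1).inner_map_map _ _

/-- The adjacency operator of `ℤ`. -/
noncomputable def hop : Seq →L[ℂ] Seq :=
  (shift 1).toContinuousLinearMap + (shift (-1)).toContinuousLinearMap

theorem isSelfAdjoint_hop : IsSelfAdjoint hop := by
  rw [ContinuousLinearMap.isSelfAdjoint_iff_isSymmetric]
  intro v w
  change ⟪shift 1 v + shift (-1) v, w⟫_ℂ = ⟪v, shift 1 w + shift (-1) w⟫_ℂ
  have h : ⟪shift (-1) v, w⟫_ℂ = ⟪v, shift 1 w⟫_ℂ := by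
    rw [← inner_conj_symm, ← inner_shift w v, inner_conj_symm]
  rw [inner_add_left, inner_add_right, inner_shift, h, add_comm]

theorem norm_hop_le : ‖hop‖ ≤ 2 := by
  refine (norm_add_le _ _).trans ?_
  have h1 := (shift 1).norm_toContinuousLinearMap_le
  have h2 := (shift (-1)).norm_toContinuousLinearMap_le
  linarith

/-- The operator `2c · hop` is self-adjoint of norm at most `4|c|`, so its spectrum consists of
reals of modulus at most `4|c|`. -/
theorem isUnit_sub_hop {η : ℂ} {c : ℝ} (h : ¬ ∃ r : ℝ, |r| ≤ |c| ∧ η = r) :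
    IsUnit (algebraMap ℂ (Seq →L[ℂ] Seq) (4 * η) - (2 * c : ℂ) • hop) := by
  rw [← spectrum.notMem_iff]
  intro hmem
  have hsa : IsSelfAdjoint ((2 * c : ℂ) • hop) := by
    refine IsSelfAdjoint.smul ?_ isSelfAdjoint_hop
    rw [IsSelfAdjoint, RCLike.star_def, ← Complex.ofReal_ofNat, ← Complex.ofReal_mul,
      Complex.conj_ofReal]
  have h1 := hsa.mem_spectrum_eq_re hmem
  have h2 : ‖4 * η‖ ≤ 4 * |c| := by
    refine (spectrum.norm_le_norm_mul_of_mem hmem).trans ?_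
    have h3 : ‖(2 * c : ℂ)‖ = 2 * |c| := by simp
    have h4 : ‖(1 : Seq →L[ℂ] Seq)‖ ≤ 1 := ContinuousLinearMap.norm_id_le
    calc ‖(2 * c : ℂ) • hop‖ * ‖(1 : Seq →L[ℂ] Seq)‖ ≤ (2 * |c| * 2) * 1 := by
          rw [norm_smul, h3]
          gcongr
          exact norm_hop_le
      _ = 4 * |c| := by ring
  refine h ⟨η.re, ?_, ?_⟩
  · have h3 := Complex.abs_re_le_norm η
    rw [norm_mul] at h2
    norm_num at h2
    linarith
  · have h3 := congrArg Complex.im h1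
    simp at h3
    apply Complex.ext <;> simp [h3]

theorem exists_vertex_solution {η : ℂ} {c : ℝ} (h : ¬ ∃ r : ℝ, |r| ≤ |c| ∧ η = r) {b : ℤ → ℂ}
    (hb : Summable fun j => ‖b j‖ ^ 2) : ∃ v : ℤ → ℂ, (Summable fun j => ‖v j‖ ^ 2) ∧
      ∀ j, 4 * η * v j - 2 * (c : ℂ) * (v (j + 1) + v (j - 1)) = b j := by
  obtain ⟨B, hB, -⟩ := isUnit_iff_exists.1 (isUnit_sub_hop h)
  let b' : Seq := ⟨b, memℓp_iff_summable.2 hb⟩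
  refine ⟨B b', memℓp_iff_summable.1 (lp.memℓp _), fun j => ?_⟩
  have h1 : (algebraMap ℂ (Seq →L[ℂ] Seq) (4 * η) - (2 * c : ℂ) • hop) (B b') = b' := by
    rw [← mul_apply_eq_comp, hB, one_apply_eq_self]
  have h2 := congrArg (fun w : Seq => w j) h1
  rw [Algebra.algebraMap_eq_smul_one] at h2
  exact h2

theorem tendsto_zero_of_summable {v : ℤ → ℂ} (hv : Summable fun j => ‖v j‖ ^ 2) {φ : ℕ → ℤ}
    (hφ : Function.Injective φ) : Tendsto (fun n => v (φ n)) atTop (𝓝 0) := by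
  have h := (hv.comp_injective hφ).tendsto_atTop_zero
  rw [tendsto_zero_iff_norm_tendsto_zero]
  have h2 := (Real.continuous_sqrt.tendsto 0).comp h
  rw [Real.sqrt_zero] at h2
  refine h2.congr fun n => ?_
  simp [Real.sqrt_sq (norm_nonneg _)]

/-- The conserved quantity of the homogeneous vertex equation vanishes for decaying solutions. -/
theorem conserved_eq_zero {η c : ℂ} {w : ℕ → ℂ} (hw : Tendsto w atTop (𝓝 0))
    (heq : ∀ n, c * (w (n + 2) + w n) = 2 * η * w (n + 1)) (n : ℕ) :
    c * w (n + 1) ^ 2 - 2 * η * w n * w (n + 1) + c * w n ^ 2 = 0 := by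
  set q : ℕ → ℂ := fun n => c * w (n + 1) ^ 2 - 2 * η * w n * w (n + 1) + c * w n ^ 2 with hq
  -- The increment of `q` is `w (n + 2) - w n` times the recurrence; decay of `w` then forces the
  -- constant value to be `0`.
  have hconst : ∀ n, q (n + 1) = q n := fun n => by
    simp only [hq]
    linear_combination (w (n + 2) - w n) * heq n
  have hlim : Tendsto q atTop (𝓝 0) := by
    have h1 := hw.comp (tendsto_add_atTop_nat 1)
    have := ((h1.pow 2).const_mul c).sub ((hw.const_mul (2 * η)).mul h1) |>.add
      ((hw.pow 2).const_mul c)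
    simpa using this
  have hall : ∀ m, q (n + m) = q n := fun m => by
    induction m with
    | zero => rfl
    | succ m ih => rw [← add_assoc, hconst, ih]
  have h2 : Tendsto (fun m => q (n + m)) atTop (𝓝 0) := by
    have := hlim.comp (tendsto_add_atTop_nat n)
    refine this.congr fun m => ?_
    simp [add_comm]
  simp only [hall] at h2
  exact tendsto_nhds_unique tendsto_const_nhds h2

/-- There are no decaying solutions inside the band. -/
theorem eq_zero_of_decaying {r c : ℝ} (hc : c ≠ 0) (hr : |r| ≤ |c|) {w : ℕ → ℂ}
    (hw : Tendsto w atTop (𝓝 0))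
    (heq : ∀ n, (c : ℂ) * (w (n + 2) + w n) = 2 * (r : ℂ) * w (n + 1)) (n : ℕ) : w n = 0 := by
  have hq := conserved_eq_zero hw heq
  have hrc : 0 ≤ c ^ 2 - r ^ 2 := by
    have := sq_le_sq.2 hr; linarith
  set s : ℝ := Real.sqrt (c ^ 2 - r ^ 2)
  have hs : (s : ℂ) ^ 2 = (c : ℂ) ^ 2 - (r : ℂ) ^ 2 := by
    rw [← Complex.ofReal_pow, Real.sq_sqrt hrc]; push_cast; ring
  have hnorm : ∀ ε : ℝ, ε ^ 2 = 1 → ‖(r : ℂ) + ε * s * Complex.I‖ = |c| := by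
    intro ε hε
    rw [← sq_eq_sq₀ (norm_nonneg _) (abs_nonneg _), ← Complex.normSq_eq_norm_sq,
      Complex.normSq_apply, sq_abs]
    simp
    have h2 := Real.sq_sqrt hrc
    have : (ε * s) * (ε * s) = s ^ 2 := by rw [← sq, mul_pow, hε, one_mul]
    rw [this]
    simp only [s, h2]
    ring
  have hstep : ∀ m, ‖w (m + 1)‖ = ‖w m‖ := by
    intro m
    -- The vanishing quadratic form splits into linear factors with multipliers `(r ± i s) / c` of
    -- modulus `1`. So `‖w‖` is constant along the sequence, which is incompatible with decay unless
    -- `w = 0`.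
    have h1 : ((c : ℂ) * w (m + 1) - (r + (1 : ℝ) * s * Complex.I) * w m)
        * ((c : ℂ) * w (m + 1) - (r + (-1 : ℝ) * s * Complex.I) * w m) = 0 := by
      push_cast
      linear_combination (c : ℂ) * hq m - (s ^ 2 * w m ^ 2) * Complex.I_sq - (-w m ^ 2) * hs
    have hc' : 0 < |c| := abs_pos.2 hc
    rcases mul_eq_zero.1 h1 with h | h
    · have := congrArg norm (sub_eq_zero.1 h)
      rw [norm_mul, norm_mul, hnorm 1 (by norm_num), Complex.norm_real, Real.norm_eq_abs] at this
      exact mul_left_cancel₀ hc'.ne' this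
    · have := congrArg norm (sub_eq_zero.1 h)
      rw [norm_mul, norm_mul, hnorm (-1) (by norm_num), Complex.norm_real, Real.norm_eq_abs] at this
      exact mul_left_cancel₀ hc'.ne' this
  have hall : ∀ m, ‖w (n + m)‖ = ‖w n‖ := fun m => by
    induction m with
    | zero => rfl
    | succ m ih => rw [← add_assoc, hstep, ih]
  have h2 : Tendsto (fun m => ‖w (n + m)‖) atTop (𝓝 0) := by
    have := (tendsto_zero_iff_norm_tendsto_zero.1 hw).comp (tendsto_add_atTop_nat n)
    refine this.congr fun m => ?_
    simp [add_comm]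
  simp only [hall] at h2
  exact norm_eq_zero.1 (tendsto_nhds_unique tendsto_const_nhds h2)

/-- Square summable solutions inside the band vanish if the source has support in two adjacent
vertices. -/
theorem eq_zero_of_vertex_eq_in_band {r c : ℝ} (hc : c ≠ 0) (hr : |r| ≤ |c|) {v : ℤ → ℂ}
    (hv : Summable fun j => ‖v j‖ ^ 2) {i : ℤ}
    (heq : ∀ j, j ≠ i → j ≠ i + 1 →
      4 * (r : ℂ) * v j - 2 * (c : ℂ) * (v (j + 1) + v (j - 1)) = 0) : v = 0 := by
  -- The source-free equations at `i + 2, i + 3, …` involve only the values from `v (i + 1)` on,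
  -- those at `i - 1, i - 2, …` only the values up to `v i`; the two half-lines are treated
  -- separately.
  have hright : ∀ n : ℕ, v (i + 1 + n) = 0 := by
    refine eq_zero_of_decaying hc hr (w := fun n : ℕ => v (i + 1 + n))
      (tendsto_zero_of_summable hv fun a b hab => by simpa using hab) fun n => ?_
    have := heq (i + 1 + n + 1) (by omega) (by omega)
    have e : v (i + 1 + (n + 2 : ℕ)) = v (i + 1 + n + 1 + 1) := by congr 1; push_cast; ring
    have e' : v (i + 1 + (n + 1 : ℕ)) = v (i + 1 + n + 1) := by congr 1; push_cast; ring
    have e2 : v (i + 1 + n) = v (i + 1 + n + 1 - 1) := by congr 1; ring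
    rw [e, e', e2]
    linear_combination (-1 / 2 : ℂ) * this
  have hleft : ∀ n : ℕ, v (i - n) = 0 := by
    refine eq_zero_of_decaying hc hr (w := fun n : ℕ => v (i - n))
      (tendsto_zero_of_summable hv fun a b hab => by simpa using hab) fun n => ?_
    have := heq (i - n - 1) (by omega) (by omega)
    have e : v (i - (n + 2 : ℕ)) = v (i - n - 1 - 1) := by congr 1; push_cast; ring
    have e' : v (i - (n + 1 : ℕ)) = v (i - n - 1) := by congr 1; push_cast; ring
    have e2 : v (i - n) = v (i - n - 1 + 1) := by congr 1; ring
    rw [e, e', e2]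
    linear_combination (-1 / 2 : ℂ) * this
  funext j
  rcases le_or_gt j i with h | h
  · obtain ⟨n, hn⟩ := Int.eq_ofNat_of_zero_le (sub_nonneg.2 h)
    rw [show j = i - n by omega]
    exact hleft n
  · obtain ⟨n, hn⟩ := Int.eq_ofNat_of_zero_le (sub_nonneg.2 (Int.add_one_le_iff.2 h))
    rw [show j = i + 1 + n by omega]
    exact hright n

/-- The solution of the vertex equation with a unit source. -/
theorem green_bound {η : ℂ} {c : ℝ} {g : ℤ → ℂ} (hg : Summable fun j => ‖g j‖ ^ 2)
    (heq : ∀ j, 4 * η * g j - 2 * (c : ℂ) * (g (j + 1) + g (j - 1)) = if j = 0 then 1 else 0) :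
    16 * ‖η ^ 2 - (c : ℂ) ^ 2‖ * ‖g 0‖ ^ 2 = 1 ∧
      (|c| * ‖g 1‖ ≤ (‖η‖ + Real.sqrt ‖η ^ 2 - (c : ℂ) ^ 2‖) * ‖g 0‖) ∧
      (|c| * ‖g (-1)‖ ≤ (‖η‖ + Real.sqrt ‖η ^ 2 - (c : ℂ) ^ 2‖) * ‖g 0‖) := by
  have hright := conserved_eq_zero (η := η) (c := c) (w := fun n : ℕ => g n)
    (tendsto_zero_of_summable hg fun a b hab => by simpa using hab) (fun n => by
      have := heq (n + 1)
      rw [if_neg (by omega), add_sub_cancel_right, add_assoc, one_add_one_eq_two] at this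
      push_cast
      linear_combination (-1 / 2 : ℂ) * this) 0
  have hleft := conserved_eq_zero (η := η) (c := c) (w := fun n : ℕ => g (-n))
    (tendsto_zero_of_summable hg fun a b hab => by simpa using hab) (fun n => by
      have := heq (-n - 1)
      rw [if_neg (by omega), sub_add_cancel, sub_sub, one_add_one_eq_two] at this
      push_cast
      rw [show (-(n + 2 : ℤ)) = -n - 2 by ring, show (-(n + 1 : ℤ)) = -n - 1 by ring]
      linear_combination (-1 / 2 : ℂ) * this) 0
  have h0 := heq 0
  simp only [if_true, zero_add, zero_sub] at h0
  simp only [Nat.cast_zero, zero_add, Nat.cast_one, neg_zero] at hright hleft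
  -- Completing the square in the conserved form on each half-line.
  have hx : ((c : ℂ) * g 1 - η * g 0) ^ 2 = (η ^ 2 - (c : ℂ) ^ 2) * g 0 ^ 2 := by
    linear_combination (c : ℂ) * hright
  have hy : ((c : ℂ) * g (-1) - η * g 0) ^ 2 = (η ^ 2 - (c : ℂ) ^ 2) * g 0 ^ 2 := by
    linear_combination (c : ℂ) * hleft
  have hsqrt : ∀ x : ℂ, (x - η * g 0) ^ 2 = (η ^ 2 - (c : ℂ) ^ 2) * g 0 ^ 2 →
      ‖x‖ ≤ (‖η‖ + Real.sqrt ‖η ^ 2 - (c : ℂ) ^ 2‖) * ‖g 0‖ := by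
    intro x hx
    have h1 : ‖x - η * g 0‖ = Real.sqrt ‖η ^ 2 - (c : ℂ) ^ 2‖ * ‖g 0‖ := by
      rw [← Real.sqrt_sq (norm_nonneg (x - η * g 0)), ← norm_pow, hx, norm_mul, norm_pow,
        Real.sqrt_mul (norm_nonneg _), Real.sqrt_sq (norm_nonneg _)]
    have h2 : ‖x‖ ≤ ‖x - η * g 0‖ + ‖η * g 0‖ := by
      simpa using norm_add_le (x - η * g 0) (η * g 0)
    rw [h1, norm_mul] at h2
    linarith
  refine ⟨?_, ?_, ?_⟩
  · have hsum : ((c : ℂ) * g 1 - η * g 0) + ((c : ℂ) * g (-1) - η * g 0) = -1 / 2 := by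
      linear_combination (-1 / 2 : ℂ) * h0
    -- Two numbers with equal squares and sum `-1/2` cannot be opposite, so each is `-1/4`; squaring
    -- gives `16 (η² - c²) (g 0)² = 1`.
    have hne : ((c : ℂ) * g 1 - η * g 0) = ((c : ℂ) * g (-1) - η * g 0) := by
      rcases sq_eq_sq_iff_eq_or_eq_neg.1 (hx.trans hy.symm) with h | h
      · exact h
      · rw [h, neg_add_cancel] at hsum
        norm_num at hsum
    have h16 : 16 * (η ^ 2 - (c : ℂ) ^ 2) * g 0 ^ 2 = 1 := by
      rw [mul_assoc, ← hx]
      rw [← hne] at hsum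
      linear_combination (8 * ((c : ℂ) * g 1 - η * g 0) - 2) * hsum
    have := congrArg norm h16
    rw [norm_mul, norm_mul, norm_pow] at this
    norm_num at this
    exact this
  · have := hsqrt _ hx
    rwa [norm_mul, Complex.norm_real, Real.norm_eq_abs] at this
  · have := hsqrt _ hy
    rwa [norm_mul, Complex.norm_real, Real.norm_eq_abs] at this

end VertexEquation

/-! ### The resolvent set of the Hamiltonian -/

namespace RingChain

open Filter Topology ComplexConjugate UnboundedOp VertexEquation

theorem norm_phase_real (A x : ℝ) : ‖phase (A : ℂ) x‖ = 1 := norm_phase (by simp) x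

theorem norm_phase_neg_real (A x : ℝ) : ‖phase (-(A : ℂ)) x‖ = 1 := norm_phase (by simp) x

theorem IsBound.norm_source_le {z : ℂ} {M : ℝ} (hM : IsBound z M) (A : ℝ) (h : L2Gamma) (j : ℤ) :
    ‖source A z h j‖ ≤ 2 * M ^ 2 * Real.sqrt Real.pi *
      ((‖h (j, true)‖ + ‖h (j, false)‖) + (‖h (j - 1, true)‖ + ‖h (j - 1, false)‖)) := by
  have hM1 := hM.one_le
  have key : ∀ e, ‖smom A z h e‖ ≤ 2 * M ^ 2 * (Real.sqrt Real.pi * ‖h e‖) := fun e =>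
    (hM.norm_smom_le A h e).trans (by gcongr; nlinarith)
  rw [source]
  have h1 := hM.norm_rmom_le A h (j, true)
  have h2 := hM.norm_rmom_le A h (j, false)
  have h3 := key (j - 1, true)
  have h4 := key (j - 1, false)
  refine (norm_add_le _ _).trans ?_
  rw [norm_mul, norm_phase_real, one_mul]
  refine (add_le_add (norm_add_le _ _) le_rfl).trans ?_
  rw [norm_mul, norm_phase_neg_real, one_mul]
  refine (add_le_add (add_le_add (norm_add_le _ _) le_rfl) le_rfl).trans ?_
  linarith

theorem summable_source (A : ℝ) (z : ℂ) (h : L2Gamma) :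
    Summable fun j => ‖source A z h j‖ ^ 2 := by
  obtain ⟨M, hM⟩ := exists_isBound z
  have hinj : ∀ b, Function.Injective fun j : ℤ => ((j, b) : Edge) := fun b x y hxy => by
    simpa using hxy
  have hinj' : ∀ b, Function.Injective fun j : ℤ => ((j - 1, b) : Edge) := fun b x y hxy => by
    simpa using hxy
  have hs := summable_norm_sq h
  have h1 := summable_add_sq (summable_add_sq (hs.comp_injective (hinj true))
      (hs.comp_injective (hinj false)))
    (summable_add_sq (hs.comp_injective (hinj' true)) (hs.comp_injective (hinj' false)))
  refine Summable.of_nonneg_of_le (fun _ => by positivity) (fun j => ?_)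
    (h1.mul_left ((2 * M ^ 2 * Real.sqrt Real.pi) ^ 2))
  rw [← mul_pow]
  exact pow_le_pow_left₀ (norm_nonneg _) (hM.norm_source_le A h j) 2

/-- A point outside of the bands and different from the Dirichlet eigenvalues. -/
theorem mem_resolventSet_of_eta {A α : ℝ} {z : ℂ} (hS : ssol z Real.pi ≠ 0)
    (hη : ¬ ∃ r : ℝ, |r| ≤ |Real.cos (A * Real.pi)| ∧ eta α z = r) :
    z ∈ resolventSet (hamiltonian A α) := by
  refine (isSymm_hamiltonian A α).mem_resolventSet fun h => ?_
  obtain ⟨v, hv, heq⟩ := exists_vertex_solution hη (summable_source A z h)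
  obtain ⟨M, hM⟩ := exists_isBound z
  obtain ⟨f, g, hfg, hz, -⟩ := exists_solution hS hM h hv heq
  obtain ⟨k, rfl, rfl⟩ := exists_domain_iff.2 hfg
  exact ⟨k, hz⟩

/-! ### Sources supported on one edge and the spectrum in the bands -/

/-- A function supported on a single edge. -/
noncomputable def edgeVec (e : Edge) (F : Lp ℂ 2 edgeMeasure) : L2Gamma :=
  lp.single (E := fun _ : Edge => Lp ℂ 2 edgeMeasure) 2 e F

theorem edgeVec_self (e : Edge) (F : Lp ℂ 2 edgeMeasure) : edgeVec e F e = F := by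
  simp [edgeVec]

theorem edgeVec_ne {e e' : Edge} (h : e' ≠ e) (F : Lp ℂ 2 edgeMeasure) : edgeVec e F e' = 0 := by
  simp [edgeVec, h]

theorem mom_eq_zero {h : L2Gamma} {e : Edge} (he : h e = 0) (A : ℝ) (q : ℝ → ℂ) :
    ∫ x in (0 : ℝ)..Real.pi, q x * gsrc A h e x = 0 := by
  have : (fun x => q x * gsrc A h e x) =ᵐ[edgeMeasure] fun _ => 0 := by
    filter_upwards [Lp.coeFn_zero ℂ 2 edgeMeasure] with x hx
    rw [gsrc, he, hx]; simp
  rw [integral_edge_congr this]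
  simp

theorem smom_eq_zero {h : L2Gamma} {e : Edge} (he : h e = 0) (A : ℝ) (z : ℂ) : smom A z h e = 0 :=
  mom_eq_zero he A _

theorem rmom_eq_zero {h : L2Gamma} {e : Edge} (he : h e = 0) (A : ℝ) (z : ℂ) :
    rmom A z h e = 0 := by
  have h1 : cmom A z h e = 0 := mom_eq_zero he A _
  rw [rmom, smom_eq_zero he, h1]; ring

/-- An edge of the ring `i` meets only the vertices `i` and `i + 1`. -/
theorem source_edgeVec (A : ℝ) (z : ℂ) (i : ℤ) (b : Bool) (F : Lp ℂ 2 edgeMeasure) {j : ℤ}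
    (h1 : j ≠ i) (h2 : j ≠ i + 1) : source A z (edgeVec (i, b) F) j = 0 := by
  have e1 : ∀ b', edgeVec (i, b) F (j, b') = 0 := fun b' =>
    edgeVec_ne (fun h => h1 (congrArg Prod.fst h)) F
  have e2 : ∀ b', edgeVec (i, b) F (j - 1, b') = 0 := fun b' =>
    edgeVec_ne (fun h => h2 (by have := congrArg Prod.fst h; simp only at this; omega)) F
  rw [source, rmom_eq_zero (e1 _), rmom_eq_zero (e1 _), smom_eq_zero (e2 _), smom_eq_zero (e2 _)]
  ring

/-- There is a function on the edge whose source term does not vanish. -/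
theorem exists_source_ne_zero (A : ℝ) {z : ℂ} (hS : ssol z Real.pi ≠ 0) :
    ∃ F : Lp ℂ 2 edgeMeasure, source A z (edgeVec (0, true) F) 1 ≠ 0 := by
  -- Chosen so that after gauging the moment against `ssol z` is `∫ |ssol z|² > 0`.
  have hc : Continuous fun x : ℝ => phase (-A) x * conj (ssol z x) :=
    (continuous_phase _).mul (Complex.continuous_conj.comp (continuous_ssol z))
  let F := (memLp_of_continuousOn hc.continuousOn).toLp _
  have hF : F =ᵐ[edgeMeasure] fun x => phase (-A) x * conj (ssol z x) :=
    (memLp_of_continuousOn hc.continuousOn).coeFn_toLp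
  refine ⟨F, ?_⟩
  have e1 : ∀ b', edgeVec (0, true) F (1, b') = 0 := fun b' =>
    edgeVec_ne (fun h => by have := congrArg Prod.fst h; simp at this) F
  have e2 : edgeVec (0, true) F (1 - 1, false) = 0 := edgeVec_ne (by simp) F
  rw [source, rmom_eq_zero (e1 _), rmom_eq_zero (e1 _), smom_eq_zero e2, sub_self]
  simp only [zero_add, mul_zero, add_zero]
  refine mul_ne_zero (phase_ne_zero _ _) ?_
  have h1 : smom A z (edgeVec (0, true) F) (0, true)
      = ∫ x in (0 : ℝ)..Real.pi, ((‖ssol z x‖ ^ 2 : ℝ) : ℂ) := by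
    refine integral_edge_congr ?_
    filter_upwards [hF] with x hx
    rw [gsrc, edgeVec_self, hx, coeff_true, ← mul_assoc (phase _ _), phase_mul_neg, one_mul,
      Complex.mul_conj, Complex.normSq_eq_norm_sq]
  rw [h1, intervalIntegral.integral_ofReal]
  have hpos : 0 < ∫ x in (0 : ℝ)..Real.pi, ‖ssol z x‖ ^ 2 := by
    refine intervalIntegral.integral_pos Real.pi_pos
      ((continuous_ssol z).norm.pow 2).continuousOn (fun _ _ => by positivity)
      ⟨Real.pi, pi_mem_edge, ?_⟩
    positivity
  exact_mod_cast hpos.ne'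

/-- The points of the bands belong to the spectrum. -/
theorem mem_spec_of_eta {A α : ℝ} {z : ℂ} (hS : ssol z Real.pi ≠ 0)
    (hη : ∃ r : ℝ, |r| ≤ |Real.cos (A * Real.pi)| ∧ eta α z = r) :
    z ∈ spec (hamiltonian A α) := by
  rintro ⟨R, hR, -⟩
  obtain ⟨r, hr, hr'⟩ := hη
  obtain ⟨F, hF⟩ := exists_source_ne_zero A hS
  obtain ⟨f, -, hf⟩ := hR (edgeVec (0, true) F)
  obtain ⟨p, p₁, p₂, v, hg⟩ := (isInGraph_apply f).exists_isGauged
  have heq := hg.vertex_eq hS hf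
  rw [hr'] at heq
  refine hF ?_
  -- Without hopping `η = 0` as well, and the left side of the vertex equation is identically zero.
  -- With hopping the source touches only the vertices `0` and `1`, so `v` vanishes. Either way the
  -- source at `1` would be `0`.
  rcases eq_or_ne (Real.cos (A * Real.pi)) 0 with hc | hc
  · rw [hc, abs_zero, abs_nonpos_iff] at hr
    rw [← heq, hr, hc]; simp
  · have hv : v = 0 := by
      refine eq_zero_of_vertex_eq_in_band hc hr hg.summable_v (i := 0) fun j h1 h2 => ?_
      rw [heq j, source_edgeVec A z 0 true F h1 h2]
    rw [← heq, hv]; simp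

theorem ssol_pi_ne_zero_of_im {z : ℂ} (hz : z.im ≠ 0) : ssol z Real.pi ≠ 0 := fun h => by
  obtain ⟨E, -, rfl⟩ := (ssol_pi_eq_zero_iff z).1 h
  simp at hz

end RingChain

/-! ### Eigenvectors -/

namespace RingChain

open Filter Topology ComplexConjugate UnboundedOp VertexEquation

/-- Solutions of the homogeneous equation are combinations of the fundamental solutions. -/
theorem eq_fundamental {p p₁ p₂ : ℝ → ℂ} {z : ℂ} (hp : IsPrim p p₁) (hp₁ : IsPrim p₁ p₂)
    (h : ∀ᵐ x ∂edgeMeasure, p₂ x = -z * p x) {x : ℝ} (hx : x ∈ Icc 0 Real.pi) :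
    p x = p 0 * csol z x + p₁ 0 * ssol z x := by
  have zero_const : ∀ {v w : ℝ → ℂ}, IsPrim v w → w =ᵐ[edgeMeasure] 0 → v x = v 0 := by
    intro v w hv hw
    have h0 := (hv.congr_ae hw).eq x hx
    simpa using h0
  -- The Wronskians of `p` with both fundamental solutions are constant; inverting them recovers
  -- `p`.
  have c1 := zero_const (((isPrim_csol z).mul hp).add (((isPrim_ssol z).mul hp₁).const_mul (-1)))
    (by filter_upwards [h] with t ht
        simp only [ht, Pi.zero_apply]; ring)
  have c2 := zero_const ((((isPrim_ssol z).mul hp).const_mul z).add ((isPrim_csol z).mul hp₁))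
    (by filter_upwards [h] with t ht
        simp only [ht, Pi.zero_apply]; ring)
  simp only [csol_zero, ssol_zero] at c1 c2
  linear_combination csol z x * c1 + ssol z x * c2 - p x * csol_sq_add z x

/-- A combination of the fundamental solutions that vanishes almost everywhere is trivial. -/
theorem fundamental_eq_zero {a b z : ℂ}
    (h : ∀ᵐ x ∂edgeMeasure, a * csol z x + b * ssol z x = 0) : a = 0 ∧ b = 0 := by
  have hp := ((isPrim_csol z).const_mul a).add ((isPrim_ssol z).const_mul b)
  have hp₁ := (((isPrim_ssol z).const_mul (-z)).const_mul a).add ((isPrim_csol z).const_mul b)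
  have e0 : EqOn (fun x => a * csol z x + b * ssol z x) 0 (Icc 0 Real.pi) :=
    Measure.eqOn_Icc_of_ae_eq volume Real.pi_pos.ne h hp.continuousOn continuousOn_const
  have e1 : EqOn (fun x => a * (-z * ssol z x) + b * csol z x) 0 (Icc 0 Real.pi) :=
    Measure.eqOn_Icc_of_ae_eq volume Real.pi_pos.ne
      (ae_zero_of_primitive hp.ii hp.eq fun x hx => e0 hx) hp₁.continuousOn continuousOn_const
  have h0 := e0 zero_mem_edge
  have h1 := e1 zero_mem_edge
  simp only [csol_zero, ssol_zero, Pi.zero_apply] at h0 h1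
  exact ⟨by simpa using h0, by simpa using h1⟩

/-- Finitely supported vertex values and slopes that satisfy the vertex conditions give an
eigenvector. -/
theorem exists_eigenvector {A α : ℝ} {z : ℂ} {v : ℤ → ℂ} {β : Edge → ℂ} (s : Finset ℤ)
    (hv : ∀ j ∉ s, v j = 0) (hβ : ∀ e : Edge, e.1 ∉ s → β e = 0)
    (finish : ∀ e : Edge, v e.1 * csol z Real.pi + β e * ssol z Real.pi
      = phase (coeff A e) Real.pi * v (e.1 + 1))
    (flux : ∀ j, β (j + 1, true) + β (j + 1, false)
      - phase (-A) Real.pi * (β (j, true) * csol z Real.pi + v j * (-z * ssol z Real.pi))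
      - phase A Real.pi * (β (j, false) * csol z Real.pi + v j * (-z * ssol z Real.pi))
      = α * v (j + 1)) :
    ∃ f ∈ eigenspace (hamiltonian A α) z, (∀ e : Edge, e.1 ∉ s → f e = 0) ∧
      ∀ e, f e = 0 → v e.1 = 0 ∧ β e = 0 := by
  let p : Edge → ℝ → ℂ := fun e x => v e.1 * csol z x + β e * ssol z x
  let p₁ : Edge → ℝ → ℂ := fun e x => β e * csol z x + v e.1 * (-z * ssol z x)
  let p₂ : Edge → ℝ → ℂ := fun e x => -z * p e x
  have hp : ∀ e, IsPrim (p e) (p₁ e) := fun e =>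
    (((isPrim_csol z).const_mul (v e.1)).add ((isPrim_ssol z).const_mul (β e))).congr
      (fun _ => rfl) fun x => by simp only [p₁]; ring
  have hp₁ : ∀ e, IsPrim (p₁ e) (p₂ e) := fun e =>
    (((isPrim_csol z).const_mul (β e)).add
      (((isPrim_ssol z).const_mul (-z)).const_mul (v e.1))).congr
      (fun _ => rfl) fun x => by simp only [p₂, p]; ring
  have hmem : ∀ e, MemLp (fun x => phase (-coeff A e) x * p e x) 2 edgeMeasure :=
    fun e => MemLp.phase_mul _ (memLp_of_continuousOn (hp e).continuousOn)
  let F : ∀ _ : Edge, Lp ℂ 2 edgeMeasure := fun e => (hmem e).toLp _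
  have hF : ∀ e, F e =ᵐ[edgeMeasure] fun x => phase (-coeff A e) x * p e x :=
    fun e => (hmem e).coeFn_toLp
  have hF0 : ∀ e : Edge, e.1 ∉ s → F e = 0 := by
    intro e he
    refine Lp.ext ((hF e).trans (EventuallyEq.trans ?_ (Lp.coeFn_zero _ _ _).symm))
    refine Eventually.of_forall fun x => ?_
    simp [p, hv _ he, hβ _ he]
  have hFl : Memℓp F 2 := by
    refine (memℓp_zero ?_).of_exponent_ge zero_le
    refine ((s.finite_toSet).prod (finite_univ (α := Bool))).subset fun e he => ⟨?_, mem_univ _⟩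
    by_contra h
    exact he (hF0 e h)
  let f : L2Gamma := ⟨F, hFl⟩
  have hgr : IsInGraph A α f (z • f) := by
    refine IsGauged.isInGraph (p := p) (p₁ := p₁) (p₂ := p₂) (v := v)
      ⟨fun e => isH2_of_isPrim (hp e) (hp₁ e) ?_, fun e => hF e, fun e => ?_, fun e => ?_, finish,
        fun j => ?_⟩
    · exact (memLp_of_continuousOn (hp e).continuousOn).const_mul (-z)
    · have he : (z • f) e = z • F e := rfl
      rw [he]
      filter_upwards [hF e, Lp.coeFn_smul z (F e)] with x h1 h2
      rw [h2, Pi.smul_apply, h1, smul_eq_mul]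
      simp only [p₂]
      ring
    · simp [p, csol_zero, ssol_zero]
    · simp only [p₁, csol_zero, ssol_zero, mul_one, mul_zero, add_zero]
      exact flux j
  refine ⟨f, ?_, hF0, fun e he => ?_⟩
  · obtain ⟨k, hk, hk'⟩ := exists_domain_iff.2 hgr
    exact mem_eigenspace_iff.2 ⟨k, hk, hk'⟩
  · refine fundamental_eq_zero (z := z) ?_
    have he' : F e = 0 := he
    filter_upwards [hF e, Lp.coeFn_zero ℂ 2 edgeMeasure] with x h1 h2
    rw [he', h2] at h1
    have := mul_eq_zero.1 h1.symm
    exact this.resolve_left (phase_ne_zero _ _)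

/-- A sequence of eigenvectors with disjoint supports. -/
theorem isInfinitelyDegenerate_of_family {A α : ℝ} {z : ℂ} (w : ℤ → L2Gamma)
    (hw : ∀ j, w j ∈ eigenspace (hamiltonian A α) z) (hne : ∀ j, w j ≠ 0)
    (hs : ∀ j (e : Edge), e.1 ∉ ({2 * j, 2 * j + 1} : Finset ℤ) → w j e = 0) :
    IsInfinitelyDegenerate (hamiltonian A α) z := by
  intro hfin
  have horth : ∀ i j, i ≠ j → ⟪w i, w j⟫_ℂ = 0 := by
    intro i j hij
    rw [lp.inner_eq_tsum]
    refine (tsum_congr fun e => ?_).trans tsum_zero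
    by_cases he : e.1 ∈ ({2 * i, 2 * i + 1} : Finset ℤ)
    · rw [hs j e (by simp only [Finset.mem_insert, Finset.mem_singleton] at he ⊢; omega),
        inner_zero_right]
    · rw [hs i e he, inner_zero_left]
  have hli : LinearIndependent ℂ w := linearIndependent_of_ne_zero_of_inner_eq_zero hne horth
  have hli' : LinearIndependent ℂ
      (fun j => (⟨w j, hw j⟩ : eigenspace (hamiltonian A α) z)) :=
    LinearIndependent.of_comp (eigenspace (hamiltonian A α) z).subtype hli
  exact Module.Finite.not_linearIndependent_of_infinite _ hli'

theorem csol_pi_sq_of_ssol {z : ℂ} (hS : ssol z Real.pi = 0) : csol z Real.pi ^ 2 = 1 := by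
  have := csol_sq_add z Real.pi
  rwa [hS, zero_pow two_ne_zero, mul_zero, add_zero] at this

/-- The Dirichlet eigenvalues are eigenvalues of infinite multiplicity. -/
theorem isInfinitelyDegenerate_of_ssol (A α : ℝ) {z : ℂ} (hS : ssol z Real.pi = 0) :
    IsInfinitelyDegenerate (hamiltonian A α) z := by
  have hC := csol_pi_sq_of_ssol hS
  set C := csol z Real.pi with hCdef
  -- Slopes of a function that vanishes at all vertices. On the ring `2 i` the slopes `1` and `-1`
  -- balance at its first vertex; those on the ring `2 i + 1` compensate the flux arriving at the
  -- common vertex, and their own fluxes cancel at the far end because `C² = 1`.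
  let β : ℤ → Edge → ℂ := fun i e =>
    if e = (2 * i, true) then 1 else if e = (2 * i, false) then -1
    else if e = (2 * i + 1, true) then -C * phase A Real.pi
    else if e = (2 * i + 1, false) then C * phase (-A) Real.pi else 0
  have hex : ∀ i : ℤ, ∃ f ∈ eigenspace (hamiltonian A α) z,
      (∀ e : Edge, e.1 ∉ ({2 * i, 2 * i + 1} : Finset ℤ) → f e = 0) ∧
      ∀ e, f e = 0 → (0 : ℤ → ℂ) e.1 = 0 ∧ β i e = 0 := by
    intro i
    refine exists_eigenvector (v := 0) (β := β i) {2 * i, 2 * i + 1} (fun _ _ => rfl) ?_ ?_ ?_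
    · rintro ⟨j, b⟩ he
      simp only [Finset.mem_insert, Finset.mem_singleton, not_or] at he
      simp [β, he.1, he.2]
    · intro e; simp [hS]
    · intro j
      simp only [β, Prod.mk.injEq, and_true, Pi.zero_apply, zero_mul, mul_zero, add_zero,
        Bool.false_eq_true, and_false, if_false, reduceCtorEq, ← hCdef]
      have hpm := phase_neg_mul (A : ℂ) Real.pi
      by_cases h0 : j + 1 = 2 * i
      · simp [h0, show j ≠ 2 * i by omega, show j ≠ 2 * i + 1 by omega]
      by_cases h1 : j = 2 * i
      · simp [h1]
        ring
      by_cases h2 : j = 2 * i + 1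
      · have a1 : j + 1 ≠ 2 * i + 1 := by omega
        simp only [h2, if_true, if_false, show ¬ (2 * i + 1 + 1 = 2 * i) by omega,
          show ¬ (2 * i + 1 + 1 = 2 * i + 1) by omega, show ¬ (2 * i + 1 = 2 * i) by omega]
        ring
      · simp [h0, h1, h2]
  choose w hw hs hn using hex
  refine isInfinitelyDegenerate_of_family w hw (fun j hj => ?_) hs
  have := (hn j (2 * j, true) (by rw [hj]; rfl)).2
  simp [β] at this

/-- If the hopping between the vertices vanishes, the zeros of `η` are eigenvalues of infinite
multiplicity. -/
theorem isInfinitelyDegenerate_of_eta {A α : ℝ} (hc : Real.cos (A * Real.pi) = 0) {z : ℂ}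
    (hη : eta α z = 0) : IsInfinitelyDegenerate (hamiltonian A α) z := by
  by_cases hS : ssol z Real.pi = 0
  · exact isInfinitelyDegenerate_of_ssol A α hS
  have hc' := phase_add_phase_neg A
  rw [hc, Complex.ofReal_zero, mul_zero] at hc'
  have hpm := phase_neg_mul (A : ℂ) Real.pi
  have hcs := csol_sq_add z Real.pi
  have hη' : csol z Real.pi + α / 4 * ssol z Real.pi = 0 := hη
  set C := csol z Real.pi with hCdef
  set S := ssol z Real.pi with hSdef
  -- Only the vertex common to the rings `2 i` and `2 i + 1` is excited. The fluxes through the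
  -- upper and lower edges cancel at the neighbouring vertices because the phases sum to zero; at
  -- the vertex itself the condition is `η = 0`.
  let v : ℤ → ℤ → ℂ := fun i j => if j = 2 * i + 1 then 1 else 0
  let β : ℤ → Edge → ℂ := fun i e => S⁻¹ * (phase (coeff A e) Real.pi * v i (e.1 + 1) - C * v i e.1)
  have hex : ∀ i : ℤ, ∃ f ∈ eigenspace (hamiltonian A α) z,
      (∀ e : Edge, e.1 ∉ ({2 * i, 2 * i + 1} : Finset ℤ) → f e = 0) ∧
      ∀ e, f e = 0 → v i e.1 = 0 ∧ β i e = 0 := by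
    intro i
    have hβS : ∀ e, S * β i e = phase (coeff A e) Real.pi * v i (e.1 + 1) - C * v i e.1 :=
      fun e => mul_inv_cancel_left₀ hS _
    refine exists_eigenvector {2 * i, 2 * i + 1} ?_ ?_ ?_ ?_
    · intro j hj
      simp only [Finset.mem_insert, Finset.mem_singleton, not_or] at hj
      simp [v, hj.2]
    · rintro ⟨j, b⟩ he
      simp only [Finset.mem_insert, Finset.mem_singleton, not_or] at he
      simp [β, v, he.1, he.2]
    · intro e
      rw [← hSdef, ← hCdef]
      linear_combination hβS e
    · intro j
      have e1 := hβS (j + 1, true)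
      have e2 := hβS (j + 1, false)
      have e3 := hβS (j, true)
      have e4 := hβS (j, false)
      simp only [coeff_true, coeff_false] at e1 e2 e3 e4
      rw [← mul_right_inj' hS, ← hSdef, ← hCdef]
      linear_combination e1 + e2 - C * phase (-A) Real.pi * e3 - C * phase A Real.pi * e4
        + (v i (j + 1 + 1)) * hc' - 4 * v i (j + 1) * hη'
        + (v i j) * hcs * (phase A Real.pi + phase (-A) Real.pi) + v i j * hc'
        - 2 * C * v i (j + 1) * hpm
  choose w hw hs hn using hex
  refine isInfinitelyDegenerate_of_family w hw (fun j hj => ?_) hs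
  have := (hn j (2 * j + 1, true) (by rw [hj]; rfl)).1
  simp [v] at this

theorem mem_eigenvalues_of_isInfinitelyDegenerate {A α : ℝ} {z : ℂ}
    (h : IsInfinitelyDegenerate (hamiltonian A α) z) : z ∈ eigenvalues (hamiltonian A α) := by
  intro h0
  refine h ?_
  rw [h0]
  infer_instance

/-- If there is hopping between the vertices, all eigenvalues are Dirichlet eigenvalues. -/
theorem ssol_eq_zero_of_mem_eigenvalues {A α : ℝ} (hc : Real.cos (A * Real.pi) ≠ 0) {z : ℂ}
    (hz : z ∈ eigenvalues (hamiltonian A α)) : ssol z Real.pi = 0 := by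
  by_contra hS
  have hη : ∃ r : ℝ, |r| ≤ |Real.cos (A * Real.pi)| ∧ eta α z = r := by
    by_contra hη
    exact notMem_resolventSet_of_mem_eigenvalues hz (mem_resolventSet_of_eta hS hη)
  obtain ⟨r, hr, hr'⟩ := hη
  refine hz ((Submodule.eq_bot_iff _).2 fun f hf => ?_)
  obtain ⟨k, rfl, hk⟩ := mem_eigenspace_iff.1 hf
  obtain ⟨p, p₁, p₂, v, hg⟩ := (isInGraph_apply k).exists_isGauged
  have hk0 : hamiltonian A α k - z • (k : L2Gamma) = 0 := sub_eq_zero.2 hk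
  have heq := hg.vertex_eq hS hk0
  have hsrc : ∀ j, source A z 0 j = 0 := fun j => by
    rw [source, rmom_eq_zero rfl, rmom_eq_zero rfl, smom_eq_zero rfl, smom_eq_zero rfl]; ring
  -- With vanishing vertex values the function on each edge is a multiple of `ssol z`, which does
  -- not vanish at `π`.
  have hv : v = 0 := by
    refine eq_zero_of_vertex_eq_in_band hc hr hg.summable_v (i := 0) fun j h1 h2 => ?_
    rw [← hr', heq j, hsrc]
  ext1
  funext e
  have hp0 : p e 0 = 0 := by rw [hg.start, hv]; rfl
  have hpπ : p e Real.pi = 0 := by rw [hg.finish, hv]; simp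
  have hp₂ : ∀ᵐ x ∂edgeMeasure, p₂ e x = -z * p e x := by
    filter_upwards [hg.p₂_eq hk0 e, Lp.coeFn_zero ℂ 2 edgeMeasure] with x h1 h2
    have h3 : ((0 : L2Gamma) e : ℝ → ℂ) x = 0 := h2
    rw [h1, gsrc, h3, mul_zero, sub_zero]
  have hx : ∀ x ∈ Icc 0 Real.pi, p e x = p₁ e 0 * ssol z x := fun x hx => by
    rw [eq_fundamental (hg.isH2 e).isPrim (hg.isH2 e).isPrim₁ hp₂ hx, hp0]; ring
  have hp10 : p₁ e 0 = 0 := by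
    have := hx _ pi_mem_edge
    rw [hpπ] at this
    exact (mul_eq_zero.1 this.symm).resolve_right hS
  refine Lp.ext ((hg.f_eq e).trans (EventuallyEq.trans ?_ (Lp.coeFn_zero _ _ _).symm))
  filter_upwards [ae_restrict_mem measurableSet_Icc] with x hxm
  rw [hx x hxm, hp10]
  simp

end RingChain

/-! ### Limits of the resolvent at real energies -/

namespace RingChain

open Filter Topology ComplexConjugate UnboundedOp VertexEquation

/-- Near `k²` there is a square root close to `k`. -/
theorem exists_sqrt_tendsto (k : ℂ) :
    ∃ r : ℂ → ℂ, (∀ z, r z ^ 2 = z) ∧ Tendsto r (𝓝 (k ^ 2)) (𝓝 k) := by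
  -- The sign is chosen so that the root is the one nearer to `k`; the square of its distance to `k`
  -- is then at most `|root z - k| |root z + k| = |z - k²|`.
  refine ⟨fun z => if ‖root z - k‖ ≤ ‖root z + k‖ then root z else -root z, fun z => ?_, ?_⟩
  · dsimp only
    split_ifs
    · exact root_sq z
    · rw [neg_sq, root_sq]
  · have hbound : ∀ z, ‖(if ‖root z - k‖ ≤ ‖root z + k‖ then root z else -root z) - k‖
        ≤ Real.sqrt ‖z - k ^ 2‖ := fun z => by
      refine Real.le_sqrt_of_sq_le ?_
      have h : ‖z - k ^ 2‖ = ‖root z - k‖ * ‖root z + k‖ := by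
        rw [← norm_mul]; congr 1; linear_combination -root_sq z
      rw [h, sq]
      split_ifs with h1
      · gcongr
      · have h2 : ‖-root z - k‖ = ‖root z + k‖ := by rw [← norm_neg]; congr 1; ring
        rw [h2]
        gcongr
        exact (not_le.1 h1).le
    rw [tendsto_iff_norm_sub_tendsto_zero]
    refine squeeze_zero (fun _ => norm_nonneg _) hbound ?_
    have : Continuous fun z : ℂ => Real.sqrt ‖z - k ^ 2‖ := by fun_prop
    have h0 := this.tendsto (k ^ 2)
    rwa [sub_self, norm_zero, Real.sqrt_zero] at h0

/-- Near any point `k²` the variable is the square of a root tending to `k`, which circumvents the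
branch cut of `root`. -/
theorem continuous_of_comp_sq {f : ℂ → ℂ} (h : Continuous fun k => f (k ^ 2)) : Continuous f := by
  refine continuous_iff_continuousAt.2 fun z => ?_
  obtain ⟨k, rfl⟩ : ∃ k, z = k ^ 2 := ⟨root z, (root_sq z).symm⟩
  obtain ⟨r, hr, hr'⟩ := exists_sqrt_tendsto k
  have := (h.tendsto k).comp hr'
  refine this.congr fun z => ?_
  simp only [Function.comp_apply, hr]

theorem continuous_csol_left (x : ℝ) : Continuous fun z => csol z x := by
  refine continuous_of_comp_sq ?_
  simp only [csol_sq]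
  fun_prop

theorem continuous_ssol_left (x : ℝ) : Continuous fun z => ssol z x := by
  refine continuous_of_comp_sq ?_
  have hd : ∀ k, DifferentiableAt ℂ (fun k : ℂ => Complex.sin (k * x)) k := fun k => by fun_prop
  -- The removable singularity of `sin (k x) / k` at `k = 0` is filled by the derivative `x`, which
  -- is also the value of `ssol` at energy `0`.
  have h : (fun k => ssol (k ^ 2) x) = dslope (fun k : ℂ => Complex.sin (k * x)) 0 := by
    funext k
    rcases eq_or_ne k 0 with rfl | hk
    · rw [dslope_same, zero_pow two_ne_zero, ssol_zero_left]
      have h1 : HasDerivAt (fun k : ℂ => k * x) (x : ℂ) 0 := by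
        simpa using (hasDerivAt_id (0 : ℂ)).mul_const (x : ℂ)
      have h2 := (Complex.hasDerivAt_sin ((0 : ℂ) * x)).comp 0 h1
      have h3 := h2.deriv
      simp only [zero_mul, Complex.cos_zero, one_mul] at h3
      exact h3.symm
    · rw [dslope_of_ne _ hk, slope_def_field, ssol_sq hk]
      simp
  rw [h]
  refine continuous_iff_continuousAt.2 fun k => ?_
  rcases eq_or_ne k 0 with rfl | hk
  · exact continuousAt_dslope_same.2 (hd 0)
  · exact (continuousAt_dslope_of_ne hk).2 (hd k).continuousAt

theorem continuous_eta (α : ℝ) : Continuous (eta α) :=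
  (continuous_csol_left _).add (continuous_const.mul (continuous_ssol_left _))

theorem norm_csol_le (z : ℂ) {x : ℝ} (hx : x ∈ Icc 0 Real.pi) :
    ‖csol z x‖ ≤ Real.exp (Real.sqrt ‖z‖ * Real.pi) := by
  obtain ⟨k, rfl⟩ : ∃ k, z = k ^ 2 := ⟨root z, (root_sq z).symm⟩
  have hk : ‖k * x‖ ≤ ‖k‖ * Real.pi := by
    rw [norm_mul, Complex.norm_real, Real.norm_of_nonneg hx.1]
    exact mul_le_mul_of_nonneg_left hx.2 (norm_nonneg _)
  have hexp : ∀ w : ℂ, ‖w‖ ≤ ‖k‖ * Real.pi → ‖Complex.exp w‖ ≤ Real.exp (‖k‖ * Real.pi) := by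
    intro w hw
    rw [Complex.norm_exp]
    exact Real.exp_le_exp.2 ((Complex.re_le_norm w).trans hw)
  rw [csol_sq, norm_pow, Real.sqrt_sq (norm_nonneg _), Complex.cos, norm_div, Complex.norm_ofNat]
  have h1 := hexp (k * x * Complex.I) (by simpa using hk)
  have h2 := hexp (-(k * x) * Complex.I) (by simpa using hk)
  have h3 := norm_add_le (Complex.exp (k * x * Complex.I)) (Complex.exp (-(k * x) * Complex.I))
  linarith

/-- Mean value inequality: `ssol` starts at `0` and has derivative `csol`. -/
theorem norm_ssol_le (z : ℂ) {x : ℝ} (hx : x ∈ Icc 0 Real.pi) :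
    ‖ssol z x‖ ≤ Real.pi * Real.exp (Real.sqrt ‖z‖ * Real.pi) := by
  have := (convex_Icc 0 Real.pi).norm_image_sub_le_of_norm_hasDerivWithin_le (f := ssol z)
    (fun y _ => (hasDerivAt_ssol z y).hasDerivWithinAt) (fun y hy => norm_csol_le z hy)
    zero_mem_edge hx
  rw [ssol_zero, sub_zero, sub_zero, Real.norm_of_nonneg hx.1] at this
  refine this.trans ?_
  rw [mul_comm]
  exact mul_le_mul_of_nonneg_right hx.2 (Real.exp_pos _).le

/-- One constant has to serve a whole neighbourhood of `z₀`, since the resolvent estimate must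
persist as the real axis is approached. -/
theorem eventually_isBound {z₀ : ℂ} (hS : ssol z₀ Real.pi ≠ 0) :
    ∃ M, ∀ᶠ z in 𝓝 z₀, IsBound z M := by
  let K := Real.exp (Real.sqrt (‖z₀‖ + 1) * Real.pi)
  let L := ‖(ssol z₀ Real.pi)⁻¹‖ + 1
  have h1 : ∀ᶠ z in 𝓝 z₀, ‖z‖ < ‖z₀‖ + 1 :=
    continuous_norm.continuousAt.eventually_lt continuousAt_const (lt_add_one _)
  have h2 : ∀ᶠ z in 𝓝 z₀, ‖(ssol z Real.pi)⁻¹‖ < L :=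
    ((continuous_ssol_left Real.pi).continuousAt.inv₀ hS).norm.eventually_lt continuousAt_const
      (lt_add_one _)
  have hK : 0 < K := Real.exp_pos _
  have hL : 0 < L := by positivity
  have hpi := Real.pi_pos
  refine ⟨1 + K + Real.pi * K + L, ?_⟩
  filter_upwards [h1, h2] with z hz1 hz2
  have hexp : Real.exp (Real.sqrt ‖z‖ * Real.pi) ≤ K :=
    Real.exp_le_exp.2 (mul_le_mul_of_nonneg_right (Real.sqrt_le_sqrt hz1.le) hpi.le)
  have hKpi : 0 < Real.pi * K := by positivity
  refine ⟨by linarith, fun x hx => ?_, fun x hx => ?_, by linarith⟩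
  · linarith [norm_csol_le z hx]
  · have := norm_ssol_le z hx
    have h3 := mul_le_mul_of_nonneg_left hexp hpi.le
    linarith

/-- The Green function of the vertex equation stays bounded away from the band edges. -/
theorem eventually_green_bound (α : ℝ) {c : ℝ} (hc : c ≠ 0) {z₀ : ℂ}
    (hη : eta α z₀ ^ 2 ≠ (c : ℂ) ^ 2) :
    ∃ G, ∀ᶠ z in 𝓝 z₀, ∀ g : ℤ → ℂ, (Summable fun j => ‖g j‖ ^ 2) →
      (∀ j, 4 * eta α z * g j - 2 * (c : ℂ) * (g (j + 1) + g (j - 1)) = if j = 0 then 1 else 0) →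
      ‖g 0‖ ≤ G ∧ ‖g 1‖ ≤ G ∧ ‖g (-1)‖ ≤ G := by
  set D := ‖eta α z₀ ^ 2 - (c : ℂ) ^ 2‖ with hD
  have hDpos : 0 < D := norm_pos_iff.2 (sub_ne_zero.2 hη)
  have hcont : Continuous fun z => ‖eta α z ^ 2 - (c : ℂ) ^ 2‖ :=
    (((continuous_eta α).pow 2).sub continuous_const).norm
  have h1 : ∀ᶠ z in 𝓝 z₀, D / 2 < ‖eta α z ^ 2 - (c : ℂ) ^ 2‖ :=
    continuousAt_const.eventually_lt hcont.continuousAt (half_lt_self hDpos)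
  have h2 : ∀ᶠ z in 𝓝 z₀, ‖eta α z ^ 2 - (c : ℂ) ^ 2‖ < D + 1 :=
    hcont.continuousAt.eventually_lt continuousAt_const (lt_add_one D)
  have h3 : ∀ᶠ z in 𝓝 z₀, ‖eta α z‖ < ‖eta α z₀‖ + 1 :=
    (continuous_eta α).norm.continuousAt.eventually_lt continuousAt_const (lt_add_one _)
  -- From `16 · (D / 2) · |g 0|² ≤ 1`.
  let G₀ := Real.sqrt (1 / (8 * D))
  let N := ‖eta α z₀‖ + 1 + Real.sqrt (D + 1)
  have hcpos : 0 < |c| := abs_pos.2 hc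
  refine ⟨max G₀ (N * G₀ / |c|), ?_⟩
  filter_upwards [h1, h2, h3] with z hz1 hz2 hz3 g hg heq
  obtain ⟨e0, e1, e2⟩ := green_bound hg heq
  have hG₀ : ‖g 0‖ ≤ G₀ := by
    refine Real.le_sqrt_of_sq_le ?_
    rw [le_div_iff₀ (by positivity)]
    nlinarith [sq_nonneg ‖g 0‖]
  have hN : (‖eta α z‖ + Real.sqrt ‖eta α z ^ 2 - (c : ℂ) ^ 2‖) * ‖g 0‖ ≤ N * G₀ := by
    have := Real.sqrt_le_sqrt hz2.le
    exact mul_le_mul (by simp only [N]; linarith) hG₀ (norm_nonneg _) (by positivity)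
  refine ⟨hG₀.trans (le_max_left _ _), ?_, ?_⟩ <;> refine le_trans ?_ (le_max_right _ _) <;>
    rw [le_div_iff₀ hcpos, mul_comm] <;> linarith

/-- The resolvent has bounded diagonal matrix elements near energies which are neither Dirichlet
eigenvalues nor band edges. -/
theorem exists_im_bound {A α : ℝ} (hc : Real.cos (A * Real.pi) ≠ 0) {E₀ : ℝ}
    (hE₀ : (E₀ : ℂ) ∈ resolventSet (hamiltonian A α)) {x : ℝ} (hx : x ∉ squares)
    (hη : eta α x ^ 2 ≠ (Real.cos (A * Real.pi) : ℂ) ^ 2) (e : Edge) (F : Lp ℂ 2 edgeMeasure)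
    {μ : Measure ℝ} (hμ : IsSpectralMeasure (hamiltonian A α) (edgeVec e F) μ) :
    ∃ C, ∀ᶠ ε : ℝ in 𝓝[>] 0, (∫ t : ℝ, ((t : ℂ) - (x + ε * Complex.I))⁻¹ ∂μ).im ≤ C := by
  obtain ⟨i, b⟩ := e
  have hS : ssol x Real.pi ≠ 0 := fun h => by
    obtain ⟨E, hE, h⟩ := (ssol_pi_eq_zero_iff _).1 h
    rw [Complex.ofReal_inj] at h
    exact hx (h ▸ hE)
  obtain ⟨M, hM⟩ := eventually_isBound hS
  obtain ⟨G, hG⟩ := eventually_green_bound α hc hη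
  have hlim : Tendsto (fun ε : ℝ => (x : ℂ) + ε * Complex.I) (𝓝[>] 0) (𝓝 (x : ℂ)) := by
    have : Continuous fun ε : ℝ => (x : ℂ) + ε * Complex.I := by fun_prop
    have h := this.tendsto 0
    simp only [Complex.ofReal_zero, zero_mul, add_zero] at h
    exact h.mono_left nhdsWithin_le_nhds
  let B := 2 * M ^ 2 * Real.sqrt Real.pi * (4 * ‖F‖)
  refine ⟨‖F‖ * (Real.sqrt Real.pi * (solConst M * (2 * B * G + 2 * B * G + ‖F‖))), ?_⟩
  filter_upwards [hlim.eventually hM, hlim.eventually hG, self_mem_nhdsWithin] with ε hMε hGε hε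
  rw [mem_Ioi] at hε
  set z : ℂ := x + ε * Complex.I with hz
  have him : z.im ≠ 0 := by simp [hz, hε.ne']
  have hSz := ssol_pi_ne_zero_of_im him
  -- Otherwise the non-real `z` would belong to the spectrum.
  have hηz : ¬ ∃ r : ℝ, |r| ≤ |Real.cos (A * Real.pi)| ∧ eta α z = r := fun h =>
    mem_spec_of_eta hSz h ((isSymm_hamiltonian A α).mem_resolventSet_of_im_ne_zero hE₀ him)
  obtain ⟨g, hg, hgeq⟩ := exists_vertex_solution hηz (b := fun j => if j = 0 then 1 else 0)
    (summable_of_hasFiniteSupport ((finite_singleton (0 : ℤ)).subset fun j hj => by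
      by_contra h
      rw [mem_singleton_iff] at h
      simp [h] at hj))
  obtain ⟨g0, g1, g2⟩ := hGε g hg hgeq
  set h := edgeVec (i, b) F with hh
  -- The source sits at the two ends of the edge, so the solution is a superposition of two
  -- translates of the Green function.
  let v : ℤ → ℂ := fun j => source A z h i * g (j - i) + source A z h (i + 1) * g (j - (i + 1))
  have hle : ∀ e', ‖h e'‖ ≤ ‖F‖ := fun e' => by
    rcases eq_or_ne e' (i, b) with rfl | hne
    · rw [hh, edgeVec_self]
    · rw [hh, edgeVec_ne hne, norm_zero]; exact norm_nonneg _
  have hb : ∀ j, ‖source A z h j‖ ≤ B := fun j => by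
    refine (hMε.norm_source_le A h j).trans ?_
    have := hle (j, true)
    have := hle (j, false)
    have := hle (j - 1, true)
    have := hle (j - 1, false)
    refine mul_le_mul_of_nonneg_left (by linarith) (by positivity)
  have hv : Summable fun j => ‖v j‖ ^ 2 := by
    have key : ∀ (a : ℂ) (m : ℤ), Summable fun j => ‖a * g (j - m)‖ ^ 2 := fun a m => by
      simp only [norm_mul, mul_pow]
      exact (summable_shift hg (-m)).mul_left _
    refine Summable.of_nonneg_of_le (fun _ => by positivity) (fun j => ?_)
      (summable_add_sq (key (source A z h i) i) (key (source A z h (i + 1)) (i + 1)))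
    exact pow_le_pow_left₀ (norm_nonneg _) (norm_add_le _ _) 2
  have heq : ∀ j, 4 * eta α z * v j
      - 2 * (Real.cos (A * Real.pi) : ℂ) * (v (j + 1) + v (j - 1)) = source A z h j := fun j => by
    have a1 := hgeq (j - i)
    have a2 := hgeq (j - (i + 1))
    rw [show j - i + 1 = j + 1 - i by ring, show j - i - 1 = j - 1 - i by ring] at a1
    rw [show j - (i + 1) + 1 = j + 1 - (i + 1) by ring,
      show j - (i + 1) - 1 = j - 1 - (i + 1) by ring] at a2
    have a3 : 4 * eta α z * v j - 2 * (Real.cos (A * Real.pi) : ℂ) * (v (j + 1) + v (j - 1))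
        = source A z h i * (if j - i = 0 then 1 else 0)
          + source A z h (i + 1) * (if j - (i + 1) = 0 then 1 else 0) := by
      rw [← a1, ← a2]; simp only [v]; ring
    rw [a3]
    by_cases h1 : j = i
    · subst h1; simp
    by_cases h2 : j = i + 1
    · subst h2; simp
    · rw [if_neg (by omega), if_neg (by omega), hh, source_edgeVec A z i b F h1 h2]; ring
  obtain ⟨f, f', hff, hfz, hfb⟩ := exists_solution hSz hMε h hv heq
  obtain ⟨k, rfl, rfl⟩ := exists_domain_iff.2 hff
  obtain ⟨k', hk', hin, -⟩ :=
    (isSymm_hamiltonian A α).exists_resolvent_of_isSpectralMeasure hμ x hε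
  have hkk : k' = k := (isSymm_hamiltonian A α).eq_of_sub_smul_eq him (hk'.trans hfz.symm)
  rw [← hin, hkk]
  have hGn : 0 ≤ G := (norm_nonneg _).trans g0
  have hBn : 0 ≤ B := (norm_nonneg _).trans (hb 0)
  have hvb : ∀ a b : ℤ, ‖g a‖ ≤ G → ‖g b‖ ≤ G →
      ‖source A z h i * g a + source A z h (i + 1) * g b‖ ≤ 2 * B * G := fun a b ha hb' => by
    refine (norm_add_le _ _).trans ?_
    rw [norm_mul, norm_mul]
    have h1 := mul_le_mul (hb i) ha (norm_nonneg _) hBn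
    have h2 := mul_le_mul (hb (i + 1)) hb' (norm_nonneg _) hBn
    linarith
  -- Only the solution on the original edge enters the matrix element, hence only `g 0`, `g 1` and
  -- `g (-1)` need to be bounded.
  have hv1 : ‖v i‖ ≤ 2 * B * G := hvb _ _ (by simpa using g0) (by simpa using g2)
  have hv2 : ‖v (i + 1)‖ ≤ 2 * B * G := hvb _ _ (by simpa using g1) (by simpa using g0)
  have hK : 0 ≤ solConst M := by
    have := hMε.one_le
    unfold solConst; positivity
  have hin' : ⟪edgeVec (i, b) F, (k : L2Gamma)⟫_ℂ = ⟪F, (k : L2Gamma) (i, b)⟫_ℂ := by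
    rw [edgeVec, lp.inner_single_left]
  rw [hin']
  refine (Complex.im_le_norm _).trans ((norm_inner_le_norm _ _).trans ?_)
  refine mul_le_mul_of_nonneg_left ((hfb (i, b)).trans ?_) (norm_nonneg _)
  have := hle (i, b)
  gcongr

/-- The functions supported on single edges form a total set. -/
theorem eq_top_of_edgeVec_mem {V : Submodule ℂ L2Gamma} (hV : IsClosed (V : Set L2Gamma))
    (h : ∀ e F, edgeVec e F ∈ V) : V = ⊤ := by
  refine (Submodule.eq_top_iff').2 fun ψ => ?_
  have hs := lp.hasSum_single (p := 2) (by norm_num) ψ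
  refine hV.mem_of_tendsto hs (Eventually.of_forall fun s => ?_)
  exact Submodule.sum_mem _ fun e _ => h e _

/-- Spectral measures are absolutely continuous away from the Dirichlet eigenvalues and the band
edges. -/
theorem measure_eq_zero_of_volume {A α : ℝ} (hc : Real.cos (A * Real.pi) ≠ 0) {E₀ : ℝ}
    (hE₀ : (E₀ : ℂ) ∈ resolventSet (hamiltonian A α)) {μ : L2Gamma → Measure ℝ}
    (hμ : IsSpectralFamily (hamiltonian A α) μ) {N : Set ℝ} (hN : MeasurableSet N)
    (hN0 : volume N = 0)
    (hND : ∀ x ∈ N, x ∉ squares ∧ eta α x ^ 2 ≠ (Real.cos (A * Real.pi) : ℂ) ^ 2)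
    (ψ : L2Gamma) : μ ψ N = 0 := by
  obtain ⟨V, hV, hmem⟩ := hμ.exists_nullSubspace N hN
  -- The resolvent bound is available for single-edge vectors only; it extends to all vectors
  -- because those with null set `N` form a closed subspace.
  have htop : V = ⊤ := eq_top_of_edgeVec_mem hV fun e F => (hmem _).2 <| by
    have hm := hμ.isSpectralMeasure (edgeVec e F)
    have := hm.1
    exact measure_eq_zero_of_im_bounded _ hN0 fun x hx =>
      exists_im_bound hc hE₀ (hND x hx).1 (hND x hx).2 e F hm
  rw [← hmem, htop]
  exact Submodule.mem_top

end RingChain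

/-! ### The band functions -/

namespace RingChain

open Filter Topology

/-- `cos kπ` as a function of the real energy `k²`. -/
noncomputable def cosPi (E : ℝ) : ℝ := (csol E Real.pi).re

/-- `sin kπ / k` as a function of the real energy `k²`. -/
noncomputable def sinPi (E : ℝ) : ℝ := (ssol E Real.pi).re

/-- `η` as a function of the real energy `k²`. -/
noncomputable def disc (α E : ℝ) : ℝ := cosPi E + α / 4 * sinPi E

theorem csol_pi_sq (k : ℝ) : csol ((k ^ 2 : ℝ) : ℂ) Real.pi = (Real.cos (k * Real.pi) : ℝ) := by
  push_cast
  exact csol_sq k Real.pi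

theorem ssol_pi_sq {k : ℝ} (hk : k ≠ 0) :
    ssol ((k ^ 2 : ℝ) : ℂ) Real.pi = (Real.sin (k * Real.pi) / k : ℝ) := by
  push_cast
  exact ssol_sq (Complex.ofReal_ne_zero.2 hk) Real.pi

theorem csol_pi_neg_sq (κ : ℝ) :
    csol ((-κ ^ 2 : ℝ) : ℂ) Real.pi = (Real.cosh (κ * Real.pi) : ℝ) := by
  have h : ((-κ ^ 2 : ℝ) : ℂ) = (κ * Complex.I) ^ 2 := by
    rw [mul_pow, Complex.I_sq]; push_cast; ring
  rw [h, csol_sq, mul_right_comm, Complex.cos_mul_I]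
  push_cast
  rfl

theorem ssol_pi_neg_sq {κ : ℝ} (hκ : κ ≠ 0) :
    ssol ((-κ ^ 2 : ℝ) : ℂ) Real.pi = (Real.sinh (κ * Real.pi) / κ : ℝ) := by
  have h : ((-κ ^ 2 : ℝ) : ℂ) = (κ * Complex.I) ^ 2 := by
    rw [mul_pow, Complex.I_sq]; push_cast; ring
  have hκ' : (κ : ℂ) ≠ 0 := Complex.ofReal_ne_zero.2 hκ
  rw [h, ssol_sq (mul_ne_zero hκ' Complex.I_ne_zero), mul_right_comm, Complex.sin_mul_I,
    mul_div_mul_right _ _ Complex.I_ne_zero]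
  push_cast
  rfl

theorem cosPi_sq (k : ℝ) : cosPi (k ^ 2) = Real.cos (k * Real.pi) := by
  rw [cosPi, csol_pi_sq, Complex.ofReal_re]

theorem sinPi_sq {k : ℝ} (hk : k ≠ 0) : sinPi (k ^ 2) = Real.sin (k * Real.pi) / k := by
  rw [sinPi, ssol_pi_sq hk, Complex.ofReal_re]

theorem cosPi_neg_sq (κ : ℝ) : cosPi (-κ ^ 2) = Real.cosh (κ * Real.pi) := by
  rw [cosPi, csol_pi_neg_sq, Complex.ofReal_re]

theorem sinPi_neg_sq {κ : ℝ} (hκ : κ ≠ 0) : sinPi (-κ ^ 2) = Real.sinh (κ * Real.pi) / κ := by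
  rw [sinPi, ssol_pi_neg_sq hκ, Complex.ofReal_re]

theorem cosPi_zero : cosPi 0 = 1 := by
  have := cosPi_sq 0
  simpa using this

theorem sinPi_zero : sinPi 0 = Real.pi := by
  rw [sinPi, Complex.ofReal_zero, ssol_zero_left, Complex.ofReal_re]

/-- Every real energy is zero, `k²` or `-k²` with `0 < k`. -/
theorem energy_cases (E : ℝ) : E = 0 ∨ (∃ k, 0 < k ∧ E = k ^ 2) ∨ ∃ k, 0 < k ∧ E = -k ^ 2 := by
  rcases lt_trichotomy E 0 with h | h | h
  · exact Or.inr (Or.inr ⟨Real.sqrt (-E), Real.sqrt_pos.2 (by linarith),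
      by rw [Real.sq_sqrt (by linarith)]; ring⟩)
  · exact Or.inl h
  · exact Or.inr (Or.inl ⟨Real.sqrt E, Real.sqrt_pos.2 h, (Real.sq_sqrt h.le).symm⟩)

theorem csol_eq_cosPi (E : ℝ) : csol E Real.pi = cosPi E := by
  rcases energy_cases E with rfl | ⟨k, hk, rfl⟩ | ⟨k, hk, rfl⟩
  · have := csol_pi_sq 0
    rw [cosPi_zero]
    simpa using this
  · rw [csol_pi_sq, cosPi_sq]
  · rw [csol_pi_neg_sq, cosPi_neg_sq]

theorem ssol_eq_sinPi (E : ℝ) : ssol E Real.pi = sinPi E := by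
  rcases energy_cases E with rfl | ⟨k, hk, rfl⟩ | ⟨k, hk, rfl⟩
  · rw [sinPi_zero, Complex.ofReal_zero, ssol_zero_left]
  · rw [ssol_pi_sq hk.ne', sinPi_sq hk.ne']
  · rw [ssol_pi_neg_sq hk.ne', sinPi_neg_sq hk.ne']

theorem eta_eq_disc (α E : ℝ) : eta α E = disc α E := by
  rw [eta, csol_eq_cosPi, ssol_eq_sinPi, disc]
  push_cast
  rfl

theorem continuous_cosPi : Continuous cosPi :=
  Complex.continuous_re.comp ((continuous_csol_left _).comp Complex.continuous_ofReal)

theorem continuous_sinPi : Continuous sinPi :=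
  Complex.continuous_re.comp ((continuous_ssol_left _).comp Complex.continuous_ofReal)

theorem continuous_disc (α : ℝ) : Continuous (disc α) :=
  continuous_cosPi.add (continuous_const.mul continuous_sinPi)

theorem sinPi_eq_zero_iff (E : ℝ) : sinPi E = 0 ↔ E ∈ squares := by
  rw [← Complex.ofReal_eq_zero, ← ssol_eq_sinPi, ssol_pi_eq_zero_iff]
  constructor
  · rintro ⟨E', h, h'⟩
    rwa [Complex.ofReal_inj.1 h']
  · exact fun h => ⟨E, h, rfl⟩

theorem disc_zero (α : ℝ) : disc α 0 = 1 + α * Real.pi / 4 := by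
  rw [disc, cosPi_zero, sinPi_zero]; ring

theorem disc_nat_sq (α : ℝ) {n : ℕ} (hn : 1 ≤ n) : disc α ((n : ℝ) ^ 2) = (-1) ^ n := by
  have hs : sinPi ((n : ℝ) ^ 2) = 0 := (sinPi_eq_zero_iff _).2 ⟨n, hn, rfl⟩
  rw [disc, hs, cosPi_sq, Real.cos_nat_mul_pi, mul_zero, add_zero]

/-- At `-κ²` the discriminant is `cosh κπ + (α / 4κ) sinh κπ`. For `κ = |α| + 1` the second term is
at least `-sinh κπ / 4`, and `sinh κπ ≥ κπ > 3`. -/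
theorem exists_disc_gt_one (α : ℝ) : ∃ E < 0, 1 < disc α E := by
  set κ := |α| + 1 with hκ
  have hκ0 : 0 < κ := by positivity
  have hκ1 : 1 ≤ κ := by simp [hκ]
  refine ⟨-κ ^ 2, by nlinarith, ?_⟩
  rw [disc, cosPi_neg_sq, sinPi_neg_sq hκ0.ne']
  have h3 := Real.pi_gt_three
  have h1 : κ * Real.pi ≤ Real.sinh (κ * Real.pi) := Real.self_le_sinh_iff.2 (by positivity)
  have h2 := Real.sinh_lt_cosh (κ * Real.pi)
  have h4 : 3 < κ * Real.pi := by nlinarith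
  set s := Real.sinh (κ * Real.pi)
  have h5 : -α * (s / κ) ≤ s := by
    rw [mul_div_assoc', div_le_iff₀ hκ0, mul_comm]
    have : -α ≤ κ := by linarith [neg_le_abs α]
    exact mul_le_mul_of_nonneg_left this (by linarith)
  linarith [h5]

/-! ### Strict monotonicity of the discriminant quotient between the squares -/

/-- The sign condition for the derivative of `ratio`. It is affine in `c`: twice the difference of
the sides is `(1 + c)(1 - cos θ)(θ + sin θ) + (1 - c)(1 + cos θ)(θ - sin θ)`, a sum of positive
terms. -/
theorem trig_ineq {c θ : ℝ} (hc : |c| < 1) (hθ : 0 < θ) (hs : Real.sin θ ≠ 0) :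
    (Real.cos θ - c) * Real.sin θ < θ * (1 - c * Real.cos θ) := by
  obtain ⟨h1, h2⟩ := abs_lt.1 hc
  have hsq := Real.sin_sq_add_cos_sq θ
  have hs2 : 0 < Real.sin θ ^ 2 := by positivity
  have hC : |Real.cos θ| < 1 := by rw [← sq_lt_one_iff_abs_lt_one]; linarith
  obtain ⟨h3, h4⟩ := abs_lt.1 hC
  have h5 : Real.sin θ < θ := Real.sin_lt hθ
  have h6 : -θ < Real.sin θ := by
    rcases le_or_gt θ 1 with h | h
    · linarith [Real.sin_pos_of_pos_of_le_one hθ h]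
    · linarith [Real.neg_one_le_sin θ]
  have a1 : 0 < (1 + c) * ((1 - Real.cos θ) * (θ + Real.sin θ)) :=
    mul_pos (by linarith) (mul_pos (by linarith) (by linarith))
  have a2 : 0 < (1 - c) * ((1 + Real.cos θ) * (θ - Real.sin θ)) :=
    mul_pos (by linarith) (mul_pos (by linarith) (by linarith))
  linarith

/-- The same splitting at negative energies, now with `cosh θ - 1` and `sinh θ - θ` as the positive
factors. -/
theorem hyp_ineq {c θ : ℝ} (hc : |c| < 1) (hθ : 0 < θ) :
    θ * (1 - c * Real.cosh θ) < (Real.cosh θ - c) * Real.sinh θ := by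
  obtain ⟨h1, h2⟩ := abs_lt.1 hc
  have h3 : 1 < Real.cosh θ := Real.one_lt_cosh.2 hθ.ne'
  have h5 : θ < Real.sinh θ := Real.self_lt_sinh_iff.2 hθ
  have a1 : 0 < (1 + c) * ((Real.cosh θ - 1) * (θ + Real.sinh θ)) :=
    mul_pos (by linarith) (mul_pos (by linarith) (by linarith))
  have a2 : 0 < (1 - c) * ((Real.cosh θ + 1) * (Real.sinh θ - θ)) :=
    mul_pos (by linarith) (mul_pos (by linarith) (by linarith))
  linarith

/-- The quotient `(cos kπ - c) / (sin kπ / k)`. -/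
noncomputable def ratio (c E : ℝ) : ℝ := (cosPi E - c) / sinPi E

theorem continuousAt_ratio (c : ℝ) {E : ℝ} (hE : E ∉ squares) : ContinuousAt (ratio c) E :=
  (continuous_cosPi.sub continuous_const).continuousAt.div continuous_sinPi.continuousAt
    (mt (sinPi_eq_zero_iff E).1 hE)

theorem strictAntiOn_ratio_sq {c : ℝ} (hc : |c| < 1) {D : Set ℝ} (hD : Convex ℝ D)
    (hD0 : D ⊆ Ici 0) (hDs : ∀ k ∈ D, k ^ 2 ∉ squares) :
    StrictAntiOn (fun k => ratio c (k ^ 2)) D := by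
  refine strictAntiOn_of_deriv_neg hD (fun k hk => ?_) fun k hk => ?_
  · exact (ContinuousAt.comp (f := fun k : ℝ => k ^ 2) (continuousAt_ratio c (hDs k hk))
      (continuous_pow 2).continuousAt).continuousWithinAt
  · have hk0 : 0 < k := by
      have := interior_mono hD0 hk
      rwa [interior_Ici] at this
    have hs : Real.sin (k * Real.pi) ≠ 0 := fun h => by
      refine hDs k (interior_subset hk) ((sinPi_eq_zero_iff _).1 ?_)
      rw [sinPi_sq hk0.ne', h, zero_div]
    have hlin : HasDerivAt (fun k : ℝ => k * Real.pi) Real.pi k := by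
      simpa using (hasDerivAt_id k).mul_const Real.pi
    have hcos := (Real.hasDerivAt_cos (k * Real.pi)).comp k hlin
    have hsin := (Real.hasDerivAt_sin (k * Real.pi)).comp k hlin
    have hd := ((hasDerivAt_id k).mul (hcos.sub_const c)).div hsin hs
    have heq : (fun k => ratio c (k ^ 2)) =ᶠ[𝓝 k]
        ((id * fun x => (Real.cos ∘ fun k : ℝ => k * Real.pi) x - c) /
          (Real.sin ∘ fun k : ℝ => k * Real.pi)) := by
      filter_upwards [lt_mem_nhds hk0] with x hx
      simp only [ratio, cosPi_sq, sinPi_sq hx.ne', Pi.div_apply, Pi.mul_apply, id_eq,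
        Function.comp_apply]
      rw [div_div_eq_mul_div, mul_comm]
    rw [heq.deriv_eq, hd.deriv]
    refine div_neg_of_neg_of_pos ?_ (by simp only [Function.comp_apply]; positivity)
    simp only [Pi.mul_apply, id_eq, Function.comp_apply, one_mul]
    refine lt_of_eq_of_lt ?_ (sub_neg.2 (trig_ineq hc (mul_pos hk0 Real.pi_pos) hs))
    -- By `sin² + cos² = 1` the numerator of the derivative is exactly the difference in `trig_ineq`
    -- with `θ = kπ`.
    linear_combination (-k * Real.pi) * Real.sin_sq_add_cos_sq (k * Real.pi)

theorem neg_sq_notMem_squares (κ : ℝ) : -κ ^ 2 ∉ squares := by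
  rintro ⟨n, hn, h⟩
  have : (1 : ℝ) ≤ n := by exact_mod_cast hn
  nlinarith [sq_nonneg κ]

theorem strictMonoOn_ratio_neg_sq {c : ℝ} (hc : |c| < 1) :
    StrictMonoOn (fun κ => ratio c (-κ ^ 2)) (Ici 0) := by
  refine strictMonoOn_of_deriv_pos (convex_Ici 0) (fun k hk => ?_) fun k hk => ?_
  · exact (ContinuousAt.comp (f := fun k : ℝ => -k ^ 2)
      (continuousAt_ratio c (neg_sq_notMem_squares k))
      (continuous_pow 2).neg.continuousAt).continuousWithinAt
  · have hk0 : 0 < k := by rwa [interior_Ici] at hk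
    have hs : Real.sinh (k * Real.pi) ≠ 0 :=
      (Real.sinh_pos_iff.2 (mul_pos hk0 Real.pi_pos)).ne'
    have hlin : HasDerivAt (fun k : ℝ => k * Real.pi) Real.pi k := by
      simpa using (hasDerivAt_id k).mul_const Real.pi
    have hcos := (Real.hasDerivAt_cosh (k * Real.pi)).comp k hlin
    have hsin := (Real.hasDerivAt_sinh (k * Real.pi)).comp k hlin
    have hd := ((hasDerivAt_id k).mul (hcos.sub_const c)).div hsin hs
    have heq : (fun k => ratio c (-k ^ 2)) =ᶠ[𝓝 k]
        ((id * fun x => (Real.cosh ∘ fun k : ℝ => k * Real.pi) x - c) /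
          (Real.sinh ∘ fun k : ℝ => k * Real.pi)) := by
      filter_upwards [lt_mem_nhds hk0] with x hx
      simp only [ratio, cosPi_neg_sq, sinPi_neg_sq hx.ne', Pi.div_apply, Pi.mul_apply, id_eq,
        Function.comp_apply]
      rw [div_div_eq_mul_div, mul_comm]
    rw [heq.deriv_eq, hd.deriv]
    refine div_pos ?_ (by simp only [Function.comp_apply]; positivity)
    simp only [Pi.mul_apply, id_eq, Function.comp_apply, one_mul]
    refine lt_of_lt_of_eq (sub_pos.2 (hyp_ineq hc (mul_pos hk0 Real.pi_pos))) ?_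
    linear_combination (k * Real.pi) * Real.cosh_sq (k * Real.pi)

/-- The open intervals between the Dirichlet eigenvalues. -/
def gap (n : ℕ) : Set ℝ := {E | (1 ≤ n → (n : ℝ) ^ 2 < E) ∧ E < ((n : ℝ) + 1) ^ 2}

theorem ordConnected_gap (n : ℕ) : (gap n).OrdConnected :=
  ⟨fun _ hx _ hy _ hz => ⟨fun h => (hx.1 h).trans_le hz.1, hz.2.trans_lt hy.2⟩⟩

theorem lt_of_gap_of_lt {n k : ℕ} (h : n < k) {x y : ℝ} (hx : x ∈ gap n) (hy : y ∈ gap k) :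
    x < (k : ℝ) ^ 2 ∧ (k : ℝ) ^ 2 < y := by
  refine ⟨hx.2.trans_le ?_, hy.1 (by omega)⟩
  have : (n : ℝ) + 1 ≤ k := by exact_mod_cast h
  exact pow_le_pow_left₀ (by positivity) this 2

theorem notMem_squares_of_mem_gap {n : ℕ} {E : ℝ} (h : E ∈ gap n) : E ∉ squares := by
  rintro ⟨k, hk, rfl⟩
  have h2 := lt_of_pow_lt_pow_left₀ 2 (by positivity) h.2
  have h2' : k < n + 1 := by exact_mod_cast h2
  have h1 := lt_of_pow_lt_pow_left₀ 2 (by positivity) (h.1 (by omega))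
  have h1' : n < k := by exact_mod_cast h1
  omega

theorem exists_mem_gap {E : ℝ} (h : E ∉ squares) : ∃ n, E ∈ gap n := by
  refine ⟨⌊Real.sqrt E⌋₊, fun h1 => ?_, ?_⟩
  · have h2 := Nat.floor_le (Real.sqrt_nonneg E)
    have h3 : 0 < Real.sqrt E := by
      have : (1 : ℝ) ≤ ⌊Real.sqrt E⌋₊ := by exact_mod_cast h1
      linarith
    have h4 := pow_le_pow_left₀ (by positivity) h2 2
    rw [Real.sq_sqrt (Real.sqrt_pos.1 h3).le] at h4
    exact lt_of_le_of_ne h4 fun h5 => h ⟨_, h1, h5.symm⟩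
  · exact Real.lt_sq_of_sqrt_lt (Nat.lt_floor_add_one _)

/-- Nonnegative energies are parametrized by `k²` and nonpositive ones by `-κ²`. The latter reverses
the order, so increase in `κ` is decrease in the energy; the two halves meet at `0`. -/
theorem strictAntiOn_ratio {c : ℝ} (hc : |c| < 1) (n : ℕ) : StrictAntiOn (ratio c) (gap n) := by
  have hpos : ∀ x ∈ gap n, ∀ y ∈ gap n, 0 ≤ x → x < y → ratio c y < ratio c x := by
    intro x hx y hy h0 hxy
    have := strictAntiOn_ratio_sq hc (convex_Icc (Real.sqrt x) (Real.sqrt y))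
      (fun k hk => (Real.sqrt_nonneg x).trans hk.1) (fun k hk => by
        refine notMem_squares_of_mem_gap (n := n) ((ordConnected_gap n).out hx hy ⟨?_, ?_⟩)
        · exact (Real.sqrt_le_left ((Real.sqrt_nonneg x).trans hk.1)).1 hk.1
        · exact (Real.le_sqrt ((Real.sqrt_nonneg x).trans hk.1) (h0.trans hxy.le)).1 hk.2)
      (left_mem_Icc.2 (Real.sqrt_le_sqrt hxy.le)) (right_mem_Icc.2 (Real.sqrt_le_sqrt hxy.le))
      (Real.sqrt_lt_sqrt h0 hxy)
    simpa only [Real.sq_sqrt h0, Real.sq_sqrt (h0.trans hxy.le)] using this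
  have hneg : ∀ x y : ℝ, x < y → y ≤ 0 → ratio c y < ratio c x := by
    intro x y hxy h0
    have := strictMonoOn_ratio_neg_sq hc (Real.sqrt_nonneg (-y)) (Real.sqrt_nonneg (-x))
      (Real.sqrt_lt_sqrt (by linarith) (by linarith))
    simpa only [Real.sq_sqrt (show 0 ≤ -y by linarith), Real.sq_sqrt (show 0 ≤ -x by linarith),
      neg_neg] using this
  intro x hx y hy hxy
  rcases le_or_gt 0 x with h0 | h0
  · exact hpos x hx y hy h0 hxy
  rcases le_or_gt y 0 with h1 | h1
  · exact hneg x y hxy h1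
  · exact (hpos 0 ((ordConnected_gap n).out hx hy ⟨h0.le, h1.le⟩) y hy le_rfl h1).trans
      (hneg x 0 h0 le_rfl)

/-- The sign of `sin kπ` for `n < k < n + 1`; at energies `≤ 0`, which occur only for `n = 0`, the
function is `π` or `sinh κπ / κ`. -/
theorem sinPi_sign {n : ℕ} {E : ℝ} (h : E ∈ gap n) : 0 < (-1) ^ n * sinPi E := by
  rcases energy_cases E with rfl | ⟨k, hk, rfl⟩ | ⟨k, hk, rfl⟩
  · have hn : n = 0 := by
      by_contra h0
      have := h.1 (by omega)
      nlinarith [sq_nonneg (n : ℝ)]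
    rw [hn, sinPi_zero]
    simpa using Real.pi_pos
  · rw [sinPi_sq hk.ne', ← mul_div_assoc]
    refine div_pos ?_ hk
    have h2 := lt_of_pow_lt_pow_left₀ 2 (by positivity) h.2
    have h1 : (n : ℝ) < k := by
      rcases Nat.eq_zero_or_pos n with rfl | hn
      · simpa using hk
      · exact lt_of_pow_lt_pow_left₀ 2 hk.le (h.1 hn)
    rw [← Real.sin_sub_nat_mul_pi]
    have hpi := Real.pi_pos
    refine Real.sin_pos_of_pos_of_lt_pi ?_ ?_
    · nlinarith
    · nlinarith
  · have hn : n = 0 := by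
      by_contra h0
      have := h.1 (by omega)
      nlinarith [sq_nonneg (n : ℝ), sq_nonneg k]
    rw [hn, sinPi_neg_sq hk.ne', pow_zero, one_mul]
    exact div_pos (Real.sinh_pos_iff.2 (mul_pos hk Real.pi_pos)) hk

/-- Crossing the level `c` means that `ratio c` equals `-α/4`: the coupling enters only as a level
of one monotone function. -/
theorem disc_sub (α c : ℝ) {E : ℝ} (hE : E ∉ squares) :
    disc α E - c = sinPi E * (ratio c E + α / 4) := by
  have := mt (sinPi_eq_zero_iff E).1 hE
  rw [disc, ratio]
  field_simp
  ring

/-- Between two Dirichlet eigenvalues the discriminant crosses every level in `(-1, 1)` once. -/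
theorem disc_le_iff (α : ℝ) {t : ℝ} (ht : |t| < 1) {n : ℕ} {a E : ℝ} (ha : a ∈ gap n)
    (hE : E ∈ gap n) (hat : (-1) ^ n * disc α a = t) :
    ((-1) ^ n * disc α E ≤ t ↔ a ≤ E) ∧ (t ≤ (-1) ^ n * disc α E ↔ E ≤ a) := by
  have hs : ((-1 : ℝ) ^ n) * (-1) ^ n = 1 := by rw [← mul_pow]; norm_num
  have ht' : |(-1) ^ n * t| < 1 := by rwa [abs_mul, abs_pow, abs_neg, abs_one, one_pow, one_mul]
  have key : ∀ x ∈ gap n, (-1) ^ n * disc α x - t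
      = ((-1) ^ n * sinPi x) * (ratio ((-1) ^ n * t) x + α / 4) := fun x hx => by
    rw [mul_assoc, ← disc_sub α _ (notMem_squares_of_mem_gap hx)]
    linear_combination t * hs
  have ha0 : ratio ((-1) ^ n * t) a + α / 4 = 0 := by
    have := key a ha
    rw [hat, sub_self] at this
    exact (mul_eq_zero.1 this.symm).resolve_left (sinPi_sign ha).ne'
  have hanti := strictAntiOn_ratio ht' n
  have hpos := sinPi_sign hE
  have hkE := key E hE
  constructor
  · rw [← hanti.le_iff_ge hE ha, ← sub_nonpos, hkE, ← not_lt,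
      mul_pos_iff_of_pos_left hpos, not_lt]
    constructor <;> intro <;> linarith
  · rw [← hanti.le_iff_ge ha hE, ← sub_nonneg, hkE, mul_nonneg_iff_of_pos_left hpos]
    constructor <;> intro <;> linarith

end RingChain

/-! ### The bands -/

namespace RingChain

open Filter Topology

/-- Intermediate value theorem: `(-1)^n disc` is `-1` at `(n + 1)²` and `1` at `n²`. For `n = 0`,
where the gap has no left end point, a negative energy with `disc > 1` takes the place of `n²`. -/
theorem exists_disc_eq (α : ℝ) {t : ℝ} (ht : |t| < 1) (n : ℕ) :
    ∃ a ∈ gap n, (-1) ^ n * disc α a = t := by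
  obtain ⟨ht1, ht2⟩ := abs_lt.1 ht
  have hs : ((-1 : ℝ) ^ n) * (-1) ^ n = 1 := by rw [← mul_pow]; norm_num
  obtain ⟨l, hl, hlg, hlt⟩ : ∃ l < ((n : ℝ) + 1) ^ 2, Ioo l (((n : ℝ) + 1) ^ 2) ⊆ gap n ∧
      t < (-1) ^ n * disc α l := by
    rcases Nat.eq_zero_or_pos n with rfl | hn
    · obtain ⟨E, hE, hE1⟩ := exists_disc_gt_one α
      refine ⟨E, by norm_num; linarith, fun x hx => ⟨fun h => by omega, hx.2⟩, ?_⟩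
      rw [pow_zero, one_mul]; linarith
    · refine ⟨(n : ℝ) ^ 2, by nlinarith [(Nat.cast_nonneg n : (0 : ℝ) ≤ n)],
        fun x hx => ⟨fun _ => hx.1, hx.2⟩, ?_⟩
      rw [disc_nat_sq α hn, hs]; exact ht2
  have hr : (-1) ^ n * disc α (((n : ℝ) + 1) ^ 2) = -1 := by
    have := disc_nat_sq α (n := n + 1) (by omega)
    rw [Nat.cast_add, Nat.cast_one] at this
    rw [this, pow_succ, ← mul_assoc, hs, one_mul]
  have hcont : Continuous fun E => (-1) ^ n * disc α E := continuous_const.mul (continuous_disc α)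
  obtain ⟨a, ha, hat⟩ := intermediate_value_Icc' hl.le hcont.continuousOn
    (show t ∈ Icc _ _ from ⟨by rw [hr]; exact ht1.le, hlt.le⟩)
  dsimp only at hat
  refine ⟨a, hlg ⟨lt_of_le_of_ne ha.1 ?_, lt_of_le_of_ne ha.2 ?_⟩, hat⟩
  · rintro rfl; linarith
  · rintro rfl; linarith

/-- In each gap the energies in the bands form a compact interval of positive length. -/
theorem exists_band (α : ℝ) {c : ℝ} (hc0 : 0 < c) (hc1 : c < 1) (n : ℕ) :
    ∃ a b, a < b ∧ Icc a b ⊆ gap n ∧ (∀ E ∈ gap n, (-1) ^ n * disc α E ≤ c ↔ a ≤ E) ∧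
      ∀ E ∈ gap n, -c ≤ (-1) ^ n * disc α E ↔ E ≤ b := by
  have h1 : |c| < 1 := by rwa [abs_of_pos hc0]
  have h2 : |-c| < 1 := by rwa [abs_neg]
  obtain ⟨a, ha, hac⟩ := exists_disc_eq α h1 n
  obtain ⟨b, hb, hbc⟩ := exists_disc_eq α h2 n
  refine ⟨a, b, ?_, (ordConnected_gap n).out ha hb, fun E hE => (disc_le_iff α h1 ha hE hac).1,
    fun E hE => (disc_le_iff α h2 hb hE hbc).2⟩
  refine lt_of_le_of_ne ((disc_le_iff α h1 ha hb hac).1.1 (by linarith)) ?_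
  rintro rfl
  linarith

theorem abs_disc_eq (α : ℝ) (n : ℕ) (E : ℝ) : |disc α E| = |(-1) ^ n * disc α E| := by
  rw [abs_mul, abs_pow, abs_neg, abs_one, one_pow, one_mul]

theorem countable_squares : squares.Countable := by
  refine (countable_range fun n : ℕ => (n : ℝ) ^ 2).mono ?_
  rintro _ ⟨n, -, rfl⟩
  exact ⟨n, rfl⟩

theorem isClosed_squares : IsClosed squares := by
  have : squares = sinPi ⁻¹' {0} := by
    ext E; exact (sinPi_eq_zero_iff E).symm
  rw [this]
  exact isClosed_singleton.preimage continuous_sinPi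

/-- Each gap contains at most one such energy by strict monotonicity, and the squares are countable.
-/
theorem countable_disc_eq (α : ℝ) {t : ℝ} (ht : |t| < 1) : {E | disc α E = t}.Countable := by
  have hsub : {E | disc α E = t} ⊆ squares ∪ ⋃ n, ({E | disc α E = t} ∩ gap n) := fun E hE => by
    by_cases h : E ∈ squares
    · exact Or.inl h
    · obtain ⟨n, hn⟩ := exists_mem_gap h
      exact Or.inr (mem_iUnion.2 ⟨n, hE, hn⟩)
  refine (countable_squares.union (countable_iUnion fun n => ?_)).mono hsub
  refine Set.Subsingleton.countable fun x hx y hy => ?_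
  refine (strictAntiOn_ratio ht n).injOn hx.2 hy.2 ?_
  have key : ∀ w ∈ {E | disc α E = t} ∩ gap n, ratio t w = -(α / 4) := fun w hw => by
    have hns := notMem_squares_of_mem_gap hw.2
    have h1 := disc_sub α t hns
    rw [show disc α w = t from hw.1, sub_self] at h1
    have := (mul_eq_zero.1 h1.symm).resolve_left (mt (sinPi_eq_zero_iff w).1 hns)
    linarith
  rw [key x hx, key y hy]

theorem mem_xiZeros_iff (α E : ℝ) : E ∈ xiZeros α ↔ disc α E = 0 := by
  have h : ∀ k : ℂ, (E : ℂ) = k ^ 2 → (xiNum α k = 0 ↔ disc α E = 0) := fun k hk => by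
    rw [xiNum_eq_eta, ← hk, eta_eq_disc, Complex.ofReal_eq_zero]
  constructor
  · rintro ⟨k, hk, h0⟩
    exact (h k hk).1 h0
  · intro h0
    exact ⟨root E, (root_sq _).symm, (h _ (root_sq _).symm).2 h0⟩

theorem norm_xi_le_one_iff {A α : ℝ} (hc : Real.cos (A * Real.pi) ≠ 0) {E : ℝ} {k : ℂ}
    (hk : (E : ℂ) = k ^ 2) : ‖xi A α k‖ ≤ 1 ↔ |disc α E| ≤ |Real.cos (A * Real.pi)| := by
  rw [xi, xiNum_eq_eta, ← hk, eta_eq_disc, ← Complex.ofReal_div, Complex.norm_real,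
    Real.norm_eq_abs, abs_div, div_le_one (abs_pos.2 hc)]

theorem mem_bandSet_iff {A α : ℝ} (hc : Real.cos (A * Real.pi) ≠ 0) (E : ℝ) :
    E ∈ bandSet A α ↔ |disc α E| ≤ |Real.cos (A * Real.pi)| := by
  constructor
  · rintro ⟨k, hk, h⟩
    exact (norm_xi_le_one_iff hc hk).1 h
  · intro h
    exact ⟨root E, (root_sq _).symm, (norm_xi_le_one_iff hc (root_sq _).symm).2 h⟩

theorem abs_cos_lt_one {A : ℝ} (hA : ¬ ∃ m : ℤ, A = m) : |Real.cos (A * Real.pi)| < 1 := by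
  rw [← sq_lt_one_iff_abs_lt_one]
  have hs : Real.sin (A * Real.pi) ≠ 0 := fun h => by
    obtain ⟨m, hm⟩ := Real.sin_eq_zero_iff.1 h
    exact hA ⟨m, (mul_right_cancel₀ Real.pi_ne_zero hm).symm⟩
  have := Real.sin_sq_add_cos_sq (A * Real.pi)
  have : 0 < Real.sin (A * Real.pi) ^ 2 := by positivity
  linarith

theorem cos_eq_zero_iff {A : ℝ} :
    Real.cos (A * Real.pi) = 0 ↔ ∃ m : ℤ, A - 1 / 2 = m := by
  rw [Real.cos_eq_zero_iff]
  refine exists_congr fun m => ⟨fun h => ?_, fun h => ?_⟩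
  · have : (A - 1 / 2) * Real.pi = m * Real.pi := by linarith
    exact mul_right_cancel₀ Real.pi_ne_zero this
  · rw [← h]; ring

theorem isClosed_bandSet {A α : ℝ} (hc : Real.cos (A * Real.pi) ≠ 0) :
    IsClosed (bandSet A α) := by
  have : bandSet A α = {E | |disc α E| ≤ |Real.cos (A * Real.pi)|} :=
    Set.ext fun E => mem_bandSet_iff hc E
  rw [this]
  exact isClosed_le (continuous_disc α).abs continuous_const

/-- At the squares `|disc| = 1`, which strictly exceeds `|cos Aπ|`; hence bands of different gaps do
not touch. -/
theorem notMem_squares_of_mem_bandSet {A α : ℝ} (hc : Real.cos (A * Real.pi) ≠ 0)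
    (hc1 : |Real.cos (A * Real.pi)| < 1) {E : ℝ} (hE : E ∈ bandSet A α) : E ∉ squares := by
  rintro ⟨n, hn, rfl⟩
  rw [mem_bandSet_iff hc, disc_nat_sq α hn, abs_pow, abs_neg, abs_one, one_pow] at hE
  linarith

/-- The connected components of the set of energies in the bands. -/
theorem connectedComponentIn_bandSet {A α : ℝ} (hc : Real.cos (A * Real.pi) ≠ 0)
    (hc1 : |Real.cos (A * Real.pi)| < 1) {n : ℕ} {a b : ℝ} (hab : Icc a b ⊆ gap n)
    (h1 : ∀ E ∈ gap n, (-1) ^ n * disc α E ≤ |Real.cos (A * Real.pi)| ↔ a ≤ E)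
    (h2 : ∀ E ∈ gap n, -|Real.cos (A * Real.pi)| ≤ (-1) ^ n * disc α E ↔ E ≤ b) {E : ℝ}
    (hE : E ∈ bandSet A α) (hEn : E ∈ gap n) :
    connectedComponentIn (bandSet A α) E = Icc a b := by
  have hmem : ∀ y ∈ gap n, (y ∈ bandSet A α ↔ y ∈ Icc a b) := fun y hy => by
    rw [mem_bandSet_iff hc, abs_disc_eq α n, abs_le, h1 y hy, h2 y hy, and_comm]; rfl
  refine Subset.antisymm (fun y hy => ?_) ?_
  · have hsub := connectedComponentIn_subset (bandSet A α) E
    have hord := (isPreconnected_connectedComponentIn (x := E) (F := bandSet A α)).ordConnected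
    have hEc := mem_connectedComponentIn hE
    have hns : ∀ w ∈ connectedComponentIn (bandSet A α) E, w ∉ squares := fun w hw =>
      notMem_squares_of_mem_bandSet hc hc1 (hsub hw)
    obtain ⟨k, hk⟩ := exists_mem_gap (hns y hy)
    -- A connected set meeting two different gaps would contain a square between them.
    rcases lt_trichotomy k n with hlt | rfl | hlt
    · obtain ⟨l1, l2⟩ := lt_of_gap_of_lt hlt hk hEn
      exact absurd ⟨n, by omega, rfl⟩ (hns _ (hord.out hy hEc ⟨l1.le, l2.le⟩))
    · exact (hmem y hk).1 (hsub hy)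
    · obtain ⟨l1, l2⟩ := lt_of_gap_of_lt hlt hEn hk
      exact absurd ⟨k, by omega, rfl⟩ (hns _ (hord.out hEc hy ⟨l1.le, l2.le⟩))
  · exact isPreconnected_Icc.subset_connectedComponentIn ((hmem E hEn).1 hE)
      fun y hy => (hmem y (hab hy)).2 hy

end RingChain

/-! ### The spectrum of the Hamiltonian -/

namespace UnboundedOp

variable {H : Type*} [NormedAddCommGroup H] [InnerProductSpace ℂ H]

theorem eigenspace_le_ppSubspace (T : H →ₗ.[ℂ] H) (z : ℂ) : eigenspace T z ≤ ppSubspace T :=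
  (le_iSup (eigenspace T) z).trans (Submodule.le_topologicalClosure _)

theorem isClosed_ppSubspace (T : H →ₗ.[ℂ] H) : IsClosed (ppSubspace T : Set H) :=
  Submodule.isClosed_topologicalClosure _

/-- Spectral measures of vectors orthogonal to all eigenvectors have no atoms. -/
theorem IsSpectralFamily.measure_countable {T : H →ₗ.[ℂ] H} {μ : H → Measure ℝ}
    (hμ : IsSpectralFamily T μ) {ψ : H} (hψ : ψ ∈ (ppSubspace T)ᗮ) {D : Set ℝ}
    (hD : D.Countable) : μ ψ D = 0 := by
  rw [← biUnion_of_singleton D, measure_biUnion_null_iff hD]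
  exact fun E _ => hμ.measure_singleton E ψ
    (Submodule.orthogonal_le (eigenspace_le_ppSubspace T E) hψ)

end UnboundedOp

namespace RingChain

open Filter Topology UnboundedOp

theorem mem_spec_iff {A α : ℝ} (z : ℂ) : z ∈ spec (hamiltonian A α) ↔
    ssol z Real.pi = 0 ∨ ∃ r : ℝ, |r| ≤ |Real.cos (A * Real.pi)| ∧ eta α z = r := by
  constructor
  · intro h
    by_contra! h'
    refine h (mem_resolventSet_of_eta h'.1 ?_)
    rintro ⟨r, hr, hr'⟩
    exact h'.2 r hr hr'
  · intro h
    by_cases hS : ssol z Real.pi = 0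
    · exact notMem_resolventSet_of_mem_eigenvalues
        (mem_eigenvalues_of_isInfinitelyDegenerate (isInfinitelyDegenerate_of_ssol A α hS))
    · exact mem_spec_of_eta hS (h.resolve_left hS)

theorem ofReal_mem_spec_iff {A α : ℝ} (E : ℝ) : (E : ℂ) ∈ spec (hamiltonian A α) ↔
    E ∈ squares ∨ |disc α E| ≤ |Real.cos (A * Real.pi)| := by
  rw [mem_spec_iff, ssol_eq_sinPi, Complex.ofReal_eq_zero, sinPi_eq_zero_iff, eta_eq_disc]
  refine or_congr_right ⟨?_, fun h => ⟨_, h, rfl⟩⟩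
  rintro ⟨r, hr, h⟩
  rwa [Complex.ofReal_inj.1 h]

theorem ofReal_mem_resolventSet_iff {A α : ℝ} (E : ℝ) :
    (E : ℂ) ∈ resolventSet (hamiltonian A α) ↔
      E ∉ squares ∧ |Real.cos (A * Real.pi)| < |disc α E| := by
  have := (ofReal_mem_spec_iff (A := A) (α := α) E).not
  rw [not_or, not_le] at this
  rw [← this, spec, notMem_compl_iff]

/-- This real resolvent point is what the construction of the spectral measures rests on. -/
theorem exists_mem_resolventSet (A α : ℝ) :
    ∃ E : ℝ, (E : ℂ) ∈ resolventSet (hamiltonian A α) := by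
  obtain ⟨E, hE, hE1⟩ := exists_disc_gt_one α
  refine ⟨E, (ofReal_mem_resolventSet_iff E).2 ⟨?_, ?_⟩⟩
  · rintro ⟨n, -, rfl⟩
    nlinarith [sq_nonneg (n : ℝ)]
  · exact (Real.abs_cos_le_one _).trans_lt (hE1.trans_le (le_abs_self _))

theorem spec_hamiltonian (A α : ℝ) : spec (hamiltonian A α) =
    Complex.ofReal '' {E | E ∈ squares ∨ |disc α E| ≤ |Real.cos (A * Real.pi)|} := by
  ext z
  constructor
  · intro hz
    obtain ⟨E, hE⟩ := exists_mem_resolventSet A α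
    have him : z.im = 0 := by
      by_contra h
      exact hz ((isSymm_hamiltonian A α).mem_resolventSet_of_im_ne_zero hE h)
    have hzr : ((z.re : ℝ) : ℂ) = z := Complex.ext rfl (by simp [him])
    exact ⟨z.re, (ofReal_mem_spec_iff z.re).1 (by rwa [hzr]), hzr⟩
  · rintro ⟨E, hE, rfl⟩
    exact (ofReal_mem_spec_iff E).2 hE

theorem isInfinitelyDegenerate_of_mem_squares (A α : ℝ) {E : ℝ} (hE : E ∈ squares) :
    IsInfinitelyDegenerate (hamiltonian A α) (E : ℂ) :=
  isInfinitelyDegenerate_of_ssol A α ((ssol_pi_eq_zero_iff _).2 ⟨E, hE, rfl⟩)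

theorem eigenvalues_hamiltonian {A : ℝ} (α : ℝ) (hc : Real.cos (A * Real.pi) ≠ 0) :
    eigenvalues (hamiltonian A α) = Complex.ofReal '' squares := by
  ext z
  constructor
  · intro hz
    obtain ⟨E, hE, rfl⟩ := (ssol_pi_eq_zero_iff z).1 (ssol_eq_zero_of_mem_eigenvalues hc hz)
    exact ⟨E, hE, rfl⟩
  · rintro ⟨E, hE, rfl⟩
    exact mem_eigenvalues_of_isInfinitelyDegenerate (isInfinitelyDegenerate_of_mem_squares A α hE)

/-- Without hopping between the vertices the spectrum is pure point. -/
theorem ppSubspace_eq_top {A : ℝ} (α : ℝ) (hc : Real.cos (A * Real.pi) = 0) :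
    ppSubspace (hamiltonian A α) = ⊤ := by
  have hT := isSymm_hamiltonian A α
  obtain ⟨E₀, hE₀⟩ := exists_mem_resolventSet A α
  obtain ⟨μ, hμ⟩ := hT.exists_spectralFamily hE₀
  rw [ppSubspace, Submodule.topologicalClosure_eq_top_iff, ← Submodule.orthogonal_closure,
    Submodule.eq_bot_iff]
  intro ψ hψ
  -- The spectrum is countable, so a vector orthogonal to all eigenvectors has neither atoms nor
  -- mass off the spectrum; its total mass `‖ψ‖²` is zero.
  have hcount : (squares ∪ {E | disc α E = 0}).Countable :=
    countable_squares.union (countable_disc_eq α (by simp))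
  have h0 : μ ψ univ = 0 := by
    refine measure_mono_null (t := {x : ℝ | (x : ℂ) ∈ resolventSet (hamiltonian A α)} ∪
      (squares ∪ {E | disc α E = 0})) (fun x _ => ?_)
      (measure_union_null (hT.measure_resolventSet (hμ.isSpectralMeasure ψ))
        (hμ.measure_countable hψ hcount))
    by_cases h : (x : ℂ) ∈ resolventSet (hamiltonian A α)
    · exact Or.inl h
    · have := (ofReal_mem_spec_iff x).1 h
      rw [hc, abs_zero, abs_nonpos_iff] at this
      exact Or.inr this
  rw [hμ.measure_univ, ENNReal.ofReal_eq_zero] at h0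
  exact norm_eq_zero.1 (pow_eq_zero_iff two_ne_zero |>.1 (le_antisymm h0 (sq_nonneg _)))

/-- Vectors orthogonal to all eigenvectors have absolutely continuous spectral measures. -/
theorem absolutelyContinuous_of_mem {A α : ℝ} (hc : Real.cos (A * Real.pi) ≠ 0)
    (hc1 : |Real.cos (A * Real.pi)| < 1) {E₀ : ℝ}
    (hE₀ : (E₀ : ℂ) ∈ resolventSet (hamiltonian A α)) {μ : L2Gamma → Measure ℝ}
    (hμ : IsSpectralFamily (hamiltonian A α) μ) {ψ : L2Gamma}
    (hψ : ψ ∈ (ppSubspace (hamiltonian A α))ᗮ) : μ ψ ≪ volume := by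
  set c := Real.cos (A * Real.pi) with hcdef
  -- Dirichlet energies and band edges, where no resolvent bound is available. They form a countable
  -- set, which is null for lack of atoms.
  let D : Set ℝ := squares ∪ ({E | disc α E = c} ∪ {E | disc α E = -c})
  have hD : D.Countable := countable_squares.union
    ((countable_disc_eq α hc1).union (countable_disc_eq α (by rwa [abs_neg])))
  refine Measure.AbsolutelyContinuous.mk fun N hN hN0 => ?_
  refine measure_mono_null (t := (N \ D) ∪ D) (by rw [sdiff_union_self]; exact subset_union_left)
    (measure_union_null ?_ (hμ.measure_countable hψ hD))
  refine measure_eq_zero_of_volume hc hE₀ hμ (hN.diff hD.measurableSet)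
    (measure_mono_null sdiff_subset hN0) (fun x hx => ⟨fun h => hx.2 (Or.inl h), fun h => ?_⟩) ψ
  rw [eta_eq_disc] at h
  rcases sq_eq_sq_iff_eq_or_eq_neg.1 h with h | h
  · exact hx.2 (Or.inr (Or.inl (Complex.ofReal_inj.1 h)))
  · exact hx.2 (Or.inr (Or.inr (by exact_mod_cast h)))

theorem orthogonal_ppSubspace {A : ℝ} (α : ℝ) (hc : Real.cos (A * Real.pi) ≠ 0)
    (hc1 : |Real.cos (A * Real.pi)| < 1) :
    ((ppSubspace (hamiltonian A α))ᗮ : Set L2Gamma) = acSubspace (hamiltonian A α) := by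
  have hT := isSymm_hamiltonian A α
  obtain ⟨E₀, hE₀⟩ := exists_mem_resolventSet A α
  obtain ⟨μ, hμ⟩ := hT.exists_spectralFamily hE₀
  ext ψ
  constructor
  · intro hψ
    exact ⟨μ ψ, hμ.isSpectralMeasure ψ, absolutelyContinuous_of_mem hc hc1 hE₀ hμ hψ⟩
  · rintro ⟨ν, hν, hac⟩
    rw [SetLike.mem_coe, ppSubspace, Submodule.orthogonal_closure, ← Submodule.iInf_orthogonal,
      Submodule.mem_iInf]
    intro z
    rw [Submodule.mem_orthogonal]
    intro v hv
    by_cases hz : z ∈ eigenvalues (hamiltonian A α)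
    · rw [eigenvalues_hamiltonian α hc] at hz
      obtain ⟨E, -, rfl⟩ := hz
      exact hT.inner_eq_zero_of_measure_singleton hv hν (hac Real.volume_singleton)
    · rw [not_not.1 hz, Submodule.mem_bot] at hv
      rw [hv, inner_zero_left]

/-- Off the bands the spectrum consists of squares only, a Lebesgue null set. At a point of a band
some spectral measure charges every neighbourhood, and it remains to replace the vector by its
component orthogonal to the eigenvectors. -/
theorem acSpectrum_hamiltonian {A : ℝ} (α : ℝ) (hc : Real.cos (A * Real.pi) ≠ 0)
    (hc1 : |Real.cos (A * Real.pi)| < 1) : acSpectrum (hamiltonian A α) = bandSet A α := by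
  have hT := isSymm_hamiltonian A α
  obtain ⟨E₀, hE₀⟩ := exists_mem_resolventSet A α
  obtain ⟨μ, hμ⟩ := hT.exists_spectralFamily hE₀
  ext E
  constructor
  · intro hE
    by_contra hEB
    obtain ⟨ψ, ν, hν, hac, hne⟩ := hE _ (isClosed_bandSet hc).isOpen_compl hEB
    refine hne (measure_mono_null
      (t := {x : ℝ | (x : ℂ) ∈ resolventSet (hamiltonian A α)} ∪ squares)
      (fun x hx => ?_) (measure_union_null (hT.measure_resolventSet hν)
        (hac (countable_squares.measure_zero _))))
    by_cases h : x ∈ squares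
    · exact Or.inr h
    · refine Or.inl ((ofReal_mem_resolventSet_iff x).2 ⟨h, ?_⟩)
      rwa [mem_compl_iff, mem_bandSet_iff hc, not_le] at hx
  · intro hE U hU hEU
    have hEs := notMem_squares_of_mem_bandSet hc hc1 hE
    -- With the eigenvalues removed, the neighbourhood is invisible to all eigenvectors, hence to
    -- the whole pure point subspace.
    have hW : IsOpen (U ∩ squaresᶜ) := hU.inter isClosed_squares.isOpen_compl
    have hspec : (E : ℂ) ∈ spec (hamiltonian A α) :=
      (ofReal_mem_spec_iff E).2 (Or.inr ((mem_bandSet_iff hc E).1 hE))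
    obtain ⟨h, hh⟩ := hμ.exists_measure_ne_zero hT hE₀ hspec hW ⟨hEU, hEs⟩
    obtain ⟨V, hV, hmem⟩ := hμ.exists_nullSubspace _ hW.measurableSet
    have hpp : ppSubspace (hamiltonian A α) ≤ V := by
      refine Submodule.topologicalClosure_minimal _ (iSup_le fun z v hv => ?_) hV
      by_cases hz : z ∈ eigenvalues (hamiltonian A α)
      · rw [eigenvalues_hamiltonian α hc] at hz
        obtain ⟨E', hE', rfl⟩ := hz
        refine (hmem v).2 (measure_mono_null (fun x hx => ?_)
          (hT.measure_compl_of_mem_eigenspace hv (hμ.isSpectralMeasure v)))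
        rintro rfl
        exact hx.2 hE'
      · rw [not_not.1 hz, Submodule.mem_bot] at hv
        rw [hv]
        exact V.zero_mem
    have := (isClosed_ppSubspace (hamiltonian A α)).completeSpace_coe
    -- If the orthogonal component `ψ` did not charge `U`, neither component of `h` would charge the
    -- punctured neighbourhood, and so neither would `h`.
    obtain ⟨φ, hφ, ψ, hψ, rfl⟩ :=
      (ppSubspace (hamiltonian A α)).exists_add_mem_mem_orthogonal h
    refine ⟨ψ, μ ψ, hμ.isSpectralMeasure ψ, absolutelyContinuous_of_mem hc hc1 hE₀ hμ hψ,
      fun h0 => hh ((hmem _).1 (V.add_mem (hpp hφ) ((hmem ψ).2 ?_)))⟩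
    exact measure_mono_null inter_subset_left h0

theorem sq_mem_spec_iff {A α : ℝ} (hc : Real.cos (A * Real.pi) ≠ 0) {k : ℂ} {E : ℝ}
    (hk : (E : ℂ) = k ^ 2) (hE : E ∉ squares) :
    k ^ 2 ∈ spec (hamiltonian A α) ↔ ‖xi A α k‖ ≤ 1 := by
  rw [norm_xi_le_one_iff hc hk, ← hk, ofReal_mem_spec_iff, or_iff_right hE]

theorem exists_energy {k : ℂ}
    (hk : (0 < k.re ∧ k.im = 0 ∧ ¬ ∃ n : ℕ, k = n) ∨ (k.re = 0 ∧ 0 < k.im)) :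
    ∃ E : ℝ, (E : ℂ) = k ^ 2 ∧ E ∉ squares := by
  rcases hk with ⟨h1, h2, h3⟩ | ⟨h1, h2⟩
  · have hkr : k = (k.re : ℂ) := Complex.ext rfl (by simp [h2])
    refine ⟨k.re ^ 2, by rw [Complex.ofReal_pow, ← hkr], ?_⟩
    rintro ⟨n, -, hn⟩
    refine h3 ⟨n, ?_⟩
    rw [hkr, (pow_left_inj₀ h1.le (Nat.cast_nonneg n) two_ne_zero).1 hn, Complex.ofReal_natCast]
  · have hki : k = k.im * Complex.I := Complex.ext (by simp [h1]) (by simp)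
    refine ⟨-k.im ^ 2, ?_, neg_sq_notMem_squares _⟩
    conv_rhs => rw [hki, mul_pow, Complex.I_sq]
    push_cast
    ring

end RingChain

/-! ### Assembly of the theorem -/

open UnboundedOp RingChain in
theorem mainTheorem1 (A α : ℝ) (hA : ¬ ∃ m : ℤ, A = m) :
    ((∃ m : ℤ, A - 1 / 2 = m) →
      spec (hamiltonian A α) = Complex.ofReal '' (xiZeros α ∪ squares) ∧
      (∀ E ∈ xiZeros α ∪ squares, IsInfinitelyDegenerate (hamiltonian A α) (E : ℂ)) ∧
      ppSubspace (hamiltonian A α) = ⊤) ∧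
    ((¬ ∃ m : ℤ, A - 1 / 2 = m) →
      spec (hamiltonian A α) = Complex.ofReal '' (squares ∪ bandSet A α) ∧
      (∀ k : ℂ, ((0 < k.re ∧ k.im = 0 ∧ ¬ ∃ n : ℕ, k = n) ∨ (k.re = 0 ∧ 0 < k.im)) →
        (k ^ 2 ∈ spec (hamiltonian A α) ↔ ‖xi A α k‖ ≤ 1)) ∧
      (∀ E ∈ squares, IsInfinitelyDegenerate (hamiltonian A α) (E : ℂ)) ∧
      eigenvalues (hamiltonian A α) = Complex.ofReal '' squares ∧
      ((ppSubspace (hamiltonian A α))ᗮ : Set L2Gamma) = acSubspace (hamiltonian A α) ∧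
      acSpectrum (hamiltonian A α) = bandSet A α ∧
      (∀ J, IsBand (hamiltonian A α) J → ∃ a b : ℝ, a < b ∧ J = Set.Icc a b) ∧
      ∃ J₀, IsBand (hamiltonian A α) J₀ ∧
        (∀ J, IsBand (hamiltonian A α) J → J ≠ J₀ →
          (∀ x ∈ J₀, ∀ y ∈ J, x < y) ∧
          ∃ n : ℕ, 1 ≤ n ∧ J ⊆ Set.Ioo ((n : ℝ) ^ 2) (((n : ℝ) + 1) ^ 2)) ∧
        (4 * (|Real.cos (A * Real.pi)| - 1) / Real.pi < α → J₀ ⊆ Set.Ioo 0 1) ∧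
        (α < -4 * (|Real.cos (A * Real.pi)| + 1) / Real.pi → J₀ ⊆ Set.Iio 0) ∧
        (-4 * (|Real.cos (A * Real.pi)| + 1) / Real.pi ≤ α →
          α ≤ 4 * (|Real.cos (A * Real.pi)| - 1) / Real.pi → (0 : ℝ) ∈ J₀)) := by
  have hc1 := abs_cos_lt_one hA
  constructor
  · intro h
    have hc := RingChain.cos_eq_zero_iff.2 h
    have hset : {E | E ∈ squares ∨ |disc α E| ≤ |Real.cos (A * Real.pi)|}
        = xiZeros α ∪ squares := by
      ext E
      change (E ∈ squares ∨ |disc α E| ≤ |Real.cos (A * Real.pi)|) ↔ (E ∈ xiZeros α ∨ E ∈ squares)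
      rw [mem_xiZeros_iff, hc, abs_zero, abs_nonpos_iff, or_comm]
    refine ⟨by rw [spec_hamiltonian, hset], ?_, ppSubspace_eq_top α hc⟩
    rintro E (hE | hE)
    · refine isInfinitelyDegenerate_of_eta hc ?_
      rw [eta_eq_disc, (mem_xiZeros_iff α E).1 hE, Complex.ofReal_zero]
    · exact isInfinitelyDegenerate_of_mem_squares A α hE
  · intro h
    have hc := mt RingChain.cos_eq_zero_iff.1 h
    have hset : {E | E ∈ squares ∨ |disc α E| ≤ |Real.cos (A * Real.pi)|}
        = squares ∪ bandSet A α := by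
      ext E
      exact or_congr_right (mem_bandSet_iff hc E).symm
    have hac := acSpectrum_hamiltonian α hc hc1
    choose a b hab hsub h1 h2 using exists_band α (abs_pos.2 hc) hc1
    have hbands : ∀ J, IsBand (hamiltonian A α) J → ∃ n, J = Icc (a n) (b n) := by
      rintro J ⟨E, hE, rfl⟩
      rw [hac] at hE ⊢
      obtain ⟨n, hn⟩ := exists_mem_gap (notMem_squares_of_mem_bandSet hc hc1 hE)
      exact ⟨n, connectedComponentIn_bandSet hc hc1 (hsub n) (h1 n) (h2 n) hE hn⟩
    have hlow : ∀ E ∈ Icc (a 0) (b 0), E < 1 := fun E hE => by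
      have := (hsub 0 hE).2
      norm_num at this
      exact this
    have hpi := Real.pi_pos
    have hd0 := disc_zero α
    have hgap : (0 : ℝ) ∈ gap 0 := ⟨fun h => absurd h (by omega), by norm_num⟩
    -- Energy `0` lies in the lowest gap, so its position relative to `a 0` and `b 0` is decided by
    -- comparing `disc α 0 = 1 + απ/4` with `± |cos Aπ|`; this gives the three cases for `α`.
    have ha0 := h1 0 0 hgap
    have hb0 := h2 0 0 hgap
    rw [pow_zero, one_mul, hd0] at ha0 hb0
    refine ⟨by rw [spec_hamiltonian, hset], fun k hk => ?_,
      fun E hE => isInfinitelyDegenerate_of_mem_squares A α hE, eigenvalues_hamiltonian α hc,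
      orthogonal_ppSubspace α hc hc1, hac, fun J hJ => ?_, Icc (a 0) (b 0), ?_, fun J hJ hne => ?_,
      fun hα => ?_, fun hα => ?_, fun hα hα' => ?_⟩
    · obtain ⟨E, hE, hEs⟩ := exists_energy hk
      exact sq_mem_spec_iff hc hE hEs
    · obtain ⟨n, rfl⟩ := hbands J hJ
      exact ⟨a n, b n, hab n, rfl⟩
    · have ha : a 0 ∈ gap 0 := hsub 0 (left_mem_Icc.2 (hab 0).le)
      -- The lower end point of the interval serves as the base point of its connected component.
      have haB : a 0 ∈ bandSet A α := by
        rw [mem_bandSet_iff hc, abs_disc_eq α 0, abs_le]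
        exact ⟨(h2 0 _ ha).2 (hab 0).le, (h1 0 _ ha).2 le_rfl⟩
      refine ⟨a 0, hac ▸ haB, ?_⟩
      rw [hac, connectedComponentIn_bandSet hc hc1 (hsub 0) (h1 0) (h2 0) haB ha]
    · obtain ⟨n, rfl⟩ := hbands J hJ
      have hn : 1 ≤ n := by
        by_contra hn
        rw [show n = 0 by omega] at hne
        exact hne rfl
      refine ⟨fun x hx y hy => ?_, n, hn, fun y hy => ⟨(hsub n hy).1 hn, (hsub n hy).2⟩⟩
      obtain ⟨l1, l2⟩ := lt_of_gap_of_lt (show 0 < n by omega) (hsub 0 hx) (hsub n hy)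
      exact l1.trans l2
    · rw [div_lt_iff₀ hpi] at hα
      have hpos : 0 < a 0 := by
        by_contra hle
        have := ha0.2 (not_lt.1 hle)
        linarith
      exact fun E hE => ⟨hpos.trans_le hE.1, hlow E hE⟩
    · rw [lt_div_iff₀ hpi] at hα
      have hneg : b 0 < 0 := by
        by_contra hle
        have := hb0.2 (not_lt.1 hle)
        linarith
      exact fun E hE => hE.2.trans_lt hneg
    · rw [div_le_iff₀ hpi] at hα
      rw [le_div_iff₀ hpi] at hα'
      exact ⟨ha0.1 (by linarith), hb0.1 (by linarith)⟩
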